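/- Let $M$ be a compact smooth manifold, possibly with boundary, with a smooth Riemannian metric $g_M$, let $Y$ be a compact smooth manifold without boundary with a smooth Riemannian metric $g_Y$, and equip $M\times Y$ with the product metric $ds^2=ds_M^2+ds_Y^2$. For $N=M$ or $N=M\times Y$: - A *surface* in $N$ is a compact embedded smooth hypersurface $X$, possibly with boundary, with $\partial X\subset\partial N$ and $X\setminus\partial X\subset N\setminus\partial N$; $\mathrm{area}(X)=\int_X\sqrt{h}$ is its Riemannian area with respect to the induced metric $h$. - A *boundary region* is a closed set $R\subset\partial N$ which is the closure of its interior relative to $\partial N$; $\partial R$ denotes its boundary relative to $\partial N$. - A surface $X$ is *homologous* to $R$ if $\partial X=\partial R$ and there is a region $r\subset N$ (a set with $r=\overline{\mathrm{int}\, r}$) bounded by $R$ and $X$, i.e. $r\cap\partial N=R$ and the topological frontier of $r$ in $N$ is $X$. Let $R\subset\partial M$ be a boundary region and let $X_R\subset M$ be a surface homologous to $R$ that has minimal area among all surfaces in $M$ homologous to $R$. Then $X_R\times Y$ is a surface in $M\times Y$ homologous to $R\times Y$, and it has minimal area among all surfaces in $M\times Y$ homologous to $R\times Y$. If moreover $X_R$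 is the only minimizer in $M$, then $X_R\times Y$ is the only minimizer in $M\times Y$. -/

import Mathlib

open Set MeasureTheory Manifold Bundle
open scoped ContDiff ENNReal

namespace MinimalSurface

noncomputable section

/-! In this file `N` is a manifold (possibly with boundary) modelled on `I`, and `d` is the dimension
of its hypersurfaces, so that `N` has dimension `d + 1`. -/

section Hypersurfaces

variable {E : Type*} [NormedAddCommGroup E] [NormedSpace ℝ E] {H : Type*} [TopologicalSpace H]
  (I : ModelWithCorners ℝ E H) {N : Type*} [TopologicalSpace N] [ChartedSpace H N]

/-- `X` is a surface in `N`: a compact embedded smooth hypersurface `X` with (possibly empty)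
boundary `∂X`, such that `∂X ⊆ ∂N` and `X \ ∂X ⊆ N \ ∂N`; in other words `∂X = X ∩ ∂N`.
Near an interior point of `N`, the set `X` is the regular zero set of one smooth function `f`. Near a
point of `∂N`, it is a piece `{f = 0, 0 ≤ g}` of such a zero set, bounded by `∂X = {f = 0, g = 0}`,
where the differentials of `f` and `g` are linearly independent (contact with `∂N` may be
tangential). The clause `dense_interior` says that the interior of `X` is dense in `X`. -/
structure IsSurface (X : Set N) : Prop where
  isCompact : IsCompact X
  dense_interior : X ⊆ closure (X \ I.boundary N)
  interior_point : ∀ p ∈ X, p ∉ I.boundary N →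
    ∃ (U : Set N) (f : N → ℝ), IsOpen U ∧ p ∈ U ∧ ContMDiffOn I 𝓘(ℝ, ℝ) ∞ f U ∧
      mvfderiv I f p ≠ 0 ∧ X ∩ U = {q ∈ U | f q = 0}
  boundary_point : ∀ p ∈ X, p ∈ I.boundary N →
    ∃ (U : Set N) (f g : N → ℝ), IsOpen U ∧ p ∈ U ∧
      ContMDiffOn I 𝓘(ℝ, ℝ) ∞ f U ∧ ContMDiffOn I 𝓘(ℝ, ℝ) ∞ g U ∧
      LinearIndependent ℝ ![mvfderiv I f p, mvfderiv I g p] ∧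
      X ∩ U = {q ∈ U | f q = 0 ∧ 0 ≤ g q} ∧
      X ∩ I.boundary N ∩ U = {q ∈ U | f q = 0 ∧ g q = 0}

/-- The boundary `∂R` of a subset `R` of `∂N`, relative to `∂N`. -/
def edge (R : Set N) : Set N := closure R ∩ closure (I.boundary N \ R)

/-- `R` is a boundary region: a closed subset of `∂N` which is the closure of its interior relative
to `∂N`. -/
structure IsBoundaryRegion (R : Set N) : Prop where
  isClosed : IsClosed R
  subset_boundary : R ⊆ I.boundary N
  regular : R ⊆ closure (R \ edge I R)

/-- The surface `X` is homologous to the boundary region `R` (relative to `∂X = ∂R`): there is a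
homology region `r`, the closure of an open set, which meets `∂N` in `R` and which is bounded by `R`
and `X`. (`frontier r` is the topological frontier of `r` in `N`, which does not contain the relative
interior of `R`.) -/
structure IsHomologous (R X : Set N) : Prop where
  isSurface : IsSurface I X
  boundary_eq : X ∩ I.boundary N = edge I R
  exists_region : ∃ r : Set N, closure (interior r) = r ∧ r ∩ I.boundary N = R ∧ frontier r = X

/-- Local coordinates on a subset `S` of `N` (for us: on the interior of a hypersurface): a smooth
injective immersion of an open set `source` of `ℝ^d` into `N` with values in `S`. -/
structure LocalParam (d : ℕ) (S : Set N) where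
  source : Set (EuclideanSpace ℝ (Fin d))
  toFun : EuclideanSpace ℝ (Fin d) → N
  isOpen_source : IsOpen source
  contMDiffOn : ContMDiffOn (𝓡 d) I ∞ toFun source
  injOn : InjOn toFun source
  immersion : ∀ u ∈ source, Function.Injective (mfderiv (𝓡 d) I toFun u)
  mapsTo : MapsTo toFun source S

/-- The matrix `h_{ab} = g(∂_a φ, ∂_b φ)` of the metric induced by `g` in the coordinates `φ`. -/
def inducedMetric (g : ∀ p : N, TangentSpace I p →L[ℝ] TangentSpace I p →L[ℝ] ℝ) {d : ℕ}
    (φ : EuclideanSpace ℝ (Fin d) → N) (u : EuclideanSpace ℝ (Fin d)) :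
    Matrix (Fin d) (Fin d) ℝ :=
  Matrix.of fun a b =>
    g (φ u) (mfderiv (𝓡 d) I φ u (EuclideanSpace.single a (1 : ℝ)))
      (mfderiv (𝓡 d) I φ u (EuclideanSpace.single b (1 : ℝ)))

/-- The area `∫_X √h` of a `d`-dimensional surface `X` with respect to the metric `g`. The interior
`X \ ∂N` of `X` is covered by countably many measurable pieces `φ_i(A_i)` of coordinate patches, the
area of each piece is `∫_{A_i} √(det h)`, and the total area is the infimum of the sums; it is
attained exactly when the pieces overlap in sets of measure zero only. The boundary of `X` has
measure zero and is left out. -/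
def area (g : ∀ p : N, TangentSpace I p →L[ℝ] TangentSpace I p →L[ℝ] ℝ) (d : ℕ) (X : Set N) :
    ℝ≥0∞ :=
  ⨅ (φ : ℕ → LocalParam I d (X \ I.boundary N)) (A : ℕ → Set (EuclideanSpace ℝ (Fin d)))
    (_ : ∀ i, MeasurableSet (A i) ∧ A i ⊆ (φ i).source)
    (_ : X \ I.boundary N ⊆ ⋃ i, (φ i).toFun '' A i),
    ∑' i, ∫⁻ u in A i, ENNReal.ofReal (Real.sqrt (inducedMetric I g (φ i).toFun u).det)

/-- `X` has minimal area among the surfaces homologous to `R`. -/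
def IsMinimal (g : ∀ p : N, TangentSpace I p →L[ℝ] TangentSpace I p →L[ℝ] ℝ) (d : ℕ)
    (R X : Set N) : Prop :=
  IsHomologous I R X ∧ ∀ X' : Set N, IsHomologous I R X' → area I g d X ≤ area I g d X'

/-- `X` is the only surface of minimal area among the surfaces homologous to `R`. -/
def IsUniqueMinimal (g : ∀ p : N, TangentSpace I p →L[ℝ] TangentSpace I p →L[ℝ] ℝ) (d : ℕ)
    (R X : Set N) : Prop :=
  IsMinimal I g d R X ∧ ∀ X' : Set N, IsMinimal I g d R X' → X' = X

end Hypersurfaces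

section Product

variable {E : Type*} [NormedAddCommGroup E] [NormedSpace ℝ E] {H : Type*} [TopologicalSpace H]
  {I : ModelWithCorners ℝ E H} {M : Type*} [TopologicalSpace M] [ChartedSpace H M]
  {F : Type*} [NormedAddCommGroup F] [NormedSpace ℝ F] {G : Type*} [TopologicalSpace G]
  {J : ModelWithCorners ℝ F G} {Y : Type*} [TopologicalSpace Y] [ChartedSpace G Y]

/-- The product metric `ds_M² + ds_Y²` on `M × Y`; here `T_{(x, y)}(M × Y) = T_x M × T_y Y`. -/
def productMetric (gM : ∀ x : M, TangentSpace I x →L[ℝ] TangentSpace I x →L[ℝ] ℝ)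
    (gY : ∀ y : Y, TangentSpace J y →L[ℝ] TangentSpace J y →L[ℝ] ℝ) (p : M × Y) :
    TangentSpace (I.prod J) p →L[ℝ] TangentSpace (I.prod J) p →L[ℝ] ℝ :=
  let a : E →L[ℝ] E →L[ℝ] ℝ := gM p.1
  let b : F →L[ℝ] F →L[ℝ] ℝ := gY p.2
  (a.bilinearComp (ContinuousLinearMap.fst ℝ E F) (ContinuousLinearMap.fst ℝ E F) +
    b.bilinearComp (ContinuousLinearMap.snd ℝ E F) (ContinuousLinearMap.snd ℝ E F) :
      E × F →L[ℝ] E × F →L[ℝ] ℝ)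

theorem productMetric_apply (gM : ∀ x : M, TangentSpace I x →L[ℝ] TangentSpace I x →L[ℝ] ℝ)
    (gY : ∀ y : Y, TangentSpace J y →L[ℝ] TangentSpace J y →L[ℝ] ℝ) (x : M) (y : Y)
    (v v' : TangentSpace I x) (w w' : TangentSpace J y) :
    productMetric gM gY (x, y) (v, w) (v', w') = gM x v v' + gY y w w' :=
  rfl

end Product

end

end MinimalSurface

/-! The proof slices a competitor by the fibres of `M × Y → Y`. Let `X'` be homologous to `R × Y`
and write `X'_y = {x | (x, y) ∈ X'}`. For almost every `y` the slice `X'_y` is again a surface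
homologous to `R`, so its area is at least that of the minimizer `X`. Integrating over `Y` with a
coarea inequality gives `area X' ≥ ∫_Y area X'_y ≥ area X * vol Y`, while products of patches give
`area (X × Y) ≤ area X * vol Y` (`area_prod_univ_le`). This is minimality.

Three facts carry the lower bound. Sard's theorem (`sardAt`), used through
`exists_open_null_critical_slices`, makes almost every slice transverse at interior points. At the
boundary transversality is automatic: `∂X' = ∂R × Y` contains whole vertical fibres, so vertical
derivatives of the defining functions vanish there (`IsHomologous.exists_boundary_slice`). A
transverse slice of the homology region is then a homology region for the slice
(`IsHomologous.slice`). The coarea inequality itself is pointwise linear algebra: in coordinates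
fibred over `Y`, the metric of `Y` enters only one diagonal block of the induced metric, and a Schur
complement gives `det A * det G ≤ det` of the whole matrix (`det_mul_det_le_det_fromBlocks`).

For uniqueness, equality of areas forces almost every slice to have minimal area, hence to equal
`X`. Since `X'` is closed it contains `X × Y`. A further point of `X'` off `X × Y` would come with
an interior point of `X'` nearby, around which `X'` has area at least some `δ > 0`; this area is
invisible to almost every slice, so `area X * vol Y + δ ≤ area X'` (`IsHomologous.add_le_area`), a
contradiction when `area X` is finite. Finiteness is itself drawn from uniqueness: were the minimal
area infinite, every competitor would be a minimizer, and adding a small sphere outside the region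
produces a second one (`IsUniqueMinimal.area_ne_top`). -/

namespace MinimalSurface

noncomputable section

/-! ### Straightening of submersions by the inverse function theorem. -/

section Straightening

/-- `P` is a projection onto `ker L` followed by an identification of `ker L` with `K`; the pair
`(L, P)` is injective between spaces of equal dimension. -/
theorem exists_complementary_map {E F K : Type*} [NormedAddCommGroup E] [NormedSpace ℝ E]
    [FiniteDimensional ℝ E] [NormedAddCommGroup F] [NormedSpace ℝ F] [FiniteDimensional ℝ F]
    [NormedAddCommGroup K] [NormedSpace ℝ K] [FiniteDimensional ℝ K]
    (L : E →L[ℝ] F) (hL : Function.Surjective L)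
    (hd : Module.finrank ℝ E = Module.finrank ℝ F + Module.finrank ℝ K) :
    ∃ (P : E →L[ℝ] K) (e : E ≃L[ℝ] F × K), (e : E →L[ℝ] F × K) = L.prod P := by
  have hker : Module.finrank ℝ (LinearMap.ker (L : E →ₗ[ℝ] F)) = Module.finrank ℝ K := by
    have h1 := LinearMap.finrank_range_add_finrank_ker (L : E →ₗ[ℝ] F)
    rw [LinearMap.range_eq_top.2 hL, finrank_top] at h1
    omega
  obtain ⟨Q, hQ⟩ := (LinearMap.ker (L : E →ₗ[ℝ] F)).subtype.exists_leftInverse_of_injective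
    (Submodule.ker_subtype _)
  let c := LinearEquiv.ofFinrankEq _ _ hker
  let P : E →ₗ[ℝ] K := (c : _ →ₗ[ℝ] K).comp Q
  have hinj : Function.Injective ((L : E →ₗ[ℝ] F).prod P) := by
    rw [← LinearMap.ker_eq_bot, LinearMap.ker_eq_bot']
    intro x hx
    obtain ⟨h1, h2⟩ := Prod.mk.inj (show (L x, P x) = (0, 0) from hx)
    have h3 : Q x = 0 := c.map_eq_zero_iff.1 h2
    have h4 := LinearMap.congr_fun hQ ⟨x, h1⟩
    simp only [LinearMap.comp_apply, Submodule.subtype_apply, LinearMap.id_apply, h3] at h4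
    exact (congrArg Subtype.val h4).symm
  let e := LinearEquiv.ofInjectiveOfFinrankEq ((L : E →ₗ[ℝ] F).prod P) hinj (by simp [hd])
  refine ⟨LinearMap.toContinuousLinearMap P, e.toContinuousLinearEquiv, ?_⟩
  ext x <;> rfl

/-- Local straightening of a smooth submersion. -/
theorem exists_straightening {E F K : Type*} [NormedAddCommGroup E] [NormedSpace ℝ E]
    [FiniteDimensional ℝ E] [NormedAddCommGroup F] [NormedSpace ℝ F]
    [NormedAddCommGroup K] [NormedSpace ℝ K]
    {f : E → F} {U : Set E} {a : E} (hU : IsOpen U) (ha : a ∈ U)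
    (hf : ContDiffOn ℝ ∞ f U) (P : E →L[ℝ] K) (e : E ≃L[ℝ] F × K)
    (he : (e : E →L[ℝ] F × K) = (fderiv ℝ f a).prod P) :
    ∃ Φ : OpenPartialHomeomorph E (F × K), a ∈ Φ.source ∧ Φ.source ⊆ U ∧
      (∀ x, Φ x = (f x, P x)) ∧ ContDiffOn ℝ ∞ Φ.symm Φ.target := by
  let G : E → F × K := fun x => (f x, P x)
  have hG : ContDiffOn ℝ ∞ G U := hf.prodMk P.contDiff.contDiffOn
  have hGd : ∀ x ∈ U, HasFDerivAt G ((fderiv ℝ f x).prod P) x := fun x hx =>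
    (((hf.contDiffAt (hU.mem_nhds hx)).differentiableAt (by simp)).hasFDerivAt).prodMk
      P.hasFDerivAt
  have hGa : ContDiffAt ℝ ∞ G a := hG.contDiffAt (hU.mem_nhds ha)
  have hGe : HasFDerivAt G (e : E →L[ℝ] F × K) a := by rw [he]; exact hGd a ha
  let Φ₀ := hGa.toOpenPartialHomeomorph G hGe (by simp)
  have hcont : ContinuousOn (fun x => (fderiv ℝ f x).prod P) U := by
    have h1 : ContinuousOn (fderiv ℝ f) U := hf.continuousOn_fderiv_of_isOpen hU (by simp)
    exact ((ContinuousLinearMap.prodₗᵢ ℝ : ((E →L[ℝ] F) × (E →L[ℝ] K)) ≃ₗᵢ[ℝ] _).continuous).comp_continuousOn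
      (h1.prodMk continuousOn_const)
  -- The domain is cut down to the open set where the derivative of `(f, P)` is invertible, so that
  -- the inverse is smooth on the whole target and not only at the image of `a`.
  let W : Set E := U ∩ (fun x => (fderiv ℝ f x).prod P) ⁻¹'
    (range ((↑) : (E ≃L[ℝ] F × K) → E →L[ℝ] F × K))
  have hW : IsOpen W := hcont.isOpen_inter_preimage hU ContinuousLinearEquiv.isOpen
  have haW : a ∈ W := ⟨ha, e, he⟩
  refine ⟨Φ₀.restrOpen W hW, ?_, ?_, fun x => rfl, ?_⟩
  · exact ⟨hGa.mem_toOpenPartialHomeomorph_source hGe (by simp), haW⟩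
  · exact fun x hx => hx.2.1
  · intro y hy
    have hy' : (Φ₀.restrOpen W hW).symm y ∈ Φ₀.source ∩ W :=
      (Φ₀.restrOpen W hW).map_target hy
    obtain ⟨e', he'⟩ := hy'.2.2
    refine ((Φ₀.restrOpen W hW).contDiffAt_symm hy (f₀' := e') ?_ ?_).contDiffWithinAt
    · rw [he']
      exact hGd _ hy'.2.1
    · exact hG.contDiffAt (hU.mem_nhds hy'.2.1)

end Straightening

/-! ### Sard's theorem for real-valued functions. -/

section Sard

/-- An order `j` Taylor estimate at points where the derivatives of order at most `j` vanish. -/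
theorem norm_le_pow_of_iteratedFDeriv_eq_zero {E : Type} [NormedAddCommGroup E] [NormedSpace ℝ E]
    [FiniteDimensional ℝ E] {U : Set E} (hU : IsOpen U) {a : E} (ha : a ∈ U) (j : ℕ) :
    ∀ {F : Type} [NormedAddCommGroup F] [NormedSpace ℝ F] (G : E → F), ContDiffOn ℝ ∞ G U →
      ∃ r > 0, ∃ C : ℝ, 0 ≤ C ∧ Metric.ball a r ⊆ U ∧ ∀ x ∈ Metric.ball a r,
        ∀ y ∈ Metric.ball a r, (∀ i ≤ j, iteratedFDeriv ℝ i G x = 0) →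
          ‖G y‖ ≤ C * ‖y - x‖ ^ (j + 1) := by
  -- The mean value inequality on a segment from `x` gains one power of `‖y - x‖`. The induction on
  -- `j` applies the estimate to `fderiv ℝ G`, whose values lie in another space; hence `F` is
  -- quantified inside the statement.
  have key : ∀ {F : Type} [NormedAddCommGroup F] [NormedSpace ℝ F] (G : E → F) (r C : ℝ) (j : ℕ),
      ContDiffOn ℝ ∞ G U → Metric.ball a r ⊆ U → ∀ x ∈ Metric.ball a r, ∀ y ∈ Metric.ball a r,
        G x = 0 → 0 ≤ C → (∀ z ∈ Metric.ball a r, ‖fderiv ℝ G z‖ ≤ C * ‖z - x‖ ^ j) →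
        ‖G y‖ ≤ C * ‖y - x‖ ^ (j + 1) := by
    intro F _ _ G r C j hG hr x hx y hy hGx hC hb
    have h1 : ∀ z ∈ segment ℝ x y, ‖fderiv ℝ G z‖ ≤ C * ‖y - x‖ ^ j := by
      intro z hz
      refine (hb z ((convex_ball a r).segment_subset hx hy hz)).trans ?_
      have := norm_sub_le_of_mem_segment hz
      gcongr
    have := (convex_segment x y).norm_image_sub_le_of_norm_fderiv_le (𝕜 := ℝ) (f := G)
      (fun z hz => (hG.contDiffAt (hU.mem_nhds
        (hr ((convex_ball a r).segment_subset hx hy hz)))).differentiableAt (by simp)) h1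
      (left_mem_segment ℝ x y) (right_mem_segment ℝ x y)
    rwa [hGx, sub_zero, mul_assoc, ← pow_succ] at this
  induction j with
  | zero =>
    intro F _ _ G hG
    have hc : ContinuousAt (fderiv ℝ G) a :=
      (hG.continuousOn_fderiv_of_isOpen hU (by simp)).continuousAt (hU.mem_nhds ha)
    obtain ⟨r, hr, hb⟩ := Metric.mem_nhds_iff.1 (Filter.inter_mem (hU.mem_nhds ha)
      (hc.norm.eventually_le_const (lt_add_one ‖fderiv ℝ G a‖)))
    refine ⟨r, hr, ‖fderiv ℝ G a‖ + 1, by positivity, fun x hx => (hb hx).1, ?_⟩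
    intro x hx y hy h0
    refine key G r _ 0 hG (fun x hx => (hb hx).1) x hx y hy ?_ (by positivity) ?_
    · have := congrArg (fun T => T ![]) (h0 0 le_rfl)
      simpa using this
    · intro z hz
      simpa using (hb hz).2
  | succ j ih =>
    intro F _ _ G hG
    obtain ⟨r, hr, C, hC, hb, h⟩ := ih (fderiv ℝ G) (hG.fderiv_of_isOpen hU (by simp))
    refine ⟨r, hr, C, hC, hb, fun x hx y hy h0 => ?_⟩
    refine key G r C (j + 1) hG hb x hx y hy ?_ hC (fun z hz => h x hx z hz ?_)
    · have := congrArg (fun T => T ![]) (h0 0 (by omega))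
      simpa using this
    · intro i hi
      rw [← norm_eq_zero, norm_iteratedFDeriv_fderiv, h0 (i + 1) (by omega), norm_zero]

/-- By the Lindelöf property countably many of the neighbourhoods `V` cover `S`. -/
theorem measure_image_null_of_locally {X Z : Type*} [TopologicalSpace X]
    [SecondCountableTopology X] [MeasurableSpace Z] (μ : Measure Z) (h : X → Z) (S : Set X)
    (H : ∀ x ∈ S, ∃ V, IsOpen V ∧ x ∈ V ∧ μ (h '' (S ∩ V)) = 0) : μ (h '' S) = 0 := by
  choose! V hV hxV hnull using H
  obtain ⟨t, htS, htc, ht⟩ := TopologicalSpace.countable_cover_nhdsWithin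
    (f := V) (s := S) (fun x hx => mem_nhdsWithin_of_mem_nhds ((hV x hx).mem_nhds (hxV x hx)))
  have : h '' S ⊆ ⋃ x ∈ t, h '' (S ∩ V x) := by
    rintro _ ⟨x, hx, rfl⟩
    obtain ⟨y, hy, hxy⟩ := mem_iUnion₂.1 (ht hx)
    exact mem_iUnion₂.2 ⟨y, hy, x, ⟨hx, hxy⟩, rfl⟩
  exact measure_mono_null this ((measure_biUnion_null_iff htc).2 fun x hx => hnull x (htS hx))

/-- Sard's theorem for real functions on spaces of dimension `d`. -/
def SardAt (d : ℕ) : Prop :=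
  ∀ (E : Type) [NormedAddCommGroup E] [NormedSpace ℝ E] [FiniteDimensional ℝ E] (U : Set E)
    (h : E → ℝ), Module.finrank ℝ E = d → IsOpen U → ContDiffOn ℝ ∞ h U →
    volume (h '' {x ∈ U | fderiv ℝ h x = 0}) = 0

/-- The critical values of a function on a regular hypersurface `{w = 0}` form a null set. -/
theorem SardAt.exists_open_null {d : ℕ} (hd : SardAt d) {E : Type} [NormedAddCommGroup E]
    [NormedSpace ℝ E] [FiniteDimensional ℝ E] (hE : Module.finrank ℝ E = d + 1) {U : Set E}
    (hU : IsOpen U) {w h : E → ℝ} (hw : ContDiffOn ℝ ∞ w U) (hh : ContDiffOn ℝ ∞ h U) {a : E}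
    (ha : a ∈ U) (hwa : fderiv ℝ w a ≠ 0) :
    ∃ V, IsOpen V ∧ a ∈ V ∧ V ⊆ U ∧ volume (h '' {x ∈ V | w x = 0 ∧
      ∀ u, fderiv ℝ w x u = 0 → fderiv ℝ h x u = 0}) = 0 := by
  obtain ⟨P, e, he⟩ := exists_complementary_map (K := EuclideanSpace ℝ (Fin d)) (fderiv ℝ w a)
    (LinearMap.surjective (f := (fderiv ℝ w a : E →ₗ[ℝ] ℝ))
      (fun h => hwa (ContinuousLinearMap.coe_injective h))) (by simp [hE, add_comm])
  obtain ⟨Φ, haΦ, hΦU, hΦ, hΦs⟩ := exists_straightening hU ha hw P e he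
  refine ⟨Φ.source, Φ.open_source, haΦ, hΦU, ?_⟩
  let O : Set (EuclideanSpace ℝ (Fin d)) := (fun z => ((0 : ℝ), z)) ⁻¹' Φ.target
  have hO : IsOpen O := Φ.open_target.preimage (by fun_prop)
  -- `γ` parametrizes the hypersurface `{w = 0}` by an open subset of `ℝ^d`. Its derivative takes
  -- values in `ker dw`, so a point where `dh` vanishes on `ker dw` is an ordinary critical point of
  -- `h ∘ γ`.
  let γ : EuclideanSpace ℝ (Fin d) → E := fun z => Φ.symm (0, z)
  have hγ : ContDiffOn ℝ ∞ γ O := hΦs.comp (by fun_prop) (fun z hz => hz)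
  have hγU : MapsTo γ O U := fun z hz => hΦU (Φ.map_target hz)
  refine measure_mono_null ?_ (hd (EuclideanSpace ℝ (Fin d)) O (h ∘ γ) (by simp) hO
    (hh.comp hγ hγU))
  rintro _ ⟨x, ⟨hxV, hx0, hx⟩, rfl⟩
  have hΦx : Φ x = (0, P x) := by rw [hΦ, hx0]
  have hxO : P x ∈ O := by
    change ((0 : ℝ), P x) ∈ Φ.target
    rw [← hΦx]; exact Φ.map_source hxV
  have hγx : γ (P x) = x := by
    change Φ.symm (0, P x) = x
    rw [← hΦx, Φ.left_inv hxV]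
  have dγ := ((hγ.contDiffAt (hO.mem_nhds hxO)).differentiableAt (by simp)).hasFDerivAt
  have dw : HasFDerivAt w (fderiv ℝ w x) (γ (P x)) := by
    rw [hγx]
    exact ((hw.contDiffAt (hU.mem_nhds (hΦU hxV))).differentiableAt (by simp)).hasFDerivAt
  have dh : HasFDerivAt h (fderiv ℝ h x) (γ (P x)) := by
    rw [hγx]
    exact ((hh.contDiffAt (hU.mem_nhds (hΦU hxV))).differentiableAt (by simp)).hasFDerivAt
  have hz : (fderiv ℝ w x).comp (fderiv ℝ γ (P x)) = 0 := by
    have h1 := dw.comp (P x) dγ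
    have h2 : HasFDerivAt (w ∘ γ) (0 : EuclideanSpace ℝ (Fin d) →L[ℝ] ℝ) (P x) := by
      refine (hasFDerivAt_const (0 : ℝ) (P x)).congr_of_eventuallyEq ?_
      filter_upwards [hO.mem_nhds hxO] with z hz
      have := hΦ (Φ.symm (0, z))
      rw [Φ.right_inv hz] at this
      exact (congrArg Prod.fst this).symm
    exact h1.unique h2
  refine ⟨P x, ⟨hxO, ?_⟩, by simp [hγx]⟩
  rw [(dh.comp (P x) dγ).fderiv]
  ext u
  exact hx _ (by simpa using congrArg (fun T => T u) hz)

theorem exists_scalar_component {E A : Type*} [NormedAddCommGroup E] [NormedSpace ℝ E]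
    [NormedAddCommGroup A] [NormedSpace ℝ A] {U : Set E} (hU : IsOpen U) {x : E} (hx : x ∈ U)
    {G : E → A} (hG : ContDiffOn ℝ ∞ G U) (ev : A →L[ℝ] ℝ) (u : E) (hu : ev (fderiv ℝ G x u) ≠ 0) :
    ∃ w : E → ℝ, ContDiffOn ℝ ∞ w U ∧ fderiv ℝ w x ≠ 0 ∧ ∀ y, G y = 0 → w y = 0 := by
  refine ⟨fun y => ev (G y), ev.contDiff.comp_contDiffOn hG, fun h0 => hu ?_, fun y hy => ?_⟩
  · have h1 : HasFDerivAt (fun y => ev (G y)) (ev.comp (fderiv ℝ G x)) x :=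
      ev.hasFDerivAt.comp x
        ((hG.contDiffAt (hU.mem_nhds hx)).differentiableAt (by simp)).hasFDerivAt
    rw [h1.fderiv] at h0
    exact congrArg (fun T => T u) h0
  · simp [hy]

/-- Induction on the dimension, splitting the critical set by the order of vanishing of `D = dh`. On
`Flat`, where the derivatives of `D` up to order `d` vanish, Taylor's estimate makes `h` Hölder with
exponent `d + 2`; in dimension `d + 1` the image then has Hausdorff dimension at most `(d + 1) / (d
+ 2) < 1`. Any other critical point lies in some `S k`: a scalar component of the `k`-th derivative
of `D` vanishes on `S k` and has nonzero differential at the point, so near it `S k` lies in a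
regular hypersurface of dimension `d`, to which the induction hypothesis applies. -/
theorem sardAt (d : ℕ) : SardAt d := by
  induction d with
  | zero =>
    intro E _ _ _ U h hE hU hh
    have : Subsingleton E := Module.finrank_zero_iff.1 hE
    exact (Set.subsingleton_of_subsingleton.image h).measure_zero _
  | succ d ih =>
    intro E _ _ _ U h hE hU hh
    let D := fderiv ℝ h
    have hD : ContDiffOn ℝ ∞ D U := hh.fderiv_of_isOpen hU (by simp)
    let Flat : Set E := {x ∈ U | ∀ i ≤ d, iteratedFDeriv ℝ i D x = 0}
    let S : ℕ → Set E := fun k => {x ∈ U | D x = 0 ∧ iteratedFDeriv ℝ k D x = 0 ∧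
      iteratedFDeriv ℝ (k + 1) D x ≠ 0}
    have hsub : {x ∈ U | D x = 0} ⊆ Flat ∪ ⋃ k, S k := by
      rintro x ⟨hxU, hx⟩
      by_cases hf : ∀ i ≤ d, iteratedFDeriv ℝ i D x = 0
      · exact Or.inl ⟨hxU, hf⟩
      right
      push Not at hf
      obtain ⟨i, -, hi⟩ := hf
      have hex : ∃ i, iteratedFDeriv ℝ i D x ≠ 0 := ⟨i, hi⟩
      have h0 : iteratedFDeriv ℝ 0 D x = 0 := by ext m; simp [hx]
      classical
      have hpos : Nat.find hex ≠ 0 := fun h => Nat.find_spec hex (by rw [h, h0])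
      obtain ⟨k, hk⟩ := Nat.exists_eq_succ_of_ne_zero hpos
      refine mem_iUnion.2 ⟨k, hxU, hx, ?_, ?_⟩
      · have := Nat.find_min hex (m := k) (by omega)
        simpa using this
      · have := Nat.find_spec hex
        rwa [hk] at this
    refine measure_mono_null (image_mono hsub) ?_
    rw [image_union, image_iUnion]
    refine measure_union_null ?_ (measure_iUnion_null fun k => ?_)
    · have hdim : dimH (h '' Flat) ≤ dimH Flat / ((d + 2 : ℕ) : NNReal) := by
        refine dimH_image_le_of_locally_holder_on (by positivity) fun x hx => ?_
        obtain ⟨r, hr, C, hC, hrU, hb⟩ := norm_le_pow_of_iteratedFDeriv_eq_zero hU hx.1 d D hD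
        refine ⟨C.toNNReal, Flat ∩ Metric.ball x r,
          inter_mem_nhdsWithin _ (Metric.ball_mem_nhds x hr), ?_⟩
        intro y hy z hz
        -- The bound of order `d + 1` on `dh` integrates along the segment to order `d + 2` for `h`.
        have h1 : ∀ u ∈ segment ℝ y z, ‖fderiv ℝ h u‖ ≤ C * ‖z - y‖ ^ (d + 1) := by
          intro u hu
          have hu' := (convex_ball x r).segment_subset hy.2 hz.2 hu
          refine (hb y hy.2 u hu' hy.1.2).trans ?_
          have := norm_sub_le_of_mem_segment hu
          gcongr
        have h2 := (convex_segment y z).norm_image_sub_le_of_norm_fderiv_le (𝕜 := ℝ) (f := h)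
          (fun u hu => (hh.contDiffAt (hU.mem_nhds (hrU
            ((convex_ball x r).segment_subset hy.2 hz.2 hu)))).differentiableAt (by simp)) h1
          (left_mem_segment ℝ y z) (right_mem_segment ℝ y z)
        rw [mul_assoc, ← pow_succ, ← dist_eq_norm, ← dist_eq_norm, dist_comm, dist_comm z y] at h2
        rw [edist_dist, edist_dist, NNReal.coe_natCast, ENNReal.rpow_natCast,
          ← ENNReal.ofReal_pow dist_nonneg, ← ENNReal.ofReal_coe_nnreal, Real.coe_toNNReal _ hC,
          ← ENNReal.ofReal_mul hC]
        exact ENNReal.ofReal_le_ofReal h2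
      have hlt : dimH (h '' Flat) < ((1 : NNReal) : ENNReal) := by
        refine hdim.trans_lt ?_
        refine (ENNReal.div_le_div_right ((dimH_mono (subset_univ Flat)).trans
          (Real.dimH_univ_eq_finrank E).le) _).trans_lt ?_
        rw [hE]
        refine ENNReal.div_lt_of_lt_mul ?_
        simp only [ENNReal.coe_one, one_mul, ENNReal.coe_natCast]
        exact_mod_cast Nat.lt_succ_self (d + 1)
      have := hausdorffMeasure_of_dimH_lt hlt
      simpa [MeasureTheory.hausdorffMeasure_real] using this
    · refine measure_image_null_of_locally volume h _ fun x hx => ?_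
      obtain ⟨hxU, hDx, hk0, hk1⟩ := hx
      have hk : ContDiffOn ℝ ∞ (iteratedFDeriv ℝ k D) U := fun y hy =>
        (ContDiffAt.iteratedFDeriv_right (hD.contDiffAt (hU.mem_nhds hy)) (le_refl _)
          ).contDiffWithinAt
      obtain ⟨v, hv⟩ : ∃ v, iteratedFDeriv ℝ (k + 1) D x v ≠ 0 := by
        by_contra! hcon
        exact hk1 (ContinuousMultilinearMap.ext hcon)
      obtain ⟨u, hu⟩ : ∃ u, iteratedFDeriv ℝ (k + 1) D x v u ≠ 0 := by
        by_contra! hcon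
        exact hv (ContinuousLinearMap.ext hcon)
      -- The `(k+1)`-st derivative at `v` is the derivative, in the direction `v 0`, of the `k`-th
      -- one evaluated at `Fin.tail v`; `ev` therefore picks a scalar component with nonzero
      -- differential at `x`.
      let ev : (E [×k]→L[ℝ] (E →L[ℝ] ℝ)) →L[ℝ] ℝ :=
        (ContinuousLinearMap.apply ℝ ℝ u).comp
          (ContinuousMultilinearMap.apply ℝ (fun _ : Fin k => E) (E →L[ℝ] ℝ) (Fin.tail v))
      obtain ⟨w, hw, hwx, hw0⟩ := exists_scalar_component hU hxU hk ev (v 0) hu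
      obtain ⟨V, hV, hxV, hVU, hnull⟩ := ih.exists_open_null hE hU hw hh hxU hwx
      refine ⟨V, hV, hxV, measure_mono_null (image_mono ?_) hnull⟩
      rintro y ⟨⟨hyU, hDy, hky, -⟩, hyV⟩
      refine ⟨hyV, ?_, fun u _ => ?_⟩
      · exact hw0 y hky
      · change D y u = 0
        rw [hDy]; rfl

end Sard

/-! ### From real-valued Sard to almost every horizontal slice. -/

section CriticalSlices

/-- If `{k = 0}` is a regular hypersurface transverse to a vertical vector at `p`, then almost every
horizontal slice of it is regular near `p`. -/
theorem exists_open_null_critical_slices {E₁ E₂ : Type} [NormedAddCommGroup E₁] [NormedSpace ℝ E₁]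
    [FiniteDimensional ℝ E₁] [NormedAddCommGroup E₂] [NormedSpace ℝ E₂] [FiniteDimensional ℝ E₂]
    [MeasurableSpace E₂] [BorelSpace E₂] (μ : Measure E₂) [μ.IsAddHaarMeasure]
    {O : Set (E₁ × E₂)} (hO : IsOpen O) {k : E₁ × E₂ → ℝ} (hk : ContDiffOn ℝ ∞ k O)
    {p : E₁ × E₂} (hp : p ∈ O) {e : E₂} (he : fderiv ℝ k p (0, e) ≠ 0) :
    ∃ V, IsOpen V ∧ p ∈ V ∧ V ⊆ O ∧
      μ {b | ∃ a, (a, b) ∈ V ∧ k (a, b) = 0 ∧ ∀ u, fderiv ℝ k (a, b) (u, 0) = 0} = 0 := by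
  have hdk : ContinuousOn (fderiv ℝ k) O := hk.continuousOn_fderiv_of_isOpen hO (by simp)
  have hdke : ContinuousOn (fun q => fderiv ℝ k q (0, e)) O := hdk.clm_apply continuousOn_const
  have hO' : IsOpen (O ∩ (fun q => fderiv ℝ k q (0, e)) ⁻¹' {0}ᶜ) :=
    hdke.isOpen_inter_preimage hO isOpen_compl_singleton
  obtain ⟨r, hr, hrO⟩ := Metric.nhds_basis_closedBall.mem_iff.1 (hO'.mem_nhds ⟨hp, he⟩)
  refine ⟨Metric.ball p r, Metric.isOpen_ball, Metric.mem_ball_self hr,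
    fun q hq => (hrO (Metric.ball_subset_closedBall hq)).1, ?_⟩
  have hKO : Metric.closedBall p r ⊆ O := fun q hq => (hrO hq).1
  let D : E₁ × E₂ → E₁ →L[ℝ] ℝ := fun q => (fderiv ℝ k q).comp (ContinuousLinearMap.inl ℝ E₁ E₂)
  have hD : ContinuousOn D O := hdk.clm_comp continuousOn_const
  let C : Set (E₁ × E₂) := Metric.closedBall p r ∩ (fun q => (k q, D q)) ⁻¹' {(0, 0)}
  -- On the closed ball the bad set is compact, so its projection `T` is closed, hence measurable,
  -- as the Fubini argument below requires.
  have hC : IsCompact C := (isCompact_closedBall p r).of_isClosed_subset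
    (((hk.continuousOn.mono hKO).prodMk (hD.mono hKO)).preimage_isClosed_of_isClosed
      Metric.isClosed_closedBall isClosed_singleton) inter_subset_left
  let T : Set E₂ := Prod.snd '' C
  have hT : IsClosed T := (hC.image continuous_snd).isClosed
  suffices hnull : μ T = 0 by
    refine measure_mono_null ?_ hnull
    rintro b ⟨a, haV, hka, hda⟩
    refine ⟨(a, b), ⟨Metric.ball_subset_closedBall haV, ?_⟩, rfl⟩
    refine Prod.ext hka (ContinuousLinearMap.ext fun u => hda u)
  suffices hae : ∀ᵐ b ∂μ, b ∈ Tᶜ by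
    simpa [ae_iff] using hae
  -- By Fubini it suffices that each line `y + ℝ e` meets `T` in a null set. Over such a line the
  -- base is one-dimensional, so Sard's theorem for real functions can be applied to the height
  -- function on `{k ∘ j = 0}`.
  let L : ℝ →ₗ[ℝ] E₂ := LinearMap.toSpanSingleton ℝ E₂ e
  refine MeasureTheory.ae_mem_of_ae_add_linearMap_mem L volume μ hT.isOpen_compl.measurableSet
    fun y => ?_
  let j : E₁ × ℝ → E₁ × E₂ := fun q => (q.1, y + q.2 • e)
  have hj : ContDiff ℝ ∞ j := by fun_prop
  let U : Set (E₁ × ℝ) := j ⁻¹' O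
  have hU : IsOpen U := hO.preimage hj.continuous
  have hw : ContDiffOn ℝ ∞ (k ∘ j) U := hk.comp hj.contDiffOn (fun q hq => hq)
  have hdj : ∀ q, HasFDerivAt j ((ContinuousLinearMap.fst ℝ E₁ ℝ).prod
      ((ContinuousLinearMap.snd ℝ E₁ ℝ).smulRight e)) q := fun q =>
    hasFDerivAt_fst.prodMk ((hasFDerivAt_snd.smul_const e).const_add y)
  have hdw : ∀ q ∈ U, ∀ u s, fderiv ℝ (k ∘ j) q (u, s) = fderiv ℝ k (j q) (u, s • e) := by
    intro q hq u s
    have := (((hk.contDiffAt (hO.mem_nhds hq)).differentiableAt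
      (by simp)).hasFDerivAt).comp q (hdj q)
    rw [this.fderiv]
    rfl
  have himg : volume (Prod.snd '' (j ⁻¹' C)) = 0 := by
    refine measure_image_null_of_locally volume _ _ fun q hq => ?_
    have hqU : q ∈ U := hKO hq.1
    have hne : fderiv ℝ (k ∘ j) q ≠ 0 := by
      intro h0
      refine (hrO hq.1).2 ?_
      have := hdw q hqU 0 1
      rw [h0, one_smul] at this
      exact this.symm
    obtain ⟨V, hV, hqV, hVU, hnull⟩ := (sardAt (Module.finrank ℝ E₁)).exists_open_null
      (by simp) hU hw (h := Prod.snd) contDiff_snd.contDiffOn hqU hne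
    refine ⟨V, hV, hqV, measure_mono_null (image_mono ?_) hnull⟩
    rintro q' ⟨hq', hqV'⟩
    have hq2 := hq'.2
    simp only [mem_preimage, mem_singleton_iff, Prod.mk.injEq] at hq2
    refine ⟨hqV', hq2.1, ?_⟩
    rintro ⟨u, s⟩ hus
    rw [hdw q' (hVU hqV')] at hus
    -- At a bad point the horizontal derivative of `k` vanishes and its derivative along `e` does
    -- not, so a vector `(u, s)` tangent to `{k ∘ j = 0}` has `s = 0`: bad points are critical for
    -- the height.
    have h1 : fderiv ℝ k (j q') (u, s • e) =
        fderiv ℝ k (j q') (u, 0) + s * fderiv ℝ k (j q') (0, e) := by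
      rw [← smul_eq_mul, ← map_smul, ← map_add]
      simp
    have h2 : fderiv ℝ k (j q') (u, 0) = 0 := congrArg (fun A => A u) hq2.2
    rw [h1, h2, zero_add, mul_eq_zero] at hus
    have h3 : s = 0 := hus.resolve_right (hrO hq'.1).2
    simp [fderiv_snd, h3]
  have : {s : ℝ | ¬ (y + L s ∈ Tᶜ)} ⊆ Prod.snd '' (j ⁻¹' C) := by
    intro s hs
    simp only [mem_compl_iff, not_not, mem_ofPred_eq] at hs
    obtain ⟨⟨a, b⟩, hab, hb⟩ := hs
    refine ⟨(a, s), ?_, rfl⟩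
    have : j (a, s) = (a, b) := by
      exact Prod.ext rfl hb.symm
    rwa [mem_preimage, this]
  exact measure_mono_null this himg

end CriticalSlices

/-! ### Determinant inequalities behind the coarea inequality. -/

section Determinants

open Matrix
open scoped MatrixOrder

/-- All eigenvalues of `1 + B` are at least `1`. -/
theorem one_le_det_one_add {ι : Type*} [Fintype ι] [DecidableEq ι] {B : Matrix ι ι ℝ}
    (hB : B.PosSemidef) : 1 ≤ (1 + B).det := by
  have hH : (1 + B).IsHermitian := isHermitian_one.add hB.1
  rw [hH.det_eq_prod_eigenvalues]
  refine Finset.one_le_prod fun i _ => ?_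
  have h1 := hH.eigenvalues_eq i
  set v : ι → ℝ := ⇑(hH.eigenvectorBasis i) with hv
  have h2 : star v ⬝ᵥ v = 1 := by
    have := hH.eigenvectorBasis.orthonormal.1 i
    have h3 : inner ℝ (hH.eigenvectorBasis i) (hH.eigenvectorBasis i) = (1 : ℝ) := by
      rw [real_inner_self_eq_norm_sq, this, one_pow]
    rw [EuclideanSpace.inner_eq_star_dotProduct] at h3
    rw [dotProduct_comm]
    exact h3
  have h4 := hB.dotProduct_mulVec_nonneg v
  simp only [add_mulVec, one_mulVec, dotProduct_add, h2] at h1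
  simp only [RCLike.re_to_real] at h1
  simp only [RCLike.ofReal_real_eq_id, id_eq]
  rw [h1]
  linarith

/-- If `A` is positive definite, write `A = Sᴴ S` and factor `A + B = Sᴴ (1 + S⁻ᴴ B S⁻¹) S`. If `A`
is singular, the left side is zero. -/
theorem det_le_det_add {ι : Type*} [Fintype ι] [DecidableEq ι] {A B : Matrix ι ι ℝ}
    (hA : A.PosSemidef) (hB : B.PosSemidef) : A.det ≤ (A + B).det := by
  by_cases h : A.PosDef
  · obtain ⟨S, hS⟩ := CStarAlgebra.nonneg_iff_eq_star_mul_self.1 hA.nonneg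
    rw [star_eq_conjTranspose] at hS
    have hdS : IsUnit S.det := by
      rw [isUnit_iff_ne_zero]
      intro h0
      have := h.det_pos
      rw [hS, det_mul, h0, mul_zero] at this
      exact this.false
    have h1 : A + B = Sᴴ * (1 + (S⁻¹)ᴴ * B * S⁻¹) * S := by
      have e1 : S⁻¹ * S = 1 := nonsing_inv_mul _ hdS
      have e2 : Sᴴ * (S⁻¹)ᴴ = 1 := by rw [← conjTranspose_mul, e1, conjTranspose_one]
      have e3 : Sᴴ * ((S⁻¹)ᴴ * B * S⁻¹) * S = (Sᴴ * (S⁻¹)ᴴ) * B * (S⁻¹ * S) := by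
        simp only [Matrix.mul_assoc]
      rw [Matrix.mul_add, Matrix.add_mul, e3, e1, e2, hS]
      simp
    have h2 := one_le_det_one_add (hB.conjTranspose_mul_mul_same S⁻¹)
    have h3 : 0 ≤ Sᴴ.det * S.det := by
      rw [← det_mul, ← hS]; exact hA.det_nonneg
    rw [h1, hS, det_mul, det_mul, det_mul]
    nlinarith
  · have h0 : A.det = 0 := by
      by_contra hne
      exact h (hA.posDef_iff_det_ne_zero.2 hne)
    rw [h0]
    exact (hA.add hB).det_nonneg

/-- The determinant on the right is `det A` times that of `G` plus the Schur complement of `A` in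
the first matrix, and this Schur complement is positive semidefinite. In the application `A` is the
metric of a slice and `G` the metric of `Y`. -/
theorem det_mul_det_le_det_fromBlocks {ι κ : Type*} [Fintype ι] [DecidableEq ι] [Fintype κ]
    [DecidableEq κ] {A : Matrix ι ι ℝ} {B : Matrix ι κ ℝ} {C G : Matrix κ κ ℝ}
    (h : (fromBlocks A B Bᴴ C).PosSemidef) (hG : G.PosSemidef) :
    A.det * G.det ≤ (fromBlocks A B Bᴴ (C + G)).det := by
  have hA : A.PosSemidef := by
    have := h.submatrix (Sum.inl : ι → ι ⊕ κ)
    exact this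
  by_cases hd : A.PosDef
  · have := hd.isUnit.invertible
    rw [det_fromBlocks₁₁]
    refine mul_le_mul_of_nonneg_left ?_ hA.det_nonneg
    have h1 := (PosDef.fromBlocks₁₁ B C hd).1 h
    have h2 := det_le_det_add hG h1
    rw [invOf_eq_nonsing_inv, add_comm C G, add_sub_assoc]
    exact h2
  · have h0 : A.det = 0 := by
      by_contra hne
      exact hd (hA.posDef_iff_det_ne_zero.2 hne)
    rw [h0, zero_mul]
    have h2 : (fromBlocks A B Bᴴ (C + G)) = fromBlocks A B Bᴴ C + fromBlocks 0 0 0 G := by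
      simp [fromBlocks_add]
    rw [h2]
    refine (h.add ?_).det_nonneg
    have h3 := hG.conjTranspose_mul_mul_same (fromCols (0 : Matrix κ ι ℝ) (1 : Matrix κ κ ℝ))
    convert h3 using 1
    rw [conjTranspose_fromCols_eq_fromRows_conjTranspose, fromRows_mul, fromRows_mul_fromCols]
    simp

end Determinants

/-! ### Local sides of a hypersurface in a vector space. -/

section Sides

/-- The two sides of a regular hypersurface are locally connected. -/
theorem exists_open_preconnected_sides {E : Type*} [NormedAddCommGroup E] [NormedSpace ℝ E]
    [FiniteDimensional ℝ E] {U : Set E} (hU : IsOpen U) {f : E → ℝ} (hf : ContDiffOn ℝ ∞ f U)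
    {a : E} (ha : a ∈ U) (hfa : fderiv ℝ f a ≠ 0) :
    ∃ W, IsOpen W ∧ a ∈ W ∧ W ⊆ U ∧ IsPreconnected (W ∩ {x | 0 < f x}) ∧
      IsPreconnected (W ∩ {x | f x < 0}) := by
  have hsurj : Function.Surjective (fderiv ℝ f a) :=
    LinearMap.surjective (f := (fderiv ℝ f a : E →ₗ[ℝ] ℝ))
      (fun h => hfa (ContinuousLinearMap.coe_injective h))
  have hpos : Module.finrank ℝ E = 1 + (Module.finrank ℝ E - 1) := by
    have : 0 < Module.finrank ℝ E := by
      rw [Module.finrank_pos_iff]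
      by_contra hn
      rw [not_nontrivial_iff_subsingleton] at hn
      exact hfa (Subsingleton.elim _ _)
    omega
  obtain ⟨P, e, he⟩ := exists_complementary_map
    (K := EuclideanSpace ℝ (Fin (Module.finrank ℝ E - 1))) (fderiv ℝ f a) hsurj (by simpa using hpos)
  obtain ⟨Φ, haΦ, hΦU, hΦ, -⟩ := exists_straightening hU ha hf P e he
  obtain ⟨δ, hδ, hb⟩ := Metric.isOpen_iff.1 Φ.open_target (Φ a) (Φ.map_source haΦ)
  -- In straightened coordinates `f` is the first coordinate, so each side becomes the convex
  -- intersection of a ball with a half space.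
  have hconv : ∀ S : Set ℝ, Convex ℝ S →
      IsPreconnected ((Φ.source ∩ Φ ⁻¹' Metric.ball (Φ a) δ) ∩ {x | f x ∈ S}) := by
    intro S hS
    have h1 : (Φ.source ∩ Φ ⁻¹' Metric.ball (Φ a) δ) ∩ {x | f x ∈ S} =
        Φ.symm '' (Metric.ball (Φ a) δ ∩ Prod.fst ⁻¹' S) := by
      ext x
      constructor
      · rintro ⟨⟨h1, h2⟩, h3⟩
        refine ⟨Φ x, ⟨h2, ?_⟩, Φ.left_inv h1⟩
        simpa [hΦ] using h3
      · rintro ⟨z, ⟨h1, h2⟩, rfl⟩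
        have h3 := Φ.right_inv (hb h1)
        refine ⟨⟨Φ.map_target (hb h1), by rwa [mem_preimage, h3]⟩, ?_⟩
        have := congrArg Prod.fst ((hΦ (Φ.symm z)).symm.trans h3)
        simp only at this
        rwa [mem_ofPred_eq, this]
    rw [h1]
    refine IsPreconnected.image ?_ _ (Φ.continuousOn_symm.mono fun z hz => hb hz.1)
    exact ((convex_ball _ _).inter (hS.is_linear_preimage
      (IsLinearMap.mk (fun _ _ => rfl) (fun _ _ => rfl)))).isPreconnected
  exact ⟨Φ.source ∩ Φ ⁻¹' Metric.ball (Φ a) δ, Φ.isOpen_inter_preimage Metric.isOpen_ball,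
    ⟨haΦ, Metric.mem_ball_self hδ⟩, fun x hx => hΦU hx.1, hconv (Ioi 0) (convex_Ioi 0),
    hconv (Iio 0) (convex_Iio 0)⟩

end Sides

/-! ### Density of the interior in a horizontal slice at a boundary point. -/

section HalfSpace

/-- Let `{f = 0, 0 ≤ g}` be a piece of hypersurface in a half space `{0 ≤ t}`, which touches the
boundary `{t = 0}` only in its edge `{f = g = 0}`, and let it be transverse to the horizontal slice
through a point `(a, b)` of the edge. If `(a, b)` is a limit of points of the hypersurface in the
interior of the half space, it is a limit of such points in the horizontal slice. -/
theorem mem_closure_slice_of_mem_closure {E₁ E₂ : Type*} [NormedAddCommGroup E₁]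
    [NormedSpace ℝ E₁] [FiniteDimensional ℝ E₁] [NormedAddCommGroup E₂] [NormedSpace ℝ E₂]
    [FiniteDimensional ℝ E₂] (t : E₁ →L[ℝ] ℝ) {D : Set (E₁ × E₂)}
    {O : Set (E₁ × E₂)} (hO : IsOpen O) (hDO : D = O ∩ {q | 0 ≤ t q.1})
    {f g : E₁ × E₂ → ℝ} (hf : ContDiffOn ℝ ∞ f D) (hg : ContDiffOn ℝ ∞ g D)
    (hD : UniqueDiffOn ℝ D) {a : E₁} {b : E₂} (hp : (a, b) ∈ D) (hfp : f (a, b) = 0)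
    (hgp : g (a, b) = 0)
    (hli : Function.Surjective (fun u : E₁ =>
      (fderivWithin ℝ f D (a, b) (u, 0), fderivWithin ℝ g D (a, b) (u, 0))))
    (hedge : ∀ q ∈ D, t q.1 = 0 → f q = 0 → ¬ 0 < g q)
    (hint : (a, b) ∈ closure {q ∈ D | 0 < t q.1 ∧ f q = 0 ∧ 0 < g q}) :
    a ∈ closure {x | (x, b) ∈ D ∧ 0 < t x ∧ f (x, b) = 0 ∧ 0 < g (x, b)} := by
  let f' := fderivWithin ℝ f D (a, b)
  let g' := fderivWithin ℝ g D (a, b)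
  let i₁ := ContinuousLinearMap.inl ℝ E₁ E₂
  obtain ⟨K, hK⟩ : ∃ k, Module.finrank ℝ E₁ = 2 + k := by
    have h1 := LinearMap.finrank_le_finrank_of_surjective
      (f := (((f'.comp i₁).prod (g'.comp i₁) : E₁ →L[ℝ] ℝ × ℝ) : E₁ →ₗ[ℝ] ℝ × ℝ)) hli
    exact Nat.exists_eq_add_of_le (by simpa using h1)
  obtain ⟨P, e₁, he₁⟩ := exists_complementary_map (K := EuclideanSpace ℝ (Fin K))
    ((f'.comp i₁).prod (g'.comp i₁)) hli (by simpa using hK)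
  let Φ : E₁ × E₂ → ((ℝ × ℝ) × EuclideanSpace ℝ (Fin K)) × E₂ :=
    fun q => (((f q, g q), P q.1), q.2)
  let L : E₁ × E₂ →L[ℝ] ((ℝ × ℝ) × EuclideanSpace ℝ (Fin K)) × E₂ :=
    ((f'.prod g').prod (P.comp (ContinuousLinearMap.fst ℝ E₁ E₂))).prod
      (ContinuousLinearMap.snd ℝ E₁ E₂)
  have hLinj : Function.Injective L := by
    rw [injective_iff_map_eq_zero]
    rintro ⟨u, v⟩ huv
    obtain ⟨h1, rfl⟩ := Prod.mk.inj huv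
    have h2 : e₁ u = 0 := (congrArg (fun A => A u) he₁).trans h1
    rw [e₁.map_eq_zero_iff.1 h2]; rfl
  let e := (LinearEquiv.ofInjectiveOfFinrankEq
    (L : E₁ × E₂ →ₗ[ℝ] ((ℝ × ℝ) × EuclideanSpace ℝ (Fin K)) × E₂) hLinj
    (by simp [hK])).toContinuousLinearEquiv
  have heL : (e : E₁ × E₂ →L[ℝ] ((ℝ × ℝ) × EuclideanSpace ℝ (Fin K)) × E₂) = L := by ext x <;> rfl
  -- `c` is so small that a map which is `c`-close to the isomorphism `e` on a set extends to a
  -- homeomorphism of the whole space.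
  obtain ⟨c, hc0, hc⟩ : ∃ c : NNReal, 0 < c ∧
      lipschitzExtensionConstant (((ℝ × ℝ) × EuclideanSpace ℝ (Fin K)) × E₂) * c <
        ‖(e.symm : ((ℝ × ℝ) × EuclideanSpace ℝ (Fin K)) × E₂ →L[ℝ] E₁ × E₂)‖₊⁻¹ := by
    have hN : 0 < ‖(e.symm : ((ℝ × ℝ) × EuclideanSpace ℝ (Fin K)) × E₂ →L[ℝ] E₁ × E₂)‖₊⁻¹ := by
      have : Nontrivial (E₁ × E₂) := e.toEquiv.nontrivial
      have := e.nnnorm_symm_pos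
      positivity
    set A := lipschitzExtensionConstant (((ℝ × ℝ) × EuclideanSpace ℝ (Fin K)) × E₂)
    have hA : 0 < A := lipschitzExtensionConstant_pos _
    obtain ⟨c, hc0, hc⟩ := exists_between (div_pos hN hA)
    exact ⟨c, hc0, by rwa [lt_div_iff₀' hA] at hc⟩
  have hΦ : ContDiffOn ℝ ∞ Φ D := by
    have h1 : ContDiffOn ℝ ∞ (fun q : E₁ × E₂ => P q.1) D := by fun_prop
    exact ((hf.prodMk hg).prodMk h1).prodMk contDiff_snd.contDiffOn
  have hΦd : HasFDerivWithinAt Φ (e : E₁ × E₂ →L[ℝ] ((ℝ × ℝ) × EuclideanSpace ℝ (Fin K)) × E₂) D (a, b) := by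
    rw [heL]
    refine HasFDerivWithinAt.prodMk (HasFDerivWithinAt.prodMk (HasFDerivWithinAt.prodMk
      ((hf.differentiableOn (by simp)) _ hp).hasFDerivWithinAt
      ((hg.differentiableOn (by simp)) _ hp).hasFDerivWithinAt) ?_) ?_
    · exact (P.comp (ContinuousLinearMap.fst ℝ E₁ E₂)).hasFDerivWithinAt
    · exact (ContinuousLinearMap.snd ℝ E₁ E₂).hasFDerivWithinAt
  have hcd : ContinuousOn (fderivWithin ℝ Φ D) D := hΦ.continuousOn_fderivWithin hD (by simp)
  have hnear : ∀ᶠ q in nhdsWithin (a, b) D, ‖fderivWithin ℝ Φ D q - e‖ ≤ c := by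
    have h1 : Filter.Tendsto (fun q => ‖fderivWithin ℝ Φ D q - e‖) (nhdsWithin (a, b) D)
        (nhds ‖fderivWithin ℝ Φ D (a, b) - e‖) := ((hcd _ hp).sub continuousWithinAt_const).norm
    rw [hΦd.fderivWithin (hD _ hp), sub_self, norm_zero] at h1
    exact h1.eventually_le_const hc0
  obtain ⟨r₀, hr₀, hr₀'⟩ := Metric.mem_nhdsWithin_iff.1 hnear
  have hpO : (a, b) ∈ O := by rw [hDO] at hp; exact hp.1
  obtain ⟨r₁, hr₁, hr₁'⟩ := Metric.isOpen_iff.1 hO _ hpO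
  let r := min r₀ r₁
  have hr : 0 < r := lt_min hr₀ hr₁
  let s : Set (E₁ × E₂) := Metric.ball (a, b) r ∩ {q | 0 ≤ t q.1}
  have hsD : s ⊆ D := fun q hq => by
    rw [hDO]; exact ⟨hr₁' (Metric.ball_subset_ball (min_le_right _ _) hq.1), hq.2⟩
  have hsc : Convex ℝ s := by
    refine (convex_ball _ _).inter ?_
    exact (convex_Ici (0 : ℝ)).linear_preimage
      (t.comp (ContinuousLinearMap.fst ℝ E₁ E₂) : E₁ × E₂ →ₗ[ℝ] ℝ)
  have happ : ApproximatesLinearOn Φ (e : E₁ × E₂ →L[ℝ] ((ℝ × ℝ) × EuclideanSpace ℝ (Fin K)) × E₂) s c := by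
    intro x hx y hy
    refine hsc.norm_image_sub_le_of_norm_hasFDerivWithin_le' (𝕜 := ℝ)
      (f' := fun q => fderivWithin ℝ Φ D q) (fun q hq => ?_) (fun q hq => ?_) hy hx
    · exact (((hΦ.differentiableOn (by simp)) q (hsD hq)).hasFDerivWithinAt).mono hsD
    · exact hr₀' ⟨Metric.ball_subset_ball (min_le_left _ _) hq.1, hsD hq⟩
  -- The functions `f` and `g` are controlled only on the half-space side, so the usual inverse
  -- function theorem is not at hand. Instead `Φ` is extended from the convex half ball `s` to a
  -- homeomorphism `Θ`; its inverse may leave the half space, which is detected by the sign of `T`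
  -- below.
  obtain ⟨Θ, hΘ⟩ := happ.exists_homeomorph_extension (Or.inr hc)
  have hps : (a, b) ∈ s := ⟨Metric.mem_ball_self hr, by rw [hDO] at hp; exact hp.2⟩
  have hΘp : Θ (a, b) = (((0, 0), P a), b) := by
    rw [← hΘ hps]; simp [Φ, hfp, hgp]
  have hcs : Θ.symm ⁻¹' Metric.ball (a, b) r ∈ nhds (Θ (a, b)) :=
    Θ.symm.continuous.continuousAt.preimage_mem_nhds (by
      rw [Θ.symm_apply_apply]; exact Metric.ball_mem_nhds _ hr)
  obtain ⟨δ, hδ, hδ'⟩ := Metric.mem_nhds_iff.1 hcs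
  let Q : Set (((ℝ × ℝ) × EuclideanSpace ℝ (Fin K)) × E₂) :=
    Metric.ball (Θ (a, b)) δ ∩ {z | z.1.1.1 = 0 ∧ 0 < z.1.1.2}
  have hQc : IsPreconnected Q := by
    refine ((convex_ball _ _).inter ?_).isPreconnected
    have h1 : Convex ℝ {z : ((ℝ × ℝ) × EuclideanSpace ℝ (Fin K)) × E₂ | z.1.1.1 = 0} :=
      (convex_singleton (0 : ℝ)).is_linear_preimage
        (IsLinearMap.mk (fun _ _ => rfl) (fun _ _ => rfl))
    have h2 : Convex ℝ {z : ((ℝ × ℝ) × EuclideanSpace ℝ (Fin K)) × E₂ | 0 < z.1.1.2} :=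
      (convex_Ioi (0 : ℝ)).is_linear_preimage
        (IsLinearMap.mk (fun _ _ => rfl) (fun _ _ => rfl))
    exact h1.inter h2
  let T : ((ℝ × ℝ) × EuclideanSpace ℝ (Fin K)) × E₂ → ℝ := fun z => t (Θ.symm z).1
  have hTc : Continuous T := t.continuous.comp (continuous_fst.comp Θ.symm.continuous)
  have hT : ∀ z ∈ Q, 0 ≤ T z → Θ.symm z ∈ s ∧ Φ (Θ.symm z) = z := by
    intro z hz h0
    have h1 : Θ.symm z ∈ s := ⟨hδ' hz.1, h0⟩
    exact ⟨h1, by rw [hΘ h1, Θ.apply_symm_apply]⟩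
  -- A zero of `T` on `Q` would be a point of the hypersurface on `{t = 0}` with `g > 0`, off the
  -- edge. Hence `T` has constant sign on the connected set `Q`.
  have hT0 : ∀ z ∈ Q, T z ≠ 0 := by
    intro z hz h0
    obtain ⟨h1, h2⟩ := hT z hz h0.ge
    refine hedge _ (hsD h1) h0 ?_ ?_
    · rw [← hz.2.1, ← congrArg (fun w => w.1.1.1) h2]
    · have := hz.2.2
      rwa [← congrArg (fun w => w.1.1.2) h2] at this
  -- The hypothesis `hint` provides one point of `Q` where `T` is positive, which fixes the sign.
  have hTpos : ∀ z ∈ Q, 0 < T z := by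
    have hnb : Metric.ball (a, b) r ∩ Θ ⁻¹' Metric.ball (Θ (a, b)) δ ∈ nhds (a, b) :=
      Filter.inter_mem (Metric.ball_mem_nhds _ hr)
        (Θ.continuous.continuousAt.preimage_mem_nhds (Metric.ball_mem_nhds _ hδ))
    obtain ⟨q, ⟨hq1, hq2⟩, hq3, hq4, hq5, hq6⟩ := mem_closure_iff_nhds.1 hint _ hnb
    have hqs : q ∈ s := ⟨hq1, hq4.le⟩
    have hqQ : Θ q ∈ Q := by
      refine ⟨hq2, ?_⟩
      rw [← hΘ hqs]
      exact ⟨hq5, hq6⟩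
    have hTq : 0 < T (Θ q) := by simpa [T] using hq4
    intro z hz
    by_contra hneg
    push Not at hneg
    obtain ⟨w, hw, hw0⟩ := hQc.intermediate_value hz hqQ hTc.continuousOn ⟨hneg, hTq.le⟩
    exact hT0 w hw hw0
  -- Only the `g`-coordinate moves along this path. The last coordinate of `Φ` is the projection to
  -- `E₂`, so the path stays in the slice over `b`.
  let η : ℝ → E₁ := fun σ => (Θ.symm (((0, σ), P a), b)).1
  have hη : Filter.Tendsto η (nhdsWithin 0 (Ioi 0)) (nhds a) := by
    have h1 : Continuous η := continuous_fst.comp (Θ.symm.continuous.comp (by fun_prop))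
    have h2 : η 0 = a := by
      simp only [η]; rw [← hΘp, Θ.symm_apply_apply]
    have := h1.continuousAt (x := (0 : ℝ))
    rw [ContinuousAt, h2] at this
    exact this.mono_left nhdsWithin_le_nhds
  refine mem_closure_of_tendsto hη ?_
  have hev : ∀ᶠ σ in nhdsWithin (0 : ℝ) (Ioi 0), (((0, σ), P a), b) ∈ Q := by
    have h1 : Continuous (fun σ : ℝ => ((((0 : ℝ), σ), P a), b)) := by fun_prop
    have h2 : (fun σ : ℝ => ((((0 : ℝ), σ), P a), b)) ⁻¹' Metric.ball (Θ (a, b)) δ ∈ nhds 0 :=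
      h1.continuousAt.preimage_mem_nhds (by rw [hΘp]; exact Metric.ball_mem_nhds _ hδ)
    filter_upwards [nhdsWithin_le_nhds h2, self_mem_nhdsWithin] with σ h3 h4
    exact ⟨h3, rfl, h4⟩
  filter_upwards [hev] with σ hσ
  obtain ⟨h1, h2⟩ := hT _ hσ (hTpos _ hσ).le
  have h3 : Θ.symm (((0, σ), P a), b) = (η σ, b) :=
    Prod.ext rfl (congrArg (fun w => w.2) h2)
  rw [h3] at h1 h2
  refine ⟨hsD h1, hTpos _ hσ, congrArg (fun w => w.1.1.1) h2, ?_⟩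
  have h4 : g (η σ, b) = σ := congrArg (fun w => w.1.1.2) h2
  rw [h4]
  exact hσ.2.2

end HalfSpace

/-! ### Charts at interior points. -/

section InteriorChart

variable {E : Type*} [NormedAddCommGroup E] [NormedSpace ℝ E] {H : Type*} [TopologicalSpace H]
  (I : ModelWithCorners ℝ E H) {N : Type*} [TopologicalSpace N] [ChartedSpace H N]

/-- The restriction of `extChartAt I p` to interior points, as an open partial homeomorphism. -/
def interiorChart (p : N) : OpenPartialHomeomorph N E where
  toPartialEquiv := ((extChartAt I p).symm.restr (interior (range I))).symm
  open_source := by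
    simp only [PartialEquiv.symm_source, PartialEquiv.restr_target, PartialEquiv.symm_target,
      PartialEquiv.symm_symm]
    exact (continuousOn_extChartAt p).isOpen_inter_preimage (isOpen_extChartAt_source p)
      isOpen_interior
  open_target := by
    have : (((extChartAt I p).symm.restr (interior (range I))).symm).target =
        I.symm ⁻¹' (chartAt H p).target ∩ interior (range I) := by
      simp only [PartialEquiv.symm_target, PartialEquiv.restr_source, PartialEquiv.symm_source,
        extChartAt_target, inter_assoc]
      rw [inter_eq_self_of_subset_right interior_subset]
    rw [this]
    exact ((chartAt H p).open_target.preimage I.continuous_symm).inter isOpen_interior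
  continuousOn_toFun := (continuousOn_extChartAt p).mono (fun x hx => hx.1)
  continuousOn_invFun := (continuousOn_extChartAt_symm p).mono (fun x hx => hx.1)

variable {I}

theorem interiorChart_source_subset (p : N) :
    (interiorChart I p).source ⊆ (extChartAt I p).source := fun _ hx => hx.1

theorem mem_interiorChart_source {p : N} (hp : p ∉ I.boundary N) :
    p ∈ (interiorChart I p).source := by
  refine ⟨mem_extChartAt_source p, ?_⟩
  rw [← ModelWithCorners.compl_interior, mem_compl_iff, not_not] at hp
  exact hp

variable (I) in
theorem contMDiffOn_interiorChart [IsManifold I ∞ N] (p : N) :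
    ContMDiffOn I 𝓘(ℝ, E) ∞ (interiorChart I p) (interiorChart I p).source :=
  (contMDiffOn_extChartAt (I := I) (n := ∞) (x := p)).mono
    (fun x hx => by simpa using interiorChart_source_subset p hx)

variable (I) in
theorem contMDiffOn_interiorChart_symm [IsManifold I ∞ N] (p : N) :
    ContMDiffOn 𝓘(ℝ, E) I ∞ (interiorChart I p).symm (interiorChart I p).target :=
  (contMDiffOn_extChartAt_symm (I := I) (n := ∞) p).mono (fun _ hx => hx.1)

end InteriorChart

/-! ### Differentials in interior coordinates and along slices. -/

section Derivatives

variable {E : Type*} [NormedAddCommGroup E] [NormedSpace ℝ E] {H : Type*} [TopologicalSpace H]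
  {I : ModelWithCorners ℝ E H} {N : Type*} [TopologicalSpace N] [ChartedSpace H N]
  {F : Type*} [NormedAddCommGroup F] [NormedSpace ℝ F] {G : Type*} [TopologicalSpace G]
  {J : ModelWithCorners ℝ F G} {Y : Type*} [TopologicalSpace Y] [ChartedSpace G Y]

theorem _root_.ContMDiffOn.mdifferentiableAt_of_isOpen {f : N → Y} {U : Set N} {p : N}
    (hf : ContMDiffOn I J ∞ f U) (hU : IsOpen U) (hp : p ∈ U) : MDifferentiableAt I J f p :=
  (hf.contMDiffAt (hU.mem_nhds hp)).mdifferentiableAt (by simp)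

theorem mvfderiv_eq_fderiv {f : E → F} {x : E} : mvfderiv 𝓘(ℝ, E) f x = fderiv ℝ f x := by
  ext v
  simp only [mvfderiv, mfderiv_eq_fderiv]
  rfl

/-- Local coordinates on an open subset of the interior of a manifold. -/
structure IsInteriorCoord (I : ModelWithCorners ℝ E H) (κ : OpenPartialHomeomorph N E) :
    Prop where
  smooth : ContMDiffOn I 𝓘(ℝ, E) ∞ κ κ.source
  smooth_symm : ContMDiffOn 𝓘(ℝ, E) I ∞ κ.symm κ.target

theorem isInteriorCoord_interiorChart [IsManifold I ∞ N] (p : N) :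
    IsInteriorCoord I (interiorChart I p) :=
  ⟨contMDiffOn_interiorChart I p, contMDiffOn_interiorChart_symm I p⟩

namespace IsInteriorCoord

variable {κ : OpenPartialHomeomorph N E} (hκ : IsInteriorCoord I κ)

include hκ

theorem mfderiv_comp_mfderiv_symm {q : N} (hq : q ∈ κ.source) (v : E) :
    mfderiv I 𝓘(ℝ, E) κ q (mfderiv 𝓘(ℝ, E) I κ.symm (κ q) v) = v := by
  have h1 : MDifferentiableAt 𝓘(ℝ, E) I κ.symm (κ q) :=
    hκ.smooth_symm.mdifferentiableAt_of_isOpen κ.open_target (κ.map_source hq)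
  have h2 : MDifferentiableAt I 𝓘(ℝ, E) κ q :=
    hκ.smooth.mdifferentiableAt_of_isOpen κ.open_source hq
  have h3 := mfderiv_comp_apply_of_eq (κ q) h2 h1 (κ.left_inv hq) v
  have h4 : (κ ∘ κ.symm) =ᶠ[nhds (κ q)] id := by
    filter_upwards [κ.open_target.mem_nhds (κ.map_source hq)] with z hz
    exact κ.right_inv hz
  rw [h4.mfderiv_eq, mfderiv_id] at h3
  exact h3.symm

theorem mfderiv_symm_comp_mfderiv {q : N} (hq : q ∈ κ.source) (v : TangentSpace I q) :
    mfderiv 𝓘(ℝ, E) I κ.symm (κ q) (mfderiv I 𝓘(ℝ, E) κ q v) = v := by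
  have h1 : MDifferentiableAt 𝓘(ℝ, E) I κ.symm (κ q) :=
    hκ.smooth_symm.mdifferentiableAt_of_isOpen κ.open_target (κ.map_source hq)
  have h2 : MDifferentiableAt I 𝓘(ℝ, E) κ q :=
    hκ.smooth.mdifferentiableAt_of_isOpen κ.open_source hq
  have h3 := mfderiv_comp q h1 h2
  have h4 : (κ.symm ∘ κ) =ᶠ[nhds q] id := by
    filter_upwards [κ.open_source.mem_nhds hq] with z hz
    exact κ.left_inv hz
  rw [h4.mfderiv_eq, mfderiv_id] at h3
  exact (congrArg (fun T => T v) h3).symm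

theorem fderiv_comp_symm {q : N} (hq : q ∈ κ.source) {f : N → ℝ}
    (hf : MDifferentiableAt I 𝓘(ℝ, ℝ) f q) (v : E) :
    fderiv ℝ (f ∘ κ.symm) (κ q) v = mvfderiv I f q (mfderiv 𝓘(ℝ, E) I κ.symm (κ q) v) := by
  rw [← mvfderiv_eq_fderiv]
  have h1 : MDifferentiableAt 𝓘(ℝ, E) I κ.symm (κ q) :=
    hκ.smooth_symm.mdifferentiableAt_of_isOpen κ.open_target (κ.map_source hq)
  exact mvfderiv_comp_apply_of_eq (κ q) hf h1 (κ.left_inv hq) v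

theorem fderiv_comp_symm_eq_zero_iff {q : N} (hq : q ∈ κ.source) {f : N → ℝ}
    (hf : MDifferentiableAt I 𝓘(ℝ, ℝ) f q) :
    fderiv ℝ (f ∘ κ.symm) (κ q) = 0 ↔ mvfderiv I f q = 0 := by
  constructor
  · intro h
    ext v
    have := hκ.fderiv_comp_symm hq hf (mfderiv I 𝓘(ℝ, E) κ q v)
    rw [h, hκ.mfderiv_symm_comp_mfderiv hq] at this
    exact this.symm
  · intro h
    ext v
    rw [hκ.fderiv_comp_symm hq hf, h]
    rfl

theorem contDiffOn_comp_symm {f : N → F} {U : Set N} (hf : ContMDiffOn I 𝓘(ℝ, F) ∞ f U) :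
    ContDiffOn ℝ ∞ (f ∘ κ.symm) (κ.target ∩ κ.symm ⁻¹' U) := by
  rw [← contMDiffOn_iff_contDiffOn]
  exact hf.comp (hκ.smooth_symm.mono inter_subset_left) (fun x hx => hx.2)

omit hκ in
theorem prod (hκ : IsInteriorCoord I κ) {κ' : OpenPartialHomeomorph Y F}
    (hκ' : IsInteriorCoord J κ') : IsInteriorCoord (I.prod J) (κ.prod κ') where
  smooth := (hκ.smooth.comp contMDiffOn_fst (fun _ hq => hq.1)).prodMk_space
    (hκ'.smooth.comp contMDiffOn_snd (fun _ hq => hq.2))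
  smooth_symm := (hκ.smooth_symm.comp contDiff_fst.contMDiff.contMDiffOn (fun _ hq => hq.1)).prodMk
    (hκ'.smooth_symm.comp contDiff_snd.contMDiff.contMDiffOn (fun _ hq => hq.2))

end IsInteriorCoord

theorem mvfderiv_slice {f : N × Y → ℝ} {x : N} {y : Y}
    (hf : MDifferentiableAt (I.prod J) 𝓘(ℝ, ℝ) f (x, y)) (v : TangentSpace I x) :
    mvfderiv I (fun x' => f (x', y)) x v = mvfderiv (I.prod J) f (x, y) (v, 0) := by
  have h1 : MDifferentiableAt I (I.prod J) (fun x' : N => (x', y)) x :=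
    mdifferentiableAt_id.prodMk mdifferentiableAt_const
  have := mvfderiv_comp_apply x (g := f) (f := fun x' : N => (x', y)) hf h1 v
  rw [mfderiv_prod_left] at this
  exact this

theorem mvfderiv_slice_right {f : N × Y → ℝ} {x : N} {y : Y}
    (hf : MDifferentiableAt (I.prod J) 𝓘(ℝ, ℝ) f (x, y)) (w : TangentSpace J y) :
    mvfderiv J (fun y' => f (x, y')) y w = mvfderiv (I.prod J) f (x, y) (0, w) := by
  have h1 : MDifferentiableAt J (I.prod J) (fun y' : Y => (x, y')) y :=
    mdifferentiableAt_const.prodMk mdifferentiableAt_id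
  have := mvfderiv_comp_apply y (g := f) (f := fun y' : Y => (x, y')) hf h1 w
  rw [mfderiv_prod_right] at this
  exact this

theorem contMDiffOn_slice {f : N × Y → ℝ} {U : Set (N × Y)}
    (hf : ContMDiffOn (I.prod J) 𝓘(ℝ, ℝ) ∞ f U) (y : Y) :
    ContMDiffOn I 𝓘(ℝ, ℝ) ∞ (fun x => f (x, y)) {x | (x, y) ∈ U} :=
  hf.comp (contMDiffOn_id.prodMk contMDiffOn_const) (fun _ hx => hx)

end Derivatives

/-! ### Transversality to horizontal slices. -/

section Regular

variable {E : Type*} [NormedAddCommGroup E] [NormedSpace ℝ E] {H : Type*} [TopologicalSpace H]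
  (I : ModelWithCorners ℝ E H) {M : Type*} [TopologicalSpace M] [ChartedSpace H M]
  {F : Type*} [NormedAddCommGroup F] [NormedSpace ℝ F] {G : Type*} [TopologicalSpace G]
  (J : ModelWithCorners ℝ F G) {Y : Type*} [TopologicalSpace Y] [ChartedSpace G Y]

/-- Near `p`, the set `X` is a hypersurface transverse to the horizontal slice through `p`. -/
def IsTransverseAt (X : Set (M × Y)) (p : M × Y) : Prop :=
  ∃ (U : Set (M × Y)) (f : M × Y → ℝ), IsOpen U ∧ p ∈ U ∧
    ContMDiffOn (I.prod J) 𝓘(ℝ, ℝ) ∞ f U ∧ X ∩ U = {q ∈ U | f q = 0} ∧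
    mvfderiv I (fun x => f (x, p.2)) p.1 ≠ 0

end Regular

/-! ### Sard's theorem for slices of surfaces in `M × Y`. -/

section Sard

variable {E : Type} [NormedAddCommGroup E] [NormedSpace ℝ E] [FiniteDimensional ℝ E]
  {H : Type*} [TopologicalSpace H]
  {I : ModelWithCorners ℝ E H} {M : Type*} [TopologicalSpace M] [ChartedSpace H M]
  [IsManifold I ∞ M]
  {F : Type} [NormedAddCommGroup F] [NormedSpace ℝ F] [FiniteDimensional ℝ F]
  [MeasurableSpace F] [BorelSpace F] {G : Type*} [TopologicalSpace G]
  {J : ModelWithCorners ℝ F G} [J.Boundaryless] {Y : Type*} [TopologicalSpace Y] [ChartedSpace G Y]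

/-- Almost every horizontal slice of a surface is transverse. -/
theorem IsSurface.ae_isTransverseAt [SecondCountableTopology (M × Y)] (μ : Measure F)
    [μ.IsAddHaarMeasure] {X : Set (M × Y)}
    (hX : IsSurface (I.prod J) X) {κ : OpenPartialHomeomorph Y F} (hκ : IsInteriorCoord J κ) :
    ∀ᵐ v ∂μ, v ∈ κ.target → ∀ x, x ∉ I.boundary M → (x, κ.symm v) ∈ X →
      IsTransverseAt I J X (x, κ.symm v) := by
  let Bad : Set (M × Y) := {p | p ∈ X ∧ p.1 ∉ I.boundary M ∧ p.2 ∈ κ.source ∧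
    ¬ IsTransverseAt I J X p}
  suffices h : μ ((fun p : M × Y => κ p.2) '' Bad) = 0 by
    refine measure_mono_null ?_ h
    intro v hv
    simp only [mem_compl_iff, mem_ofPred_eq, not_forall] at hv
    obtain ⟨hv, x, hx, hxX, hn⟩ := hv
    exact ⟨(x, κ.symm v), ⟨hxX, hx, κ.map_target hv, hn⟩, κ.right_inv hv⟩
  refine measure_image_null_of_locally μ _ _ ?_
  rintro ⟨x, y⟩ ⟨hpX, hpM, hpκ, hpn⟩
  simp only at hpM hpκ
  have hpN : (x, y) ∉ (I.prod J).boundary (M × Y) := by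
    rw [ModelWithCorners.boundary_of_boundaryless_right]
    exact fun h => hpM h.1
  obtain ⟨U, f, hU, hpU, hf, hdf, hXU⟩ := hX.interior_point _ hpX hpN
  let χ := interiorChart I x
  have hχ : IsInteriorCoord I χ := isInteriorCoord_interiorChart x
  have hxχ : x ∈ χ.source := mem_interiorChart_source hpM
  let Ψ := χ.prod κ
  have hΨ : IsInteriorCoord (I.prod J) Ψ := hχ.prod hκ
  have hpΨ : (x, y) ∈ Ψ.source := ⟨hxχ, hpκ⟩
  let O : Set (E × F) := Ψ.target ∩ Ψ.symm ⁻¹' U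
  have hO : IsOpen O := Ψ.isOpen_inter_preimage_symm hU
  have hk : ContDiffOn ℝ ∞ (f ∘ Ψ.symm) O := hΨ.contDiffOn_comp_symm hf
  have hpO : Ψ (x, y) ∈ O := ⟨Ψ.map_source hpΨ, by rwa [mem_preimage, Ψ.left_inv hpΨ]⟩
  have hder : ∀ x' y', (x', y') ∈ Ψ.source ∩ U → mvfderiv I (fun x => f (x, y')) x' = 0 →
      ∀ u, fderiv ℝ (f ∘ Ψ.symm) (Ψ (x', y')) (u, 0) = 0 := by
    rintro x' y' ⟨hq, hqU⟩ h0 u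
    have hfq : MDifferentiableAt I 𝓘(ℝ, ℝ) (fun x => f (x, y')) x' :=
      (contMDiffOn_slice hf y').mdifferentiableAt_of_isOpen (hU.preimage (by fun_prop)) hqU
    have h1 := (hχ.fderiv_comp_symm_eq_zero_iff hq.1 hfq).2 h0
    have hqO : Ψ (x', y') ∈ O := ⟨Ψ.map_source hq, by rwa [mem_preimage, Ψ.left_inv hq]⟩
    have h2 : HasFDerivAt (fun a => (f ∘ Ψ.symm) (a, κ y'))
        ((fderiv ℝ (f ∘ Ψ.symm) (Ψ (x', y'))).comp (ContinuousLinearMap.inl ℝ E F)) (χ x') :=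
      HasFDerivAt.comp (χ x') (f := fun a => (a, κ y')) (g := f ∘ Ψ.symm)
        ((hk.contDiffAt (hO.mem_nhds hqO)).differentiableAt (by simp)).hasFDerivAt
        (hasFDerivAt_prodMk_left _ _)
    have h3 : (fun a => (f ∘ Ψ.symm) (a, κ y')) = (fun x => f (x, y')) ∘ χ.symm := by
      funext a
      change f (χ.symm a, κ.symm (κ y')) = f (χ.symm a, y')
      rw [κ.left_inv hq.2]
    rw [h3] at h2
    rw [h2.fderiv] at h1
    exact congrArg (fun T => T u) h1
  have hpd : mvfderiv I (fun x => f (x, y)) x = 0 := by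
    by_contra hne
    exact hpn ⟨U, f, hU, hpU, hf, hXU, hne⟩
  -- The differential of `f` is nonzero at the point while its horizontal part vanishes, so some
  -- vertical derivative is nonzero. The same `f` tests transversality at all nearby points.
  obtain ⟨e, he⟩ : ∃ e, fderiv ℝ (f ∘ Ψ.symm) (Ψ (x, y)) (0, e) ≠ 0 := by
    by_contra! hcon
    refine hdf ((hΨ.fderiv_comp_symm_eq_zero_iff hpΨ
      (hf.mdifferentiableAt_of_isOpen hU hpU)).1 ?_)
    refine ContinuousLinearMap.ext ?_
    rintro ⟨u, w⟩
    rw [← Prod.fst_add_snd (u, w), map_add, hder x y ⟨hpΨ, hpU⟩ hpd, hcon]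
    simp
  obtain ⟨V, hV, hpV, hVO, hnull⟩ := exists_open_null_critical_slices μ hO hk hpO he
  refine ⟨(Ψ.source ∩ Ψ ⁻¹' V) ∩ U, (Ψ.isOpen_inter_preimage hV).inter hU,
    ⟨⟨hpΨ, hpV⟩, hpU⟩, measure_mono_null ?_ hnull⟩
  rintro _ ⟨⟨x', y'⟩, ⟨⟨hX', hM', hκ', hn'⟩, ⟨⟨hΨ', hV'⟩, hU'⟩⟩, rfl⟩
  have hf0 : f (x', y') = 0 := by
    have : (x', y') ∈ X ∩ U := ⟨hX', hU'⟩
    rw [hXU] at this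
    exact this.2
  refine ⟨χ x', hV', ?_, hder x' y' ⟨hΨ', hU'⟩ ?_⟩
  · change f (Ψ.symm (Ψ (x', y'))) = 0
    rw [Ψ.left_inv hΨ', hf0]
  · by_contra hne
    exact hn' ⟨U, f, hU, hU', hf, hXU, hne⟩

end Sard

/-! ### Local position of a homology region relative to its bounding surface. -/

section Sides

variable {E : Type*} [NormedAddCommGroup E] [NormedSpace ℝ E] [FiniteDimensional ℝ E] {H : Type*}
  [TopologicalSpace H] {I : ModelWithCorners ℝ E H} {N : Type*} [TopologicalSpace N]
  [ChartedSpace H N] [IsManifold I ∞ N]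

theorem exists_open_preconnected_sides_manifold {U : Set N} (hU : IsOpen U) {f : N → ℝ}
    (hf : ContMDiffOn I 𝓘(ℝ, ℝ) ∞ f U) {p : N} (hp : p ∈ U) (hpI : p ∉ I.boundary N)
    (hfp : mvfderiv I f p ≠ 0) :
    ∃ W, IsOpen W ∧ p ∈ W ∧ W ⊆ U ∧ IsPreconnected (W ∩ {x | 0 < f x}) ∧
      IsPreconnected (W ∩ {x | f x < 0}) := by
  let κ := interiorChart I p
  have hκ : IsInteriorCoord I κ := isInteriorCoord_interiorChart p
  have hpκ : p ∈ κ.source := mem_interiorChart_source hpI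
  obtain ⟨W, hW, hpW, hWU, h1, h2⟩ := exists_open_preconnected_sides
    (κ.isOpen_inter_preimage_symm hU) (hκ.contDiffOn_comp_symm hf) (a := κ p)
    ⟨κ.map_source hpκ, by rwa [mem_preimage, κ.left_inv hpκ]⟩
    (fun h => hfp ((hκ.fderiv_comp_symm_eq_zero_iff hpκ (hf.mdifferentiableAt_of_isOpen hU hp)).1 h))
  have himg : ∀ S : Set ℝ, IsPreconnected (W ∩ {x | (f ∘ κ.symm) x ∈ S}) →
      IsPreconnected ((κ.source ∩ κ ⁻¹' W) ∩ {x | f x ∈ S}) := by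
    intro S hS
    have : (κ.source ∩ κ ⁻¹' W) ∩ {x | f x ∈ S} = κ.symm '' (W ∩ {x | (f ∘ κ.symm) x ∈ S}) := by
      ext x
      constructor
      · rintro ⟨⟨hx, hxW⟩, hxS⟩
        exact ⟨κ x, ⟨hxW, by simpa [κ.left_inv hx] using hxS⟩, κ.left_inv hx⟩
      · rintro ⟨z, ⟨hz, hzS⟩, rfl⟩
        have hz' := (hWU hz).1
        exact ⟨⟨κ.map_target hz', by rwa [mem_preimage, κ.right_inv hz']⟩, hzS⟩
    rw [this]
    exact hS.image _ (κ.continuousOn_symm.mono fun z hz => (hWU hz.1).1)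
  refine ⟨κ.source ∩ κ ⁻¹' W, κ.isOpen_inter_preimage hW, ⟨hpκ, hpW⟩, ?_, himg (Ioi 0) h1,
    himg (Iio 0) h2⟩
  rintro x ⟨hx, hxW⟩
  have := (hWU hxW).2
  rwa [mem_preimage, κ.left_inv hx] at this

theorem subset_interior_or_subset_compl {Z : Type*} [TopologicalSpace Z] {S r : Set Z}
    (hS : IsPreconnected S) (hr : IsClosed r) (hSr : Disjoint S (frontier r)) :
    S ⊆ interior r ∨ S ⊆ rᶜ := by
  rcases S.eq_empty_or_nonempty with rfl | hne
  · exact Or.inl (empty_subset _)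
  refine hS.subset_or_subset isOpen_interior hr.isOpen_compl
    (disjoint_compl_right.mono_left interior_subset) fun x hx => ?_
  by_contra hcon
  rw [mem_union, not_or, mem_compl_iff, not_not] at hcon
  exact disjoint_left.1 hSr hx ⟨subset_closure hcon.2, hcon.1⟩

/-- A region bounded by a regular hypersurface lies on exactly one side of it. -/
theorem region_on_one_side {r X U : Set N} (hr : closure (interior r) = r) (hrX : frontier r = X)
    (hU : IsOpen U) {f : N → ℝ} (hf : ContMDiffOn I 𝓘(ℝ, ℝ) ∞ f U)
    (hXU : X ∩ U = {q ∈ U | f q = 0}) {p : N} (hp : p ∈ U) (hpX : p ∈ X) (hpI : p ∉ I.boundary N)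
    (hfp : mvfderiv I f p ≠ 0) :
    ∃ W, IsOpen W ∧ p ∈ W ∧ W ⊆ U ∧
      ((W ∩ {x | 0 < f x} ⊆ interior r ∧ W ∩ {x | f x < 0} ⊆ rᶜ) ∨
        (W ∩ {x | f x < 0} ⊆ interior r ∧ W ∩ {x | 0 < f x} ⊆ rᶜ)) := by
  have hrc : IsClosed r := hr ▸ isClosed_closure
  obtain ⟨W, hW, hpW, hWU, h1, h2⟩ := exists_open_preconnected_sides_manifold hU hf hp hpI hfp
  refine ⟨W, hW, hpW, hWU, ?_⟩
  have hXf : ∀ x ∈ W, x ∈ X → f x = 0 := fun x hx hxX => by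
    have : x ∈ X ∩ U := ⟨hxX, hWU hx⟩
    rw [hXU] at this
    exact this.2
  have hpr : p ∈ frontier r := hrX ▸ hpX
  have d1 : Disjoint (W ∩ {x | 0 < f x}) (frontier r) := by
    rw [hrX, disjoint_left]
    exact fun x hx hxX => hx.2.ne' (hXf x hx.1 hxX)
  have d2 : Disjoint (W ∩ {x | f x < 0}) (frontier r) := by
    rw [hrX, disjoint_left]
    exact fun x hx hxX => hx.2.ne (hXf x hx.1 hxX)
  have hcov : ∀ x ∈ W, x ∉ X → x ∈ W ∩ {x | 0 < f x} ∪ W ∩ {x | f x < 0} := by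
    intro x hx hxX
    have hne : f x ≠ 0 := fun h0 => hxX (by
      have : x ∈ X ∩ U := by rw [hXU]; exact ⟨hWU hx, h0⟩
      exact this.1)
    rcases hne.lt_or_gt with h | h
    · exact Or.inr ⟨hx, h⟩
    · exact Or.inl ⟨hx, h⟩
  have hint : (W ∩ interior r).Nonempty := by
    have : p ∈ closure (interior r) := by rw [hr]; exact hrc.frontier_subset hpr
    exact mem_closure_iff.1 this W hW hpW
  have hext : (W ∩ rᶜ).Nonempty := by
    have : p ∈ closure rᶜ := by
      rw [closure_compl]; exact hpr.2
    exact mem_closure_iff.1 this W hW hpW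
  -- Each side lies in the interior or in the exterior of `r`. They cannot agree: `p` is a limit
  -- both of interior points of `r` and of points outside `r`, and such points are not in `X`.
  rcases subset_interior_or_subset_compl h1 hrc d1 with e1 | e1 <;>
    rcases subset_interior_or_subset_compl h2 hrc d2 with e2 | e2
  · obtain ⟨x, hxW, hxr⟩ := hext
    have hxX : x ∉ X := fun h => hxr (hrc.frontier_subset (hrX ▸ h))
    exact absurd (interior_subset ((union_subset e1 e2) (hcov x hxW hxX))) hxr
  · exact Or.inl ⟨e1, e2⟩
  · exact Or.inr ⟨e2, e1⟩
  · obtain ⟨x, hxW, hxr⟩ := hint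
    have hxX : x ∉ X := fun h => (hrX ▸ h : x ∈ frontier r).2 hxr
    exact absurd (interior_subset hxr) ((union_subset e1 e2) (hcov x hxW hxX))

-- Otherwise `f` would have a local maximum at the interior point `p`, and its differential would
-- vanish.
omit [FiniteDimensional ℝ E] in
theorem mem_closure_pos_of_mvfderiv_ne_zero {U : Set N} (hU : IsOpen U) {f : N → ℝ}
    (hf : ContMDiffOn I 𝓘(ℝ, ℝ) ∞ f U) {p : N} (hp : p ∈ U) (hpI : p ∉ I.boundary N)
    (hfp : mvfderiv I f p ≠ 0) (hp0 : f p = 0) : p ∈ closure {x | 0 < f x} := by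
  let κ := interiorChart I p
  have hκ : IsInteriorCoord I κ := isInteriorCoord_interiorChart p
  have hpκ : p ∈ κ.source := mem_interiorChart_source hpI
  by_contra hcon
  refine hfp ((hκ.fderiv_comp_symm_eq_zero_iff hpκ (hf.mdifferentiableAt_of_isOpen hU hp)).1 ?_)
  refine IsLocalMax.fderiv_eq_zero ?_
  have h1 : ∀ᶠ x in nhds p, f x ≤ 0 := by
    filter_upwards [isClosed_closure.isOpen_compl.mem_nhds hcon] with x hx
    exact not_lt.1 fun h => hx (subset_closure h)
  have h2 : Filter.Tendsto κ.symm (nhds (κ p)) (nhds p) := by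
    have := κ.symm.continuousAt (x := κ p) (κ.map_source hpκ)
    rwa [ContinuousAt, κ.left_inv hpκ] at this
  filter_upwards [h2.eventually h1] with z hz
  simpa [κ.left_inv hpκ, hp0] using hz

omit [FiniteDimensional ℝ E] in
theorem mem_closure_neg_of_mvfderiv_ne_zero {U : Set N} (hU : IsOpen U) {f : N → ℝ}
    (hf : ContMDiffOn I 𝓘(ℝ, ℝ) ∞ f U) {p : N} (hp : p ∈ U) (hpI : p ∉ I.boundary N)
    (hfp : mvfderiv I f p ≠ 0) (hp0 : f p = 0) : p ∈ closure {x | f x < 0} := by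
  have h1 : mvfderiv I (fun x => -f x) p ≠ 0 := by
    have : mvfderiv I (fun x => -f x) p = -mvfderiv I f p := mvfderiv_neg
    rw [this]
    exact neg_ne_zero.2 hfp
  simpa using mem_closure_pos_of_mvfderiv_ne_zero hU (f := fun x => -f x) hf.neg hp hpI h1
    (by simp [hp0])

end Sides

/-! ### Independent pairs of functionals. -/

section LinearAlgebra

/-- Some `2 × 2` minor of the pair is nonzero, and Cramer's rule solves the system. -/
theorem surjective_pair_of_linearIndependent {E : Type*} [AddCommGroup E] [Module ℝ E]
    [TopologicalSpace E] {A B : E →L[ℝ] ℝ} (h : LinearIndependent ℝ ![A, B]) :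
    Function.Surjective (fun u => (A u, B u)) := by
  rw [LinearIndependent.pair_iff] at h
  obtain ⟨u, hu⟩ : ∃ u, A u ≠ 0 := by
    by_contra! hcon
    have : A = 0 := ContinuousLinearMap.ext hcon
    exact one_ne_zero (h 1 0 (by simp [this])).1
  obtain ⟨w, hw⟩ : ∃ w, A u * B w - B u * A w ≠ 0 := by
    by_contra! hcon
    exact hu (h (-B u) (A u) (ContinuousLinearMap.ext fun w => by
      have := hcon w
      change -B u * A w + A u * B w = 0
      linarith)).2
  rintro ⟨α, β⟩
  refine ⟨((α * B w - β * A w) / (A u * B w - B u * A w)) • u +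
    ((β * A u - α * B u) / (A u * B w - B u * A w)) • w, ?_⟩
  simp only [map_add, map_smul, smul_eq_mul, Prod.mk.injEq]
  constructor <;>
    rw [div_mul_eq_mul_div, div_mul_eq_mul_div, ← add_div, div_eq_iff hw] <;> ring

end LinearAlgebra

/-! ### Products with `Y` of surfaces and of homology regions. -/

section Products

variable {E : Type*} [NormedAddCommGroup E] [NormedSpace ℝ E]
  {H : Type*} [TopologicalSpace H]
  {I : ModelWithCorners ℝ E H} {M : Type*} [TopologicalSpace M] [ChartedSpace H M]
  {F : Type*} [NormedAddCommGroup F] [NormedSpace ℝ F] {G : Type*} [TopologicalSpace G]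
  {J : ModelWithCorners ℝ F G} {Y : Type*} [TopologicalSpace Y] [ChartedSpace G Y]

theorem mvfderiv_comp_fst {f : M → ℝ} {p : M × Y} (hf : MDifferentiableAt I 𝓘(ℝ, ℝ) f p.1)
    (v : TangentSpace I p.1) (w : TangentSpace J p.2) :
    mvfderiv (I.prod J) (fun q : M × Y => f q.1) p (v, w) = mvfderiv I f p.1 v := by
  have := mvfderiv_comp_apply p (g := f) (f := fun q : M × Y => q.1) (I := I) (I' := I.prod J)
    hf mdifferentiableAt_fst (v, w)
  rw [mfderiv_fst] at this
  exact this

variable [J.Boundaryless]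

theorem mem_boundary_prod {p : M × Y} :
    p ∈ (I.prod J).boundary (M × Y) ↔ p.1 ∈ I.boundary M := by
  rw [ModelWithCorners.boundary_of_boundaryless_right]
  exact ⟨fun h => h.1, fun h => ⟨h, mem_univ _⟩⟩

theorem edge_prod_univ (R : Set M) :
    edge (I.prod J) (R ×ˢ (univ : Set Y)) = edge I R ×ˢ univ := by
  have h : (I.prod J).boundary (M × Y) \ R ×ˢ univ = (I.boundary M \ R) ×ˢ univ := by
    ext p
    simp [mem_boundary_prod]
  rw [edge, edge, h, closure_prod_eq, closure_prod_eq, closure_univ, prod_inter_prod, inter_self]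

theorem IsSurface.prod_univ [CompactSpace Y] {X : Set M} (hX : IsSurface I X) :
    IsSurface (I.prod J) (X ×ˢ (univ : Set Y)) where
  isCompact := hX.isCompact.prod isCompact_univ
  dense_interior := by
    have h : X ×ˢ (univ : Set Y) \ (I.prod J).boundary (M × Y) = (X \ I.boundary M) ×ˢ univ := by
      ext p
      simp [mem_boundary_prod]
    rw [h, closure_prod_eq, closure_univ]
    exact prod_mono_left hX.dense_interior
  interior_point := by
    intro p hp hpI
    obtain ⟨U, f, hU, hpU, hf, hdf, hXU⟩ :=
      hX.interior_point p.1 hp.1 (fun h => hpI (mem_boundary_prod.2 h))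
    refine ⟨U ×ˢ univ, fun q => f q.1, hU.prod isOpen_univ, ⟨hpU, mem_univ _⟩,
      hf.comp contMDiffOn_fst (fun q hq => hq.1), fun h0 => hdf ?_, ?_⟩
    · ext v
      rw [← mvfderiv_comp_fst (J := J) (hf.mdifferentiableAt_of_isOpen hU hpU) v 0, h0]
      rfl
    · ext q
      exact (and_congr (and_iff_left trivial) (and_iff_left trivial)).trans
        ((Set.ext_iff.1 hXU q.1).trans (and_congr_left' (and_iff_left trivial).symm))
  boundary_point := by
    intro p hp hpI
    obtain ⟨U, f, g, hU, hpU, hf, hg, hli, hXU, hXU'⟩ :=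
      hX.boundary_point p.1 hp.1 (mem_boundary_prod.1 hpI)
    refine ⟨U ×ˢ univ, fun q => f q.1, fun q => g q.1, hU.prod isOpen_univ, ⟨hpU, mem_univ _⟩,
      hf.comp contMDiffOn_fst (fun q hq => hq.1), hg.comp contMDiffOn_fst (fun q hq => hq.1),
      ?_, ?_, ?_⟩
    · rw [LinearIndependent.pair_iff] at hli ⊢
      intro s t hst
      refine hli s t ?_
      ext v
      have h0 := congrArg (fun T => T ((v, 0) : TangentSpace I p.1 × TangentSpace J p.2)) hst
      change s * mvfderiv I f p.1 v + t * mvfderiv I g p.1 v = 0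
      rw [← mvfderiv_comp_fst (J := J) (hf.mdifferentiableAt_of_isOpen hU hpU) v 0,
        ← mvfderiv_comp_fst (J := J) (hg.mdifferentiableAt_of_isOpen hU hpU) v 0]
      exact h0
    · ext q
      exact (and_congr (and_iff_left trivial) (and_iff_left trivial)).trans
        ((Set.ext_iff.1 hXU q.1).trans (and_congr_left' (and_iff_left trivial).symm))
    · ext q
      exact (and_congr (and_congr (and_iff_left trivial) mem_boundary_prod)
        (and_iff_left trivial)).trans
        ((Set.ext_iff.1 hXU' q.1).trans (and_congr_left' (and_iff_left trivial).symm))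

theorem IsHomologous.prod_univ [CompactSpace Y] {R X : Set M} (h : IsHomologous I R X) :
    IsHomologous (I.prod J) (R ×ˢ (univ : Set Y)) (X ×ˢ (univ : Set Y)) where
  isSurface := h.isSurface.prod_univ
  boundary_eq := by
    rw [edge_prod_univ, ← h.boundary_eq]
    ext p
    simp [mem_boundary_prod]
  exists_region := by
    obtain ⟨r, h1, h2, h3⟩ := h.exists_region
    refine ⟨r ×ˢ univ, ?_, ?_, ?_⟩
    · rw [interior_prod_eq, interior_univ, closure_prod_eq, closure_univ, h1]
    · rw [← h2]
      ext p
      simp [mem_boundary_prod]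
    · rw [frontier_prod_univ_eq, h3]

end Products

/-! ### The boundary of `M` in half-space charts. -/

section HalfSpaceBoundary

variable {n : ℕ} {M : Type*} [TopologicalSpace M] [ChartedSpace (EuclideanHalfSpace (n + 1)) M]
  [IsManifold (𝓡∂ (n + 1)) ∞ M]

omit [IsManifold (𝓡∂ (n + 1)) ∞ M] in
theorem zero_le_of_mem_extChartAt_target {x : M} {a : EuclideanSpace ℝ (Fin (n + 1))}
    (ha : a ∈ (extChartAt (𝓡∂ (n + 1)) x).target) : 0 ≤ a 0 := by
  have h1 : a ∈ range (𝓡∂ (n + 1)) := extChartAt_target_subset_range x ha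
  rw [range_modelWithCornersEuclideanHalfSpace] at h1
  exact h1

/-- The boundary is defined through the preferred chart at each point; by invariance of interior
points under change of chart it can be read in the single chart at `x`. -/
theorem extChartAt_symm_mem_boundary_iff {x : M} {a : EuclideanSpace ℝ (Fin (n + 1))}
    (ha : a ∈ (extChartAt (𝓡∂ (n + 1)) x).target) :
    (extChartAt (𝓡∂ (n + 1)) x).symm a ∈ (𝓡∂ (n + 1)).boundary M ↔ a 0 = 0 := by
  have hmem : (extChartAt (𝓡∂ (n + 1)) x).symm a ∈ (chartAt (EuclideanHalfSpace (n + 1)) x).source := by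
    rw [← extChartAt_source (𝓡∂ (n + 1))]
    exact (extChartAt (𝓡∂ (n + 1)) x).map_target ha
  have h0 := zero_le_of_mem_extChartAt_target ha
  rw [← ModelWithCorners.compl_interior, mem_compl_iff]
  change ¬ (𝓡∂ (n + 1)).IsInteriorPoint _ ↔ _
  rw [ModelWithCorners.isInteriorPoint_iff_of_mem_atlas (n := ∞) (by simp)
    (chart_mem_atlas _ x) hmem]
  change ¬ (extChartAt (𝓡∂ (n + 1)) x ((extChartAt (𝓡∂ (n + 1)) x).symm a) ∈
    interior (extChartAt (𝓡∂ (n + 1)) x).target) ↔ _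
  rw [(extChartAt (𝓡∂ (n + 1)) x).right_inv ha, extChartAt_target, interior_inter,
    interior_range_modelWithCornersEuclideanHalfSpace,
    ((chartAt (EuclideanHalfSpace (n + 1)) x).open_target.preimage
      (𝓡∂ (n + 1)).continuous_symm).interior_eq]
  have h1 : a ∈ (𝓡∂ (n + 1)).symm ⁻¹' (chartAt (EuclideanHalfSpace (n + 1)) x).target := by
    rw [extChartAt_target] at ha; exact ha.1
  constructor
  · intro h
    by_contra hne
    exact h ⟨h1, lt_of_le_of_ne h0 (Ne.symm hne)⟩
  · rintro h ⟨-, h2⟩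
    have h3 : 0 < a 0 := h2
    exact h3.ne' h

end HalfSpaceBoundary

/-! ### Slices of homologous surfaces are homologous. -/

section SliceDense

variable {n : ℕ} {M : Type*} [TopologicalSpace M] [ChartedSpace (EuclideanHalfSpace (n + 1)) M]
  [IsManifold (𝓡∂ (n + 1)) ∞ M]
  {F : Type} [NormedAddCommGroup F] [NormedSpace ℝ F] [FiniteDimensional ℝ F]
  {G : Type*} [TopologicalSpace G]
  {J : ModelWithCorners ℝ F G} [J.Boundaryless] {Y : Type*} [TopologicalSpace Y] [ChartedSpace G Y]
  [IsManifold J ∞ Y]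

omit [IsManifold (𝓡∂ (n + 1)) ∞ M] [FiniteDimensional ℝ F] [J.Boundaryless]
  [IsManifold J ∞ Y] in
/-- The differential of a slice in a chart around a boundary point. -/
theorem fderivWithin_slice_eq_mvfderiv {f : M × Y → ℝ} {U : Set (M × Y)} (hU : IsOpen U)
    (hf : ContMDiffOn ((𝓡∂ (n + 1)).prod J) 𝓘(ℝ, ℝ) ∞ f U) {x : M} {y : Y} (hp : (x, y) ∈ U)
    {κ : OpenPartialHomeomorph Y F} (hy : y ∈ κ.source)
    {h : EuclideanSpace ℝ (Fin (n + 1)) × F → ℝ}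
    (hh : h = fun q => f ((extChartAt (𝓡∂ (n + 1)) x).symm q.1, κ.symm q.2))
    {D : Set (EuclideanSpace ℝ (Fin (n + 1)) × F)}
    (hD : {a | (a, κ y) ∈ D} ∈ nhdsWithin (extChartAt (𝓡∂ (n + 1)) x x) (range (𝓡∂ (n + 1))))
    (hhD : DifferentiableWithinAt ℝ h D (extChartAt (𝓡∂ (n + 1)) x x, κ y))
    (u : EuclideanSpace ℝ (Fin (n + 1))) :
    fderivWithin ℝ h D (extChartAt (𝓡∂ (n + 1)) x x, κ y) (u, 0) =
      mvfderiv (𝓡∂ (n + 1)) (fun x' => f (x', y)) x u := by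
  have hfx : MDifferentiableAt (𝓡∂ (n + 1)) 𝓘(ℝ, ℝ) (fun x' => f (x', y)) x :=
    (contMDiffOn_slice hf y).mdifferentiableAt_of_isOpen (hU.preimage (by fun_prop)) hp
  rw [hfx.mvfderiv]
  have h1 : HasFDerivWithinAt (fun a => h (a, κ y))
      ((fderivWithin ℝ h D (extChartAt (𝓡∂ (n + 1)) x x, κ y)).comp
        (ContinuousLinearMap.inl ℝ (EuclideanSpace ℝ (Fin (n + 1))) F)) {a | (a, κ y) ∈ D}
      (extChartAt (𝓡∂ (n + 1)) x x) :=
    HasFDerivWithinAt.comp (extChartAt (𝓡∂ (n + 1)) x x) (f := fun a => (a, κ y)) (g := h)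
      hhD.hasFDerivWithinAt (hasFDerivAt_prodMk_left _ _).hasFDerivWithinAt (fun a ha => ha)
  have h2 := h1.mono_of_mem_nhdsWithin hD
  have h3 : (fun a => h (a, κ y)) =
      writtenInExtChartAt (𝓡∂ (n + 1)) 𝓘(ℝ, ℝ) x (fun x' => f (x', y)) := by
    funext a
    simp only [hh, writtenInExtChartAt, extChartAt_model_space_eq_id, κ.left_inv hy]
    rfl
  rw [h3] at h2
  have h4 := h2.fderivWithin ((𝓡∂ (n + 1)).uniqueDiffOn _ (mem_range_self _))
  exact (congrArg (fun T => T u) h4).symm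

/-- This is `mem_closure_slice_of_mem_closure` read in the product of the boundary chart at `x` and
a chart of `Y`, with `t` the first coordinate of the half space. The density of the interior of `X`
supplies the limit hypothesis. -/
theorem mem_closure_slice_diff_boundary {X : Set (M × Y)}
    (hX : IsSurface ((𝓡∂ (n + 1)).prod J) X) {x : M} {y : Y} (hxy : (x, y) ∈ X)
    (hx : x ∈ (𝓡∂ (n + 1)).boundary M)
    {U : Set (M × Y)} {f g : M × Y → ℝ} (hU : IsOpen U) (hp : (x, y) ∈ U)
    (hf : ContMDiffOn ((𝓡∂ (n + 1)).prod J) 𝓘(ℝ, ℝ) ∞ f U)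
    (hg : ContMDiffOn ((𝓡∂ (n + 1)).prod J) 𝓘(ℝ, ℝ) ∞ g U)
    (hXU : X ∩ U = {q ∈ U | f q = 0 ∧ 0 ≤ g q})
    (hXU' : X ∩ ((𝓡∂ (n + 1)).prod J).boundary (M × Y) ∩ U = {q ∈ U | f q = 0 ∧ g q = 0})
    (hli : LinearIndependent ℝ ![mvfderiv (𝓡∂ (n + 1)) (fun x' => f (x', y)) x,
      mvfderiv (𝓡∂ (n + 1)) (fun x' => g (x', y)) x]) :
    x ∈ closure ({x' | (x', y) ∈ X} \ (𝓡∂ (n + 1)).boundary M) := by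
  let χ := extChartAt (𝓡∂ (n + 1)) x
  let κ := interiorChart J y
  have hκ : IsInteriorCoord J κ := isInteriorCoord_interiorChart y
  have hyκ : y ∈ κ.source := mem_interiorChart_source (by simp [ModelWithCorners.Boundaryless.boundary_eq_empty])
  let Ψ : EuclideanSpace ℝ (Fin (n + 1)) × F → M × Y := fun q => (χ.symm q.1, κ.symm q.2)
  have hΨ : ContMDiffOn 𝓘(ℝ, EuclideanSpace ℝ (Fin (n + 1)) × F) ((𝓡∂ (n + 1)).prod J) ∞ Ψ
      (χ.target ×ˢ κ.target) :=
    ((contMDiffOn_extChartAt_symm (I := 𝓡∂ (n + 1)) (n := ∞) x).comp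
      contDiff_fst.contMDiff.contMDiffOn (fun q hq => hq.1)).prodMk
      (hκ.smooth_symm.comp contDiff_snd.contMDiff.contMDiffOn (fun q hq => hq.2))
  have hΨx : Ψ (χ x, κ y) = (x, y) := Prod.ext (extChartAt_to_inv x) (κ.left_inv hyκ)
  let D : Set (EuclideanSpace ℝ (Fin (n + 1)) × F) := (χ.target ×ˢ κ.target) ∩ Ψ ⁻¹' U
  let t : EuclideanSpace ℝ (Fin (n + 1)) →L[ℝ] ℝ := EuclideanSpace.proj 0
  have hrange : ∀ a : EuclideanSpace ℝ (Fin (n + 1)), a ∈ range (𝓡∂ (n + 1)) ↔ 0 ≤ t a := by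
    intro a
    rw [range_modelWithCornersEuclideanHalfSpace]
    rfl
  -- The coordinate domain is only relatively open in the half space.
  obtain ⟨O, hO, hDO⟩ : ∃ O, IsOpen O ∧ D = O ∩ {q | 0 ≤ t q.1} := by
    obtain ⟨u, hu, huD⟩ := (continuousOn_iff'.1 hΨ.continuousOn) U hU
    refine ⟨u ∩ (((𝓡∂ (n + 1)).symm ⁻¹' (chartAt (EuclideanHalfSpace (n + 1)) x).target) ×ˢ
      κ.target), hu.inter (((chartAt (EuclideanHalfSpace (n + 1)) x).open_target.preimage
        (𝓡∂ (n + 1)).continuous_symm).prod κ.open_target), ?_⟩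
    have h1 : D = u ∩ (χ.target ×ˢ κ.target) := by rw [← huD]; exact inter_comm _ _
    rw [h1]
    ext q
    simp only [χ, extChartAt_target, mem_inter_iff, mem_prod, hrange]
    change _ ↔ _ ∧ 0 ≤ t q.1
    tauto
  have hxD : (χ x, κ y) ∈ D :=
    ⟨⟨mem_extChartAt_target x, κ.map_source hyκ⟩, by rw [mem_preimage, hΨx]; exact hp⟩
  have hDu : UniqueDiffOn ℝ D := by
    have h1 : D = ((range (𝓡∂ (n + 1))) ×ˢ (univ : Set F)) ∩ O := by
      rw [hDO]
      ext q
      simp only [mem_inter_iff, mem_prod, hrange, mem_univ, and_true]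
      change _ ∧ 0 ≤ t q.1 ↔ _
      tauto
    rw [h1]
    exact ((𝓡∂ (n + 1)).uniqueDiffOn.prod uniqueDiffOn_univ).inter hO
  have hfD : ContDiffOn ℝ ∞ (f ∘ Ψ) D := by
    rw [← contMDiffOn_iff_contDiffOn]
    exact hf.comp (hΨ.mono inter_subset_left) (fun q hq => hq.2)
  have hgD : ContDiffOn ℝ ∞ (g ∘ Ψ) D := by
    rw [← contMDiffOn_iff_contDiffOn]
    exact hg.comp (hΨ.mono inter_subset_left) (fun q hq => hq.2)
  have hnD : {a | (a, κ y) ∈ D} ∈ nhdsWithin (χ x) (range (𝓡∂ (n + 1))) := by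
    refine mem_nhdsWithin.2 ⟨{a | (a, κ y) ∈ O}, hO.preimage (by fun_prop), ?_, ?_⟩
    · rw [hDO] at hxD; exact hxD.1
    · rintro a ⟨h1, h2⟩
      change (a, κ y) ∈ D
      rw [hDO]
      exact ⟨h1, (hrange a).1 h2⟩
  have hmemX : (x, y) ∈ X ∩ ((𝓡∂ (n + 1)).prod J).boundary (M × Y) ∩ U :=
    ⟨⟨hxy, mem_boundary_prod.2 hx⟩, hp⟩
  rw [hXU'] at hmemX
  have key := mem_closure_slice_of_mem_closure t hO hDO hfD hgD hDu (a := χ x) (b := κ y) hxD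
    (by simp only [Function.comp, hΨx]; exact hmemX.2.1)
    (by simp only [Function.comp, hΨx]; exact hmemX.2.2) ?_ ?_ ?_
  · have h1 : χ.symm (χ x) ∈ closure (χ.symm '' {a | (a, κ y) ∈ D ∧ 0 < t a ∧
        (f ∘ Ψ) (a, κ y) = 0 ∧ 0 < (g ∘ Ψ) (a, κ y)}) := by
      refine ContinuousWithinAt.mem_closure_image ?_ key
      exact (continuousAt_extChartAt_symm (I := 𝓡∂ (n + 1)) x).continuousWithinAt
    rw [extChartAt_to_inv] at h1
    refine closure_mono ?_ h1
    rintro _ ⟨a, ⟨haD, hta, hfa, hga⟩, rfl⟩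
    have hΨa : Ψ (a, κ y) = (χ.symm a, y) := Prod.ext rfl (κ.left_inv hyκ)
    have haU := haD.2
    simp only [Function.comp, mem_preimage, hΨa] at hfa hga haU
    refine ⟨?_, fun hb => hta.ne' ((extChartAt_symm_mem_boundary_iff haD.1.1).1 hb)⟩
    have : (χ.symm a, y) ∈ X ∩ U := by rw [hXU]; exact ⟨haU, hfa, hga.le⟩
    exact this.1
  · have h1 := surjective_pair_of_linearIndependent hli
    have e1 := fderivWithin_slice_eq_mvfderiv hU hf hp hyκ (h := f ∘ Ψ) rfl hnD
      ((hfD.differentiableOn (by simp)) _ hxD)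
    have e2 := fderivWithin_slice_eq_mvfderiv hU hg hp hyκ (h := g ∘ Ψ) rfl hnD
      ((hgD.differentiableOn (by simp)) _ hxD)
    intro z
    obtain ⟨u, hu⟩ := h1 z
    exact ⟨u, (Prod.ext (e1 u) (e2 u)).trans hu⟩
  · intro q hq ht hfq hgq
    have h1 : Ψ q ∈ X ∩ U := by rw [hXU]; exact ⟨hq.2, hfq, hgq.le⟩
    have h2 : Ψ q ∈ X ∩ ((𝓡∂ (n + 1)).prod J).boundary (M × Y) ∩ U :=
      ⟨⟨h1.1, mem_boundary_prod.2 ((extChartAt_symm_mem_boundary_iff hq.1.1).2 ht)⟩, hq.2⟩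
    rw [hXU'] at h2
    exact hgq.ne' h2.2.2
  · rw [mem_closure_iff_nhds]
    intro V hV
    have hc : ContinuousAt (fun p : M × Y => (χ p.1, κ p.2)) (x, y) := by
      refine ContinuousAt.prodMk ?_ ?_
      · exact (continuousAt_extChartAt (I := 𝓡∂ (n + 1)) x).comp
          (x := (x, y)) (f := Prod.fst) continuousAt_fst
      · exact (κ.continuousAt hyκ).comp (x := (x, y)) (f := Prod.snd) continuousAt_snd
    have hn : (fun p : M × Y => (χ p.1, κ p.2)) ⁻¹' V ∩ (χ.source ×ˢ κ.source ∩ U) ∈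
        nhds (x, y) :=
      Filter.inter_mem (hc.preimage_mem_nhds hV) (Filter.inter_mem
        (((isOpen_extChartAt_source x).prod κ.open_source).mem_nhds
          ⟨mem_extChartAt_source x, hyκ⟩) (hU.mem_nhds hp))
    obtain ⟨p', ⟨hV', ⟨hs1, hs2⟩, hU'⟩, hX', hb'⟩ :=
      mem_closure_iff_nhds.1 (hX.dense_interior hxy) _ hn
    have hΨp : Ψ (χ p'.1, κ p'.2) = p' := Prod.ext (χ.left_inv hs1) (κ.left_inv hs2)
    have h1 : p' ∈ X ∩ U := ⟨hX', hU'⟩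
    rw [hXU] at h1
    have htarget : χ p'.1 ∈ χ.target := χ.map_source hs1
    refine ⟨(χ p'.1, κ p'.2), hV', ⟨⟨htarget, κ.map_source hs2⟩, ?_⟩, ?_, ?_, ?_⟩
    · rw [mem_preimage, hΨp]; exact hU'
    · refine lt_of_le_of_ne (zero_le_of_mem_extChartAt_target htarget) (fun h0 => hb' ?_)
      have := (extChartAt_symm_mem_boundary_iff htarget).2 h0.symm
      rw [χ.left_inv hs1] at this
      exact mem_boundary_prod.2 this
    · simp only [Function.comp, hΨp]; exact h1.2.1
    · simp only [Function.comp, hΨp]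
      refine lt_of_le_of_ne h1.2.2 (fun h0 => hb' ?_)
      have : p' ∈ {q ∈ U | f q = 0 ∧ g q = 0} := ⟨hU', h1.2.1, h0.symm⟩
      rw [← hXU'] at this
      exact this.1.2

-- The condition on the right does not involve `y`: the boundary of the surface is a union of whole
-- fibres `{x} × Y`.
omit [IsManifold (𝓡∂ (n + 1)) ∞ M] [FiniteDimensional ℝ F] [IsManifold J ∞ Y] in
theorem IsHomologous.slice_boundary_iff {R : Set M} {X : Set (M × Y)}
    (h : IsHomologous ((𝓡∂ (n + 1)).prod J) (R ×ˢ univ) X) (x : M) (y : Y) :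
    (x, y) ∈ X ∧ x ∈ (𝓡∂ (n + 1)).boundary M ↔ x ∈ edge (𝓡∂ (n + 1)) R := by
  have h1 := Set.ext_iff.1 h.boundary_eq (x, y)
  rw [edge_prod_univ] at h1
  exact (and_congr_right' mem_boundary_prod.symm).trans (h1.trans (and_iff_left (mem_univ _)))

-- The function vanishes along the fibre through the point, so its vertical derivative is zero and
-- the differential is determined by its horizontal part.
omit [IsManifold (𝓡∂ (n + 1)) ∞ M] [FiniteDimensional ℝ F] [J.Boundaryless]
  [IsManifold J ∞ Y] in
theorem mvfderiv_eq_mvfderiv_slice {k : M × Y → ℝ} {x : M} {y : Y}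
    (hk : MDifferentiableAt ((𝓡∂ (n + 1)).prod J) 𝓘(ℝ, ℝ) k (x, y))
    (hk0 : ∀ᶠ y' in nhds y, k (x, y') = 0) (u : TangentSpace (𝓡∂ (n + 1)) x)
    (w : TangentSpace J y) :
    mvfderiv ((𝓡∂ (n + 1)).prod J) k (x, y) (u, w) =
      mvfderiv (𝓡∂ (n + 1)) (fun x' => k (x', y)) x u := by
  have h1 : mvfderiv J (fun y' => k (x, y')) y = 0 := by
    have h2 : (fun y' => k (x, y')) =ᶠ[nhds y] fun _ => (0 : ℝ) := hk0
    rw [mvfderiv, h2.mfderiv_eq, mfderiv_const]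
    ext
    rfl
  have h3 := mvfderiv_slice_right hk w
  rw [h1] at h3
  have h4 := (mvfderiv ((𝓡∂ (n + 1)).prod J) k (x, y)).map_add (u, 0) (0, w)
  have h5 : ((u, 0) + (0, w) : TangentSpace (𝓡∂ (n + 1)) x × TangentSpace J y) = (u, w) :=
    Prod.ext (add_zero u) (zero_add w)
  refine (congrArg _ h5.symm).trans (h4.trans ?_)
  rw [mvfderiv_slice hk u]
  exact (congrArg _ h3.symm).trans (add_zero _)

omit [IsManifold (𝓡∂ (n + 1)) ∞ M] [FiniteDimensional ℝ F] [IsManifold J ∞ Y] in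
/-- Horizontal slices are automatically transverse at the boundary, where the surface contains
`{x} × Y`. -/
theorem IsHomologous.exists_boundary_slice {R : Set M} {X : Set (M × Y)}
    (h : IsHomologous ((𝓡∂ (n + 1)).prod J) (R ×ˢ univ) X) {x : M} {y : Y} (hxX : (x, y) ∈ X)
    (hxb : x ∈ (𝓡∂ (n + 1)).boundary M) :
    ∃ (U : Set (M × Y)) (f g : M × Y → ℝ), IsOpen U ∧ (x, y) ∈ U ∧
      ContMDiffOn ((𝓡∂ (n + 1)).prod J) 𝓘(ℝ, ℝ) ∞ f U ∧
      ContMDiffOn ((𝓡∂ (n + 1)).prod J) 𝓘(ℝ, ℝ) ∞ g U ∧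
      LinearIndependent ℝ ![mvfderiv (𝓡∂ (n + 1)) (fun x' => f (x', y)) x,
        mvfderiv (𝓡∂ (n + 1)) (fun x' => g (x', y)) x] ∧
      X ∩ U = {q ∈ U | f q = 0 ∧ 0 ≤ g q} ∧
      X ∩ ((𝓡∂ (n + 1)).prod J).boundary (M × Y) ∩ U = {q ∈ U | f q = 0 ∧ g q = 0} := by
  have hX := h.isSurface
  obtain ⟨U, f, g, hU, hpU, hf, hg, hli, hXU, hXU'⟩ :=
    hX.boundary_point (x, y) hxX (mem_boundary_prod.2 hxb)
  refine ⟨U, f, g, hU, hpU, hf, hg, ?_, hXU, hXU'⟩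
  have hzero : ∀ᶠ y' in nhds y, f (x, y') = 0 ∧ g (x, y') = 0 := by
    filter_upwards [(hU.preimage (f := fun y' : Y => (x, y')) (by fun_prop)).mem_nhds hpU]
      with y' hy'
    have h1 := (h.slice_boundary_iff x y').2 ((h.slice_boundary_iff x y).1 ⟨hxX, hxb⟩)
    have h2 : (x, y') ∈ X ∩ ((𝓡∂ (n + 1)).prod J).boundary (M × Y) ∩ U :=
      ⟨⟨h1.1, mem_boundary_prod.2 h1.2⟩, hy'⟩
    rw [hXU'] at h2
    exact h2.2
  rw [LinearIndependent.pair_iff] at hli ⊢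
  intro s t hst
  refine hli s t (ContinuousLinearMap.ext ?_)
  rintro ⟨u, w⟩
  change s * mvfderiv ((𝓡∂ (n + 1)).prod J) f (x, y) (u, w) +
    t * mvfderiv ((𝓡∂ (n + 1)).prod J) g (x, y) (u, w) = 0
  rw [mvfderiv_eq_mvfderiv_slice (hf.mdifferentiableAt_of_isOpen hU hpU)
    (hzero.mono fun _ h => h.1) u w, mvfderiv_eq_mvfderiv_slice
    (hg.mdifferentiableAt_of_isOpen hU hpU) (hzero.mono fun _ h => h.2) u w]
  exact congrArg (fun T => T u) hst

/-- No genericity of `y` is needed: only boundary points require an argument, and there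
transversality is automatic. -/
theorem IsHomologous.slice_subset_closure {R : Set M} {X : Set (M × Y)}
    (h : IsHomologous ((𝓡∂ (n + 1)).prod J) (R ×ˢ univ) X) (y : Y) :
    {x | (x, y) ∈ X} ⊆ closure ({x | (x, y) ∈ X} \ (𝓡∂ (n + 1)).boundary M) := by
  intro x hxX
  by_cases hxb : x ∈ (𝓡∂ (n + 1)).boundary M
  · obtain ⟨U, f, g, hU, hpU, hf, hg, hli, hXU, hXU'⟩ := h.exists_boundary_slice hxX hxb
    exact mem_closure_slice_diff_boundary h.isSurface hxX hxb hU hpU hf hg hXU hXU' hli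
  · exact subset_closure ⟨hxX, hxb⟩

/-- At a transverse point, the slice of a region touches both the slice of the surface and the
complement. -/
theorem IsTransverseAt.mem_closure_slice {X r : Set (M × Y)} (hr1 : closure (interior r) = r)
    (hr3 : frontier r = X) {x : M} {y : Y} (hxX : (x, y) ∈ X)
    (hxb : x ∉ (𝓡∂ (n + 1)).boundary M) (hreg : IsTransverseAt (𝓡∂ (n + 1)) J X (x, y)) :
    x ∈ closure (interior {x | (x, y) ∈ r}) ∧ x ∈ closure {x | (x, y) ∈ r}ᶜ := by
  have hcont : Continuous (fun x : M => (x, y)) := by fun_prop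
  have hint : {x | (x, y) ∈ interior r} ⊆ interior {x | (x, y) ∈ r} :=
    interior_maximal (fun x (hx : (x, y) ∈ interior r) => (interior_subset hx : (x, y) ∈ r))
      (isOpen_interior.preimage hcont)
  obtain ⟨U, f, hU, hpU, hf, hXU, hdf⟩ := hreg
  have hdfN : mvfderiv ((𝓡∂ (n + 1)).prod J) f (x, y) ≠ 0 := by
    intro h0
    refine hdf (ContinuousLinearMap.ext fun u => ?_)
    have h1 := mvfderiv_slice (hf.mdifferentiableAt_of_isOpen hU hpU) u
    rw [h0] at h1
    exact h1
  obtain ⟨W, hW, hpW, hWU, hside⟩ := region_on_one_side hr1 hr3 hU hf hXU hpU hxX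
    (fun hb => hxb (mem_boundary_prod.1 hb)) hdfN
  have hf0 : f (x, y) = 0 := by
    have : (x, y) ∈ X ∩ U := ⟨hxX, hpU⟩
    rw [hXU] at this
    exact this.2
  have hWy : {x' | (x', y) ∈ W} ∈ nhds x := (hW.preimage hcont).mem_nhds hpW
  have hpos : x ∈ closure {x' | (x', y) ∈ W ∧ 0 < f (x', y)} := by
    have := mem_closure_pos_of_mvfderiv_ne_zero (hU.preimage hcont) (contMDiffOn_slice hf y)
      hpU hxb hdf hf0
    rw [mem_closure_iff_nhds] at this ⊢
    intro V hV
    obtain ⟨z, ⟨hz1, hz2⟩, hz3⟩ := this _ (Filter.inter_mem hV hWy)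
    exact ⟨z, hz1, hz2, hz3⟩
  have hneg : x ∈ closure {x' | (x', y) ∈ W ∧ f (x', y) < 0} := by
    have := mem_closure_neg_of_mvfderiv_ne_zero (hU.preimage hcont) (contMDiffOn_slice hf y)
      hpU hxb hdf hf0
    rw [mem_closure_iff_nhds] at this ⊢
    intro V hV
    obtain ⟨z, ⟨hz1, hz2⟩, hz3⟩ := this _ (Filter.inter_mem hV hWy)
    exact ⟨z, hz1, hz2, hz3⟩
  -- The region fills exactly one side of `{f = 0}`, and `f` takes both signs in the slice
  -- arbitrarily close to `x`.
  rcases hside with ⟨h1, h2⟩ | ⟨h1, h2⟩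
  · refine ⟨closure_mono (fun z hz => hint (h1 hz)) hpos, ?_⟩
    exact closure_mono (show _ ⊆ {x | (x, y) ∈ r}ᶜ from fun z hz => h2 hz) hneg
  · refine ⟨closure_mono (fun z hz => hint (h1 hz)) hneg, ?_⟩
    exact closure_mono (show _ ⊆ {x | (x, y) ∈ r}ᶜ from fun z hz => h2 hz) hpos

/-- If all the points of a horizontal slice in the interior are transverse, then the slice of a
surface homologous to `R × Y` is homologous to `R`. -/
theorem IsHomologous.slice [CompactSpace M] [T2Space M] [T2Space Y] {R : Set M} {X : Set (M × Y)}
    (h : IsHomologous ((𝓡∂ (n + 1)).prod J) (R ×ˢ univ) X) {y : Y}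
    (hreg : ∀ x, x ∉ (𝓡∂ (n + 1)).boundary M → (x, y) ∈ X →
      IsTransverseAt (𝓡∂ (n + 1)) J X (x, y)) :
    IsHomologous (𝓡∂ (n + 1)) R {x | (x, y) ∈ X} := by
  have hcont : Continuous (fun x : M => (x, y)) := by fun_prop
  refine ⟨⟨?_, h.slice_subset_closure y, ?_, ?_⟩, ?_, ?_⟩
  · exact (h.isSurface.isCompact.isClosed.preimage hcont).isCompact
  · intro x hxX hxb
    obtain ⟨U, f, hU, hpU, hf, hXU, hdf⟩ := hreg x hxb hxX
    refine ⟨{x' | (x', y) ∈ U}, fun x' => f (x', y), hU.preimage hcont, hpU,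
      contMDiffOn_slice hf y, hdf, ?_⟩
    ext x'
    exact Set.ext_iff.1 hXU (x', y)
  · intro x hxX hxb
    obtain ⟨U, f, g, hU, hpU, hf, hg, hli, hXU, hXU'⟩ := h.exists_boundary_slice hxX hxb
    refine ⟨{x' | (x', y) ∈ U}, fun x' => f (x', y), fun x' => g (x', y), hU.preimage hcont, hpU,
      contMDiffOn_slice hf y, contMDiffOn_slice hg y, hli, ?_, ?_⟩
    · ext x'
      exact Set.ext_iff.1 hXU (x', y)
    · ext x'
      exact (and_congr_left' (and_congr_right' mem_boundary_prod.symm)).trans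
        (Set.ext_iff.1 hXU' (x', y))
  · ext x
    exact h.slice_boundary_iff x y
  · obtain ⟨r, hr1, hr2, hr3⟩ := h.exists_region
    have hrc : IsClosed r := hr1 ▸ isClosed_closure
    have hsc : IsClosed {x | (x, y) ∈ r} := hrc.preimage hcont
    have hint : {x | (x, y) ∈ interior r} ⊆ interior {x | (x, y) ∈ r} :=
      interior_maximal (fun x (hx : (x, y) ∈ interior r) => (interior_subset hx : (x, y) ∈ r))
      (isOpen_interior.preimage hcont)
    have hside : ∀ x ∈ {x | (x, y) ∈ X} \ (𝓡∂ (n + 1)).boundary M,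
        x ∈ closure (interior {x | (x, y) ∈ r}) ∧ x ∈ closure {x | (x, y) ∈ r}ᶜ := fun x hx =>
      IsTransverseAt.mem_closure_slice hr1 hr3 hx.1 hx.2 (hreg x hx.2 hx.1)
    -- The slice of the region serves as homology region. In general a slice could lie in the region
    -- without bounding interior there, or have a smaller frontier; `hside` excludes this at
    -- interior points of the slice of `X`, and density carries it to boundary points.
    have hdense := h.slice_subset_closure y
    refine ⟨{x | (x, y) ∈ r}, ?_, ?_, ?_⟩
    · refine (closure_minimal interior_subset hsc).antisymm fun x hx => ?_
      by_cases hxi : (x, y) ∈ interior r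
      · exact subset_closure (hint hxi)
      · have hxX : (x, y) ∈ X := hr3 ▸ ⟨subset_closure hx, hxi⟩
        exact closure_minimal (fun z hz => (hside z hz).1) isClosed_closure (hdense hxX)
    · ext x
      have h1 : ((x, y) ∈ r ∧ (x, y) ∈ ((𝓡∂ (n + 1)).prod J).boundary (M × Y)) ↔
          (x ∈ R ∧ y ∈ univ) := Set.ext_iff.1 hr2 (x, y)
      rw [mem_boundary_prod, and_iff_left (mem_univ y)] at h1
      exact h1
    · apply Subset.antisymm
      · rintro x ⟨hx1, hx2⟩
        rw [hsc.closure_eq] at hx1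
        have : (x, y) ∈ frontier r := ⟨subset_closure hx1, fun hi => hx2 (hint hi)⟩
        rwa [hr3] at this
      · intro x hxX
        refine closure_minimal (fun z hz => ?_) isClosed_frontier (hdense hxX)
        rw [frontier_eq_closure_inter_closure]
        exact ⟨closure_mono interior_subset (hside z hz).1, (hside z hz).2⟩

end SliceDense

/-! ### Pullbacks of metrics. -/

section Pullback

variable {W : Type*} [NormedAddCommGroup W] [NormedSpace ℝ W]
  {W' : Type*} [NormedAddCommGroup W'] [NormedSpace ℝ W']
  {E : Type*} [NormedAddCommGroup E] [NormedSpace ℝ E] {H : Type*} [TopologicalSpace H]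
  {I : ModelWithCorners ℝ E H} {N : Type*} [TopologicalSpace N] [ChartedSpace H N]
  {F : Type*} [NormedAddCommGroup F] [NormedSpace ℝ F] {G : Type*} [TopologicalSpace G]
  {J : ModelWithCorners ℝ F G} {Y : Type*} [TopologicalSpace Y] [ChartedSpace G Y]

/-- The pullback of the metric `g` by the map `Φ`, at the point `p`. -/
def pullbackForm (g : ∀ p : N, TangentSpace I p →L[ℝ] TangentSpace I p →L[ℝ] ℝ) (Φ : W → N)
    (p : W) : LinearMap.BilinForm ℝ W :=
  LinearMap.mk₂ ℝ
    (fun a b => g (Φ p) (mfderiv 𝓘(ℝ, W) I Φ p a) (mfderiv 𝓘(ℝ, W) I Φ p b))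
    (fun a a' b => by
      rw [show mfderiv 𝓘(ℝ, W) I Φ p (a + a') = mfderiv 𝓘(ℝ, W) I Φ p a +
        mfderiv 𝓘(ℝ, W) I Φ p a' from map_add _ _ _, map_add]; rfl)
    (fun c a b => by
      rw [show mfderiv 𝓘(ℝ, W) I Φ p (c • a) = c • mfderiv 𝓘(ℝ, W) I Φ p a from map_smul _ _ _,
        map_smul]; rfl)
    (fun a b b' => by
      rw [show mfderiv 𝓘(ℝ, W) I Φ p (b + b') = mfderiv 𝓘(ℝ, W) I Φ p b +
        mfderiv 𝓘(ℝ, W) I Φ p b' from map_add _ _ _, map_add])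
    (fun c a b => by
      rw [show mfderiv 𝓘(ℝ, W) I Φ p (c • b) = c • mfderiv 𝓘(ℝ, W) I Φ p b from map_smul _ _ _,
        map_smul])

theorem pullbackForm_comp (g : ∀ p : N, TangentSpace I p →L[ℝ] TangentSpace I p →L[ℝ] ℝ)
    {Φ : W → N} {τ : W' → W} {q : W'} (hΦ : MDifferentiableAt 𝓘(ℝ, W) I Φ (τ q))
    (hτ : DifferentiableAt ℝ τ q) (a b : W') :
    pullbackForm g (Φ ∘ τ) q a b = pullbackForm g Φ (τ q) (fderiv ℝ τ q a) (fderiv ℝ τ q b) := by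
  have h : ∀ c, mfderiv 𝓘(ℝ, W') I (Φ ∘ τ) q c = mfderiv 𝓘(ℝ, W) I Φ (τ q) (fderiv ℝ τ q c) := by
    intro c
    rw [← mfderiv_eq_fderiv]
    exact mfderiv_comp_apply q hΦ hτ.mdifferentiableAt c
  exact congrArg₂ (fun u v => (g (Φ (τ q)) : E →L[ℝ] E →L[ℝ] ℝ) u v) (h a) (h b)

theorem pullbackForm_congr (g : ∀ p : N, TangentSpace I p →L[ℝ] TangentSpace I p →L[ℝ] ℝ)
    {Φ Φ' : W → N} {p : W} (h : Φ =ᶠ[nhds p] Φ') : pullbackForm g Φ p = pullbackForm g Φ' p := by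
  ext a b
  have h1 : mfderiv 𝓘(ℝ, W) I Φ p = mfderiv 𝓘(ℝ, W) I Φ' p := h.mfderiv_eq
  have h2 : ∀ (x x' : N) (e : x = x') (u v : E), (g x : E →L[ℝ] E →L[ℝ] ℝ) u v =
    (g x' : E →L[ℝ] E →L[ℝ] ℝ) u v := by rintro x _ rfl u v; rfl
  refine (h2 _ _ h.eq_of_nhds _ _).trans ?_
  have h3 : ∀ c, (mfderiv 𝓘(ℝ, W) I Φ p c : E) = (mfderiv 𝓘(ℝ, W) I Φ' p c : E) :=
    fun c => congrArg (fun T : W →L[ℝ] E => T c) h1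
  exact congrArg₂ (fun u v => (g (Φ' p) : E →L[ℝ] E →L[ℝ] ℝ) u v) (h3 a) (h3 b)

theorem pullbackForm_productMetric
    (gM : ∀ x : N, TangentSpace I x →L[ℝ] TangentSpace I x →L[ℝ] ℝ)
    (gY : ∀ y : Y, TangentSpace J y →L[ℝ] TangentSpace J y →L[ℝ] ℝ) {Φ : W → N × Y} {p : W}
    (hΦ : MDifferentiableAt 𝓘(ℝ, W) (I.prod J) Φ p) (a b : W) :
    pullbackForm (productMetric gM gY) Φ p a b =
      pullbackForm gM (fun q => (Φ q).1) p a b + pullbackForm gY (fun q => (Φ q).2) p a b := by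
  have h1 : MDifferentiableAt 𝓘(ℝ, W) I (fun q => (Φ q).1) p := hΦ.fst
  have h2 : MDifferentiableAt 𝓘(ℝ, W) J (fun q => (Φ q).2) p := hΦ.snd
  have h3 := h1.mfderiv_prod h2
  have h4 : ∀ c, mfderiv 𝓘(ℝ, W) (I.prod J) Φ p c =
      (mfderiv 𝓘(ℝ, W) I (fun q => (Φ q).1) p c, mfderiv 𝓘(ℝ, W) J (fun q => (Φ q).2) p c) :=
    fun c => congrArg (fun T => T c) h3
  exact congrArg₂ (fun u v : E × F => (productMetric gM gY (Φ p) : E × F →L[ℝ] E × F →L[ℝ] ℝ) u v)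
    (h4 a) (h4 b)

/-- The tangent map of `Φ` sends the constant fields `a` and `b` to continuous maps into the tangent
bundle, to which the smooth bundle form `g` is applied. -/
theorem continuousOn_pullbackForm [FiniteDimensional ℝ E] [IsManifold I ∞ N]
    (g : ContMDiffRiemannianMetric I ∞ E (fun x : N => TangentSpace I x)) {Φ : W → N} {O : Set W}
    (hO : IsOpen O) (hΦ : ContMDiffOn 𝓘(ℝ, W) I ∞ Φ O) (a b : W) :
    ContinuousOn (fun p => pullbackForm g.inner Φ p a b) O := by
  have key : ∀ a : W, ContMDiffOn 𝓘(ℝ, W) I.tangent 0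
      (fun p => (⟨Φ p, mfderiv 𝓘(ℝ, W) I Φ p a⟩ : TangentBundle I N)) O := by
    intro a
    have h1 : ContMDiffOn 𝓘(ℝ, W).tangent I.tangent 0 (tangentMapWithin 𝓘(ℝ, W) I Φ O) _ :=
      hΦ.contMDiffOn_tangentMapWithin (m := 0) (by simp) hO.uniqueMDiffOn
    have h2 : ContMDiff 𝓘(ℝ, W) 𝓘(ℝ, W).tangent 0
        (fun p : W => (⟨p, (a : TangentSpace 𝓘(ℝ, W) p)⟩ : TangentBundle 𝓘(ℝ, W) W)) :=
      contMDiff_vectorSpace_iff_contDiff.2 contDiff_const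
    have h3 := h1.comp (t := TotalSpace.proj ⁻¹' O) (s := O) h2.contMDiffOn (fun p hp => hp)
    refine h3.congr fun p hp => ?_
    simp only [Function.comp, tangentMapWithin, mfderivWithin_of_isOpen hO hp]
  have h4 : ContMDiffOn 𝓘(ℝ, W) (I.prod 𝓘(ℝ)) 0 (fun p => TotalSpace.mk' ℝ
      (E := Bundle.Trivial N ℝ) (Φ p) (g.inner (Φ p) (mfderiv 𝓘(ℝ, W) I Φ p a)
        (mfderiv 𝓘(ℝ, W) I Φ p b))) O := by
    apply ContMDiffOn.clm_bundle_apply₂ (F₁ := E) (F₂ := E)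
    · exact (g.contMDiff.of_le (by simp)).comp_contMDiffOn (hΦ.of_le (by simp))
    · exact key a
    · exact key b
  intro p hp
  have h5 := h4 p hp
  simp only [contMDiffWithinAt_totalSpace] at h5
  exact h5.2.continuousWithinAt

end Pullback

/-! ### Gram matrices. -/

section Gram

variable {W : Type*} [AddCommGroup W] [Module ℝ W] {ι κ : Type*}

/-- The Gram matrix of the vectors `v i`. -/
def gramMatrix (B : LinearMap.BilinForm ℝ W) (v : ι → W) : Matrix ι ι ℝ :=
  Matrix.of fun i j => B (v i) (v j)

theorem posSemidef_gramMatrix [Finite ι] {B : LinearMap.BilinForm ℝ W} (hs : ∀ x y, B x y = B y x)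
    (hn : ∀ x, 0 ≤ B x x) (v : ι → W) : (gramMatrix B v).PosSemidef := by
  have := Fintype.ofFinite ι
  refine Matrix.PosSemidef.of_dotProduct_mulVec_nonneg ?_ fun x => ?_
  · ext i j
    simp [gramMatrix, hs (v j) (v i)]
  · have h := hn (∑ i, x i • v i)
    simp only [map_sum, map_smul, LinearMap.sum_apply, LinearMap.smul_apply, smul_eq_mul] at h
    simp only [gramMatrix, dotProduct, Matrix.mulVec, Finset.mul_sum, Matrix.of_apply, Pi.star_apply,
      star_trivial]
    simp only [Finset.mul_sum] at h
    refine h.trans_eq (Finset.sum_congr rfl fun i _ => Finset.sum_congr rfl fun j _ => ?_)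
    rw [hs]
    ring

theorem posDef_gramMatrix [Finite ι] {B : LinearMap.BilinForm ℝ W} (hs : ∀ x y, B x y = B y x)
    (hn : ∀ x, x ≠ 0 → 0 < B x x) {v : ι → W} (hv : LinearIndependent ℝ v) :
    (gramMatrix B v).PosDef := by
  have := Fintype.ofFinite ι
  refine Matrix.PosDef.of_dotProduct_mulVec_pos ?_ fun x hx => ?_
  · ext i j
    simp [gramMatrix, hs (v j) (v i)]
  · have h := hn (∑ i, x i • v i) (fun h0 => hx (funext (Fintype.linearIndependent_iff.1 hv x h0)))
    simp only [map_sum, map_smul, LinearMap.sum_apply, LinearMap.smul_apply, smul_eq_mul] at h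
    simp only [gramMatrix, dotProduct, Matrix.mulVec, Finset.mul_sum, Matrix.of_apply, Pi.star_apply,
      star_trivial]
    simp only [Finset.mul_sum] at h
    refine h.trans_eq (Finset.sum_congr rfl fun i _ => Finset.sum_congr rfl fun j _ => ?_)
    rw [hs]
    ring

theorem gramMatrix_reindex (B : LinearMap.BilinForm ℝ W) (v : ι → W) (e : κ ≃ ι) [Fintype ι]
    [Fintype κ] [DecidableEq ι] [DecidableEq κ] :
    (gramMatrix B (fun k => v (e k))).det = (gramMatrix B v).det :=
  Matrix.det_submatrix_equiv_self e (gramMatrix B v)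

end Gram

/-! ### Coordinates on `ℝ^(n+m)`. -/

section EuclideanCoordinates

/-- The standard basis vectors. -/
def stdVec {d : ℕ} (a : Fin d) : EuclideanSpace ℝ (Fin d) := EuclideanSpace.single a (1 : ℝ)

theorem linearIndependent_stdVec {d : ℕ} : LinearIndependent ℝ (stdVec (d := d)) := by
  have := (EuclideanSpace.basisFun (Fin d) ℝ).toBasis.linearIndependent
  rw [show ⇑(EuclideanSpace.basisFun (Fin d) ℝ).toBasis = stdVec by ext a : 1; simp [stdVec]] at this
  exact this

theorem det_gramMatrix_comp {d : ℕ} (B : LinearMap.BilinForm ℝ (EuclideanSpace ℝ (Fin d)))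
    (L : EuclideanSpace ℝ (Fin d) →ₗ[ℝ] EuclideanSpace ℝ (Fin d)) :
    (gramMatrix (B.comp L L) stdVec).det = LinearMap.det L ^ 2 * (gramMatrix B stdVec).det := by
  have h : ∀ C : LinearMap.BilinForm ℝ (EuclideanSpace ℝ (Fin d)), gramMatrix C stdVec =
      LinearMap.BilinForm.toMatrix (EuclideanSpace.basisFun (Fin d) ℝ).toBasis C := by
    intro C
    ext i j
    simp [gramMatrix, stdVec, LinearMap.BilinForm.toMatrix_apply]
  rw [h, h, LinearMap.BilinForm.toMatrix_comp (EuclideanSpace.basisFun (Fin d) ℝ).toBasis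
    (EuclideanSpace.basisFun (Fin d) ℝ).toBasis, Matrix.det_mul, Matrix.det_mul, Matrix.det_transpose,
    LinearMap.det_toMatrix]
  ring

variable (n m : ℕ)

/-- Splitting off the last `m` coordinates of `ℝ^(n+m)`. -/
def splitCoord : EuclideanSpace ℝ (Fin (n + m)) ≃L[ℝ]
    EuclideanSpace ℝ (Fin m) × EuclideanSpace ℝ (Fin n) :=
  EuclideanSpace.finAddEquivProd.trans (ContinuousLinearEquiv.prodComm ℝ _ _)

variable {n m}

theorem splitCoord_inl (a : Fin n) :
    splitCoord n m (stdVec (finSumFinEquiv (Sum.inl a))) = (0, stdVec a) := by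
  refine Prod.ext ?_ ?_ <;> ext b <;>
    simp [splitCoord, stdVec, EuclideanSpace.finAddEquivProd, EuclideanSpace.sumEquivProd]

theorem splitCoord_inr (b : Fin m) :
    splitCoord n m (stdVec (finSumFinEquiv (Sum.inr b))) = (stdVec b, 0) := by
  refine Prod.ext ?_ ?_ <;> ext b <;>
    simp [splitCoord, stdVec, EuclideanSpace.finAddEquivProd, EuclideanSpace.sumEquivProd]

theorem measurePreserving_splitCoord : MeasurePreserving (splitCoord n m) := by
  have h1 : MeasurePreserving (LinearIsometryEquiv.piLpCongrLeft 2 ℝ ℝ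
      (finSumFinEquiv (m := n) (n := m)).symm) := LinearIsometryEquiv.measurePreserving _
  have h2 : MeasurePreserving (PiLp.sumPiLpEquivProdLpPiLp (𝕜 := ℝ) (ι := Fin n) (κ := Fin m) 2 (fun _ => ℝ)) := LinearIsometryEquiv.measurePreserving _
  have h3 := WithLp.volume_preserving_ofLp (EuclideanSpace ℝ (Fin n)) (EuclideanSpace ℝ (Fin m))
  exact (Measure.measurePreserving_swap.comp (h3.comp (h2.comp h1)))

end EuclideanCoordinates

/-! ### Area densities and change of parametrization. -/

section Density

variable {W : Type*} [NormedAddCommGroup W] [NormedSpace ℝ W]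
  {E : Type*} [NormedAddCommGroup E] [NormedSpace ℝ E] {H : Type*} [TopologicalSpace H]
  {I : ModelWithCorners ℝ E H} {N : Type*} [TopologicalSpace N] [ChartedSpace H N]

theorem pullbackForm_symm [IsManifold I ∞ N]
    (g : ContMDiffRiemannianMetric I ∞ E (fun x : N => TangentSpace I x))
    (Φ : W → N) (p a b : W) : pullbackForm g.inner Φ p a b = pullbackForm g.inner Φ p b a :=
  g.symm _ _ _

theorem pullbackForm_nonneg [IsManifold I ∞ N]
    (g : ContMDiffRiemannianMetric I ∞ E (fun x : N => TangentSpace I x))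
    (Φ : W → N) (p a : W) : 0 ≤ pullbackForm g.inner Φ p a a := by
  by_cases h : mfderiv 𝓘(ℝ, W) I Φ p a = 0
  · have h1 : g.inner (Φ p) (mfderiv 𝓘(ℝ, W) I Φ p a) (mfderiv 𝓘(ℝ, W) I Φ p a) = 0 := by
      rw [h, map_zero]
    exact h1.ge
  · exact (g.pos _ _ h).le

theorem pullbackForm_pos [IsManifold I ∞ N]
    (g : ContMDiffRiemannianMetric I ∞ E (fun x : N => TangentSpace I x))
    {Φ : W → N} {p : W} (h : Function.Injective (mfderiv 𝓘(ℝ, W) I Φ p)) {a : W} (ha : a ≠ 0) :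
    0 < pullbackForm g.inner Φ p a a :=
  g.pos _ _ fun h0 => ha (h (h0.trans (map_zero _).symm))

theorem continuousOn_det_gramMatrix {ι : Type*} [Fintype ι] [DecidableEq ι]
    [FiniteDimensional ℝ E] [IsManifold I ∞ N]
    (g : ContMDiffRiemannianMetric I ∞ E (fun x : N => TangentSpace I x)) {Φ : W → N} {O : Set W}
    (hO : IsOpen O) (hΦ : ContMDiffOn 𝓘(ℝ, W) I ∞ Φ O) (v : ι → W) :
    ContinuousOn (fun p => (gramMatrix (pullbackForm g.inner Φ p) v).det) O := by
  simp only [Matrix.det_apply, gramMatrix, Matrix.of_apply]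
  refine continuousOn_finsetSum _ fun σ _ => ContinuousOn.const_smul ?_ _
  exact continuousOn_finsetProd _ fun i _ => continuousOn_pullbackForm g hO hΦ _ _

variable {d : ℕ}

/-- The area density `√h` of a parametrized surface. -/
def areaDensity (g : ∀ p : N, TangentSpace I p →L[ℝ] TangentSpace I p →L[ℝ] ℝ)
    (φ : EuclideanSpace ℝ (Fin d) → N) (u : EuclideanSpace ℝ (Fin d)) : ℝ≥0∞ :=
  ENNReal.ofReal (Real.sqrt (inducedMetric I g φ u).det)

theorem areaDensity_eq (g : ∀ p : N, TangentSpace I p →L[ℝ] TangentSpace I p →L[ℝ] ℝ)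
    (φ : EuclideanSpace ℝ (Fin d) → N) (u : EuclideanSpace ℝ (Fin d)) : areaDensity g φ u =
      ENNReal.ofReal (Real.sqrt (gramMatrix (pullbackForm g φ u) stdVec).det) := rfl

theorem continuousOn_areaDensity [FiniteDimensional ℝ E] [IsManifold I ∞ N]
    (g : ContMDiffRiemannianMetric I ∞ E (fun x : N => TangentSpace I x))
    {φ : EuclideanSpace ℝ (Fin d) → N} {O : Set (EuclideanSpace ℝ (Fin d))}
    (hO : IsOpen O) (hφ : ContMDiffOn (𝓡 d) I ∞ φ O) :
    ContinuousOn (areaDensity g.inner φ) O :=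
  ENNReal.continuous_ofReal.comp_continuousOn
    (Real.continuous_sqrt.comp_continuousOn (continuousOn_det_gramMatrix g hO hφ stdVec))

theorem areaDensity_comp (g : ∀ p : N, TangentSpace I p →L[ℝ] TangentSpace I p →L[ℝ] ℝ)
    {φ : EuclideanSpace ℝ (Fin d) → N} {τ : EuclideanSpace ℝ (Fin d) → EuclideanSpace ℝ (Fin d)}
    {u : EuclideanSpace ℝ (Fin d)} (hφ : MDifferentiableAt (𝓡 d) I φ (τ u))
    (hτ : DifferentiableAt ℝ τ u) :
    areaDensity g (φ ∘ τ) u = ENNReal.ofReal |(fderiv ℝ τ u).det| * areaDensity g φ (τ u) := by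
  have h1 : pullbackForm g (φ ∘ τ) u = (pullbackForm g φ (τ u)).comp
      (fderiv ℝ τ u : EuclideanSpace ℝ (Fin d) →ₗ[ℝ] EuclideanSpace ℝ (Fin d))
      (fderiv ℝ τ u : EuclideanSpace ℝ (Fin d) →ₗ[ℝ] EuclideanSpace ℝ (Fin d)) := by
    ext a b
    exact pullbackForm_comp g hφ hτ a b
  rw [areaDensity_eq, areaDensity_eq, h1, det_gramMatrix_comp, Real.sqrt_mul (sq_nonneg _),
    Real.sqrt_sq_eq_abs, ENNReal.ofReal_mul (abs_nonneg _)]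

/-- Invariance of area under reparametrization: the Jacobian of `τ` is exactly the factor in
`areaDensity_comp`. -/
theorem lintegral_image_areaDensity
    (g : ∀ p : N, TangentSpace I p →L[ℝ] TangentSpace I p →L[ℝ] ℝ)
    {φ : EuclideanSpace ℝ (Fin d) → N} {τ : EuclideanSpace ℝ (Fin d) → EuclideanSpace ℝ (Fin d)}
    {D : Set (EuclideanSpace ℝ (Fin d))} (hD : MeasurableSet D)
    (hφ : ∀ u ∈ D, MDifferentiableAt (𝓡 d) I φ (τ u)) (hτ : ∀ u ∈ D, DifferentiableAt ℝ τ u)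
    (hinj : InjOn τ D) :
    ∫⁻ u in τ '' D, areaDensity g φ u = ∫⁻ u in D, areaDensity g (φ ∘ τ) u := by
  rw [lintegral_image_eq_lintegral_abs_det_fderiv_mul volume hD
    (fun u hu => (hτ u hu).hasFDerivAt.hasFDerivWithinAt) hinj]
  exact setLIntegral_congr_fun hD fun u hu => (areaDensity_comp g (hφ u hu) (hτ u hu)).symm

/-- The area is bounded by the sum over any countable family of coordinate patches. -/
theorem area_le_tsum [Nonempty N] {ι : Type*} [Countable ι]
    (g : ∀ p : N, TangentSpace I p →L[ℝ] TangentSpace I p →L[ℝ] ℝ) {X : Set N}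
    (φ : ι → LocalParam I d (X \ I.boundary N)) (A : ι → Set (EuclideanSpace ℝ (Fin d)))
    (hA : ∀ i, MeasurableSet (A i)) (hA' : ∀ i, A i ⊆ (φ i).source)
    (hX : X \ I.boundary N ⊆ ⋃ i, (φ i).toFun '' A i) :
    area I g d X ≤ ∑' i, ∫⁻ u in A i, areaDensity g (φ i).toFun u := by
  obtain ⟨f, hf⟩ := exists_injective_nat ι
  -- The definition of area needs families indexed by `ℕ`; indices outside the range of `f` receive
  -- a patch with empty source, which contributes zero.
  let φ₀ : LocalParam I d (X \ I.boundary N) :=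
    { source := ∅
      toFun := fun _ => Classical.arbitrary N
      isOpen_source := isOpen_empty
      contMDiffOn := fun _ h => h.elim
      injOn := fun _ h => h.elim
      immersion := fun _ h => h.elim
      mapsTo := fun _ h => h.elim }
  have hφ : ∀ i, Function.extend f φ (fun _ => φ₀) (f i) = φ i := fun i => hf.extend_apply _ _ i
  have hAf : ∀ i, Function.extend f A (fun _ => ∅) (f i) = A i := fun i => hf.extend_apply _ _ i
  have hAn : ∀ k, k ∉ range f → Function.extend f A (fun _ => ∅) k = ∅ := fun k hk =>
    Function.extend_apply' _ _ _ (by simpa using hk)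
  refine (iInf₂_le (Function.extend f φ fun _ => φ₀) (Function.extend f A fun _ => ∅)).trans
    ((iInf₂_le ?_ ?_).trans ?_)
  · intro k
    by_cases hk : k ∈ range f
    · obtain ⟨i, rfl⟩ := hk
      rw [hφ, hAf]
      exact ⟨hA i, hA' i⟩
    · rw [hAn k hk]
      exact ⟨MeasurableSet.empty, empty_subset _⟩
  · refine hX.trans (iUnion_subset fun i => ?_)
    refine Subset.trans ?_ (subset_iUnion _ (f i))
    rw [hφ, hAf]
  · change ∑' k, ∫⁻ u in Function.extend f A (fun _ => ∅) k,
      areaDensity g (Function.extend f φ (fun _ => φ₀) k).toFun u ≤ _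
    rw [← hf.tsum_eq (f := fun k => ∫⁻ u in Function.extend f A (fun _ => ∅) k,
      areaDensity g (Function.extend f φ (fun _ => φ₀) k).toFun u)]
    · simp only [hφ, hAf]
      exact le_rfl
    · intro k hk
      by_contra hk'
      refine hk ?_
      simp only [hAn k hk', Measure.restrict_empty, lintegral_zero_measure]

end Density

/-! ### Product patches. -/

section ProductParam

variable {E : Type*} [NormedAddCommGroup E] [NormedSpace ℝ E] {H : Type*} [TopologicalSpace H]
  {I : ModelWithCorners ℝ E H} {M : Type*} [TopologicalSpace M] [ChartedSpace H M]
  {n m : ℕ} {G : Type*} [TopologicalSpace G]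
  {J : ModelWithCorners ℝ (EuclideanSpace ℝ (Fin m)) G} {Y : Type*} [TopologicalSpace Y]
  [ChartedSpace G Y]

theorem IsInteriorCoord.injective_mfderiv_symm
    {κ : OpenPartialHomeomorph M E} (hκ : IsInteriorCoord I κ) {v : E} (hv : v ∈ κ.target) :
    Function.Injective (mfderiv 𝓘(ℝ, E) I κ.symm v) := by
  have h := hκ.mfderiv_comp_mfderiv_symm (κ.map_target hv)
  rw [κ.right_inv hv] at h
  exact Function.LeftInverse.injective h

theorem mfderiv_prodCoord {φ : EuclideanSpace ℝ (Fin n) → M} {ψ : EuclideanSpace ℝ (Fin m) → Y}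
    {u : EuclideanSpace ℝ (Fin (n + m))}
    (hφ : MDifferentiableAt (𝓡 n) I φ (splitCoord n m u).2)
    (hψ : MDifferentiableAt (𝓡 m) J ψ (splitCoord n m u).1) (c : EuclideanSpace ℝ (Fin (n + m))) :
    mfderiv (𝓡 (n + m)) (I.prod J)
      (fun u => (φ (splitCoord n m u).2, ψ (splitCoord n m u).1)) u c =
      (mfderiv (𝓡 n) I φ (splitCoord n m u).2 (splitCoord n m c).2,
        mfderiv (𝓡 m) J ψ (splitCoord n m u).1 (splitCoord n m c).1) := by
  let s2 : EuclideanSpace ℝ (Fin (n + m)) →L[ℝ] EuclideanSpace ℝ (Fin n) :=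
    (ContinuousLinearMap.snd ℝ _ _).comp (splitCoord n m).toContinuousLinearMap
  let s1 : EuclideanSpace ℝ (Fin (n + m)) →L[ℝ] EuclideanSpace ℝ (Fin m) :=
    (ContinuousLinearMap.fst ℝ _ _).comp (splitCoord n m).toContinuousLinearMap
  have h2 : MDifferentiableAt (𝓡 (n + m)) (𝓡 n) s2 u := s2.mdifferentiableAt
  have h1 : MDifferentiableAt (𝓡 (n + m)) (𝓡 m) s1 u := s1.mdifferentiableAt
  have h3 := (hφ.comp (f := s2) u h2).mfderiv_prod (hψ.comp (f := s1) u h1)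
  have h4 := congrArg (fun T => T c) h3
  refine h4.trans (Prod.ext ?_ ?_)
  · refine (mfderiv_comp_apply u hφ h2 c).trans ?_
    exact congrArg (mfderiv (𝓡 n) I φ (splitCoord n m u).2)
      (congrArg (fun T => T c) (s2.hasMFDerivAt (x := u)).mfderiv)
  · refine (mfderiv_comp_apply u hψ h1 c).trans ?_
    exact congrArg (mfderiv (𝓡 m) J ψ (splitCoord n m u).1)
      (congrArg (fun T => T c) (s1.hasMFDerivAt (x := u)).mfderiv)

/-- For a product map the Gram matrix is block diagonal, so its determinant is a product. -/
theorem areaDensity_prodCoord [IsManifold I ∞ M] [IsManifold J ∞ Y]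
    (gM : ContMDiffRiemannianMetric I ∞ E (fun x : M => TangentSpace I x))
    (gY : ContMDiffRiemannianMetric J ∞ (EuclideanSpace ℝ (Fin m)) (fun y : Y => TangentSpace J y))
    {φ : EuclideanSpace ℝ (Fin n) → M} {ψ : EuclideanSpace ℝ (Fin m) → Y}
    {u : EuclideanSpace ℝ (Fin (n + m))}
    (hφ : MDifferentiableAt (𝓡 n) I φ (splitCoord n m u).2)
    (hψ : MDifferentiableAt (𝓡 m) J ψ (splitCoord n m u).1) :
    areaDensity (productMetric gM.inner gY.inner)
      (fun u => (φ (splitCoord n m u).2, ψ (splitCoord n m u).1)) u =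
      areaDensity gY.inner ψ (splitCoord n m u).1 * areaDensity gM.inner φ (splitCoord n m u).2 := by
  have key : ∀ a b, pullbackForm (productMetric gM.inner gY.inner)
      (fun u => (φ (splitCoord n m u).2, ψ (splitCoord n m u).1)) u a b =
      pullbackForm gM.inner φ (splitCoord n m u).2 (splitCoord n m a).2 (splitCoord n m b).2 +
      pullbackForm gY.inner ψ (splitCoord n m u).1 (splitCoord n m a).1 (splitCoord n m b).1 := by
    intro a b
    exact congrArg₂ (fun u v : E × EuclideanSpace ℝ (Fin m) =>
      (productMetric gM.inner gY.inner (φ (splitCoord n m _).2, ψ (splitCoord n m _).1) :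
        E × EuclideanSpace ℝ (Fin m) →L[ℝ] E × EuclideanSpace ℝ (Fin m) →L[ℝ] ℝ) u v)
      (mfderiv_prodCoord hφ hψ a) (mfderiv_prodCoord hφ hψ b)
  have h1 : (gramMatrix (pullbackForm (productMetric gM.inner gY.inner)
      (fun u => (φ (splitCoord n m u).2, ψ (splitCoord n m u).1)) u) stdVec).det =
      (gramMatrix (pullbackForm gM.inner φ (splitCoord n m u).2) stdVec).det *
      (gramMatrix (pullbackForm gY.inner ψ (splitCoord n m u).1) stdVec).det := by
    rw [← gramMatrix_reindex _ _ finSumFinEquiv, ← Matrix.det_fromBlocks_zero₂₁ _ 0]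
    congr 1
    ext (i | i) (j | j) <;> simp only [gramMatrix, Matrix.of_apply, key, splitCoord_inl,
      splitCoord_inr, map_zero, LinearMap.zero_apply, add_zero, zero_add, Matrix.fromBlocks_apply₁₁,
      Matrix.fromBlocks_apply₁₂, Matrix.fromBlocks_apply₂₁, Matrix.fromBlocks_apply₂₂,
      Matrix.zero_apply]
  rw [areaDensity_eq, h1, Real.sqrt_mul (posSemidef_gramMatrix (pullbackForm_symm gM φ _)
    (pullbackForm_nonneg gM φ _) _).det_nonneg, ENNReal.ofReal_mul (Real.sqrt_nonneg _), mul_comm]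
  rfl

/-- The product of a coordinate patch of a surface in `M` and a chart of `Y`. -/
def LocalParam.prodCoord {S : Set M} {S' : Set (M × Y)} (φ : LocalParam I n S)
    (hS : S ×ˢ univ ⊆ S') (κ : OpenPartialHomeomorph Y (EuclideanSpace ℝ (Fin m)))
    (hκ : IsInteriorCoord J κ) : LocalParam (I.prod J) (n + m) S' where
  source := splitCoord n m ⁻¹' (κ.target ×ˢ φ.source)
  toFun u := (φ.toFun (splitCoord n m u).2, κ.symm (splitCoord n m u).1)
  isOpen_source := (κ.open_target.prod φ.isOpen_source).preimage (splitCoord n m).continuous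
  contMDiffOn := by
    have h2 : ContMDiff (𝓡 (n + m)) (𝓡 n) ∞ (fun u => (splitCoord n m u).2) :=
      (contDiff_snd.comp (splitCoord n m).contDiff).contMDiff
    have h1 : ContMDiff (𝓡 (n + m)) (𝓡 m) ∞ (fun u => (splitCoord n m u).1) :=
      (contDiff_fst.comp (splitCoord n m).contDiff).contMDiff
    exact (φ.contMDiffOn.comp h2.contMDiffOn fun u hu => hu.2).prodMk
      (hκ.smooth_symm.comp h1.contMDiffOn fun u hu => hu.1)
  injOn := by
    intro u hu u' hu' h
    exact (splitCoord n m).injective (Prod.ext (κ.symm.injOn hu.1 hu'.1 (congrArg Prod.snd h))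
      (φ.injOn hu.2 hu'.2 (congrArg Prod.fst h)))
  immersion := by
    intro u hu c c' h
    have h1 := mfderiv_prodCoord (φ.contMDiffOn.mdifferentiableAt_of_isOpen φ.isOpen_source hu.2)
      (hκ.smooth_symm.mdifferentiableAt_of_isOpen κ.open_target hu.1)
    have h2 := (h1 c).symm.trans (h.trans (h1 c'))
    exact (splitCoord n m).injective (Prod.ext
      (hκ.injective_mfderiv_symm hu.1 (congrArg Prod.snd h2))
      (φ.immersion _ hu.2 (congrArg Prod.fst h2)))
  mapsTo := fun u hu => hS ⟨φ.mapsTo hu.2, mem_univ _⟩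

end ProductParam

/-! ### Partition of `Y` into chart pieces, in place of a Riemannian measure. -/

section Partition

variable {m : ℕ} {G : Type*} [TopologicalSpace G]
  (J : ModelWithCorners ℝ (EuclideanSpace ℝ (Fin m)) G) (Y : Type*) [TopologicalSpace Y]
  [ChartedSpace G Y]

/-- A partition of `Y` into finitely many measurable pieces of coordinate charts. -/
structure ChartPartition where
  num : ℕ
  chart : Fin num → OpenPartialHomeomorph Y (EuclideanSpace ℝ (Fin m))
  piece : Fin num → Set (EuclideanSpace ℝ (Fin m))
  isInteriorCoord : ∀ j, IsInteriorCoord J (chart j)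
  measurableSet_piece : ∀ j, MeasurableSet (piece j)
  exists_compact : ∀ j, ∃ K, IsCompact K ∧ piece j ⊆ K ∧ K ⊆ (chart j).target
  iUnion_eq : ⋃ j, (chart j).symm '' piece j = univ
  disjoint : ∀ i j, i ≠ j → Disjoint ((chart i).symm '' piece i) ((chart j).symm '' piece j)
  dense_of_ae : ∀ P : Y → Prop, (∀ j, ∀ᵐ v, v ∈ piece j → P ((chart j).symm v)) → Dense {y | P y}

/-- Finitely many coordinate balls cover `Y`; the `j`-th piece is the `j`-th ball minus the earlier
ones. For density, given a nonempty open `U`, take the least `j` whose ball meets `U`: the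
intersection lies entirely in the `j`-th piece and has positive measure in the chart. -/
theorem nonempty_chartPartition [CompactSpace Y] [J.Boundaryless] [IsManifold J ∞ Y] :
    Nonempty (ChartPartition J Y) := by
  have hb : ∀ y : Y, y ∉ J.boundary Y := by
    intro y; rw [ModelWithCorners.Boundaryless.boundary_eq_empty]; exact notMem_empty y
  have h1 : ∀ y : Y, ∃ r > 0, Metric.closedBall (interiorChart J y y) r ⊆
      (interiorChart J y).target := fun y =>
    Metric.nhds_basis_closedBall.mem_iff.1 ((interiorChart J y).open_target.mem_nhds
      ((interiorChart J y).map_source (mem_interiorChart_source (hb y))))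
  choose r hr hrt using h1
  let O : Y → Set Y := fun y => (interiorChart J y).source ∩
    interiorChart J y ⁻¹' Metric.ball (interiorChart J y y) (r y)
  have hO : ∀ y, IsOpen (O y) := fun y =>
    (interiorChart J y).isOpen_inter_preimage Metric.isOpen_ball
  obtain ⟨t, ht⟩ := isCompact_univ.elim_finite_subcover O hO (fun y _ => mem_iUnion.2
    ⟨y, mem_interiorChart_source (hb y), Metric.mem_ball_self (hr y)⟩)
  let c : Fin t.card → Y := fun j => t.equivFin.symm j
  have hc : ∀ y, ∃ j, y ∈ O (c j) := by
    intro y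
    obtain ⟨z, hz, hy⟩ := mem_iUnion₂.1 (ht (mem_univ y))
    exact ⟨t.equivFin ⟨z, hz⟩, by simpa [c] using hy⟩
  let κ : Fin t.card → OpenPartialHomeomorph Y (EuclideanSpace ℝ (Fin m)) :=
    fun j => interiorChart J (c j)
  let B : Fin t.card → Set (EuclideanSpace ℝ (Fin m)) := fun j =>
    Metric.ball (κ j (c j)) (r (c j)) \ ⋃ i : Fin t.card, ⋃ _ : i < j,
      (κ j).target ∩ (κ j).symm ⁻¹' O (c i)
  have hBt : ∀ j, B j ⊆ (κ j).target := fun j =>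
    sdiff_subset.trans (Metric.ball_subset_closedBall.trans (hrt (c j)))
  have hmem : ∀ (j : Fin t.card) (v : EuclideanSpace ℝ (Fin m)), v ∈ B j → (κ j).symm v ∈ O (c j) ∧ ∀ i < j, (κ j).symm v ∉ O (c i) := by
    intro j v hv
    refine ⟨⟨(κ j).map_target (hBt j hv), ?_⟩, fun i hi hmem => hv.2 ?_⟩
    · change κ j ((κ j).symm v) ∈ Metric.ball (κ j (c j)) (r (c j))
      rw [(κ j).right_inv (hBt j hv)]
      exact hv.1
    · exact mem_iUnion₂.2 ⟨i, hi, hBt j hv, hmem⟩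
  have hmem' : ∀ j y, y ∈ O (c j) → (∀ i < j, y ∉ O (c i)) → κ j y ∈ B j := by
    intro j y hy hi
    refine ⟨hy.2, fun h => ?_⟩
    obtain ⟨i, hij, -, hO'⟩ := mem_iUnion₂.1 h
    rw [mem_preimage, (κ j).left_inv hy.1] at hO'
    exact hi i hij hO'
  refine ⟨⟨t.card, κ, B, fun j => isInteriorCoord_interiorChart _, fun j => ?_, fun j =>
    ⟨Metric.closedBall (κ j (c j)) (r (c j)), isCompact_closedBall _ _,
      sdiff_subset.trans Metric.ball_subset_closedBall, hrt (c j)⟩, ?_, ?_, ?_⟩⟩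
  · refine Metric.isOpen_ball.measurableSet.diff (.iUnion fun i => .iUnion fun _ => ?_)
    exact ((κ j).isOpen_inter_preimage_symm (hO _)).measurableSet
  · refine eq_univ_of_forall fun y => mem_iUnion.2 ?_
    have hne : {j | y ∈ O (c j)}.Nonempty := hc y
    obtain ⟨j, hj⟩ := exists_minimal_of_wellFoundedLT (fun j => y ∈ O (c j)) hne
    refine ⟨j, κ j y, hmem' j y hj.1 (fun i hi h => hj.not_lt h hi), (κ j).left_inv hj.1.1⟩
  · have key : ∀ i j, i < j →
        Disjoint ((κ i).symm '' B i) ((κ j).symm '' B j) := by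
      intro i j hij
      rw [Set.disjoint_left]
      rintro _ ⟨v, hv, rfl⟩ ⟨w, hw, hvw⟩
      exact (hmem j w hw).2 i hij (hvw ▸ (hmem i v hv).1)
    intro i j hij
    rcases lt_or_gt_of_ne hij with h | h
    · exact key i j h
    · exact (key j i h).symm
  · intro P hP
    rw [dense_iff_inter_open]
    intro U hU hUne
    have hne : {j | (U ∩ O (c j)).Nonempty}.Nonempty := by
      obtain ⟨y, hy⟩ := hUne
      obtain ⟨j, hj⟩ := hc y
      exact ⟨j, y, hy, hj⟩
    obtain ⟨j, hj⟩ := exists_minimal_of_wellFoundedLT (fun j => (U ∩ O (c j)).Nonempty) hne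
    have hopen : IsOpen ((κ j).target ∩ (κ j).symm ⁻¹' (U ∩ O (c j))) :=
      (κ j).isOpen_inter_preimage_symm (hU.inter (hO _))
    have hnon : ((κ j).target ∩ (κ j).symm ⁻¹' (U ∩ O (c j))).Nonempty := by
      obtain ⟨y, hyU, hyO⟩ := hj.1
      refine ⟨κ j y, (κ j).map_source hyO.1, ?_⟩
      rw [mem_preimage, (κ j).left_inv hyO.1]
      exact ⟨hyU, hyO⟩
    have hpos := hopen.measure_pos volume hnon
    obtain ⟨v, hv, hPv⟩ : ∃ v ∈ (κ j).target ∩ (κ j).symm ⁻¹' (U ∩ O (c j)),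
        v ∈ B j → P ((κ j).symm v) := by
      by_contra! hcon
      refine hpos.ne' (measure_mono_null (fun v hv => ?_) (hP j))
      have := hcon v hv
      exact fun h => this.2 (h this.1)
    refine ⟨(κ j).symm v, hv.2.1, hPv ?_⟩
    have := hmem' j _ hv.2.2 (fun i hi h => hj.not_lt ⟨_, hv.2.1, h⟩ hi)
    rwa [(κ j).right_inv hv.1] at this

end Partition

/-! ### The volume of `Y` and the upper bound for the area of a product. -/

section Volume

variable {m : ℕ} {G : Type*} [TopologicalSpace G]
  {J : ModelWithCorners ℝ (EuclideanSpace ℝ (Fin m)) G} {Y : Type*} [TopologicalSpace Y]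
  [ChartedSpace G Y] [IsManifold J ∞ Y]
  (gY : ContMDiffRiemannianMetric J ∞ (EuclideanSpace ℝ (Fin m)) (fun y : Y => TangentSpace J y))

namespace ChartPartition

variable (C : ChartPartition J Y)

omit [IsManifold J ∞ Y] in
theorem piece_subset (j : Fin C.num) : C.piece j ⊆ (C.chart j).target := by
  obtain ⟨K, -, h1, h2⟩ := C.exists_compact j
  exact h1.trans h2

/-- The Riemannian volume of the pieces. -/
def pieceVolume (j : Fin C.num) : ℝ≥0∞ :=
  ∫⁻ v in C.piece j, areaDensity gY.inner (C.chart j).symm v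

/-- The Riemannian volume of `Y`. -/
def totalVolume : ℝ≥0∞ := ∑ j, C.pieceVolume gY j

theorem continuousOn_density (j : Fin C.num) :
    ContinuousOn (areaDensity gY.inner (C.chart j).symm) (C.chart j).target :=
  continuousOn_areaDensity gY (C.chart j).open_target (C.isInteriorCoord j).smooth_symm

theorem aemeasurable_density (j : Fin C.num) : AEMeasurable
    (areaDensity gY.inner (C.chart j).symm) (volume.restrict (C.piece j)) :=
  ((C.continuousOn_density gY j).aemeasurable (C.chart j).open_target.measurableSet).mono_measure
    (Measure.restrict_mono (C.piece_subset j) le_rfl)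

theorem density_pos (j : Fin C.num) {v : EuclideanSpace ℝ (Fin m)} (hv : v ∈ (C.chart j).target) :
    0 < areaDensity gY.inner (C.chart j).symm v := by
  rw [areaDensity_eq, ENNReal.ofReal_pos]
  exact Real.sqrt_pos.2 (posDef_gramMatrix (pullbackForm_symm gY _ _) (fun x hx =>
    pullbackForm_pos gY ((C.isInteriorCoord j).injective_mfderiv_symm hv) hx)
    linearIndependent_stdVec).det_pos

theorem density_ne_top (j : Fin C.num) (v : EuclideanSpace ℝ (Fin m)) :
    areaDensity gY.inner (C.chart j).symm v ≠ ⊤ := ENNReal.ofReal_ne_top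

theorem pieceVolume_ne_top (j : Fin C.num) : C.pieceVolume gY j ≠ ⊤ := by
  obtain ⟨K, hK, h1, h2⟩ := C.exists_compact j
  refine ((lintegral_mono_set h1).trans_lt ?_).ne
  obtain ⟨b, hb⟩ : ∃ b : ℝ≥0∞, b ≠ ⊤ ∧
      ∀ v ∈ K, areaDensity gY.inner (C.chart j).symm v ≤ b := by
    rcases K.eq_empty_or_nonempty with rfl | hne
    · exact ⟨0, ENNReal.zero_ne_top, fun v hv => hv.elim⟩
    · obtain ⟨v, hv, hmax⟩ := hK.exists_isMaxOn hne ((C.continuousOn_density gY j).mono h2)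
      exact ⟨_, C.density_ne_top gY j v, fun w hw => hmax hw⟩
  refine (setLIntegral_mono' hK.measurableSet hb.2).trans_lt ?_
  rw [setLIntegral_const]
  exact ENNReal.mul_lt_top hb.1.lt_top hK.measure_lt_top

theorem totalVolume_ne_top : C.totalVolume gY ≠ ⊤ :=
  ENNReal.sum_ne_top.2 fun j _ => C.pieceVolume_ne_top gY j

/-- The density is positive, so zero volume would make every piece null; then `dense_of_ae`, applied
to the false property, would make the empty set dense. -/
theorem totalVolume_ne_zero [Nonempty Y] : C.totalVolume gY ≠ 0 := by
  intro h
  have h1 : ∀ j, C.pieceVolume gY j = 0 := fun j =>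
    Finset.sum_eq_zero_iff.1 h j (Finset.mem_univ j)
  have h2 := C.dense_of_ae (fun _ => False) (fun j => by
    have h3 := (lintegral_eq_zero_iff' (C.aemeasurable_density gY j)).1 (h1 j)
    rw [Filter.EventuallyEq, ae_restrict_iff' (C.measurableSet_piece j)] at h3
    filter_upwards [h3] with v hv hv'
    exact (C.density_pos gY j (C.piece_subset j hv')).ne' (hv hv'))
  obtain ⟨y, hy⟩ := h2.nonempty
  exact hy

end ChartPartition

variable {E : Type*} [NormedAddCommGroup E] [NormedSpace ℝ E] [FiniteDimensional ℝ E]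
  {H : Type*} [TopologicalSpace H]
  {I : ModelWithCorners ℝ E H} {M : Type*} [TopologicalSpace M] [ChartedSpace H M]
  [IsManifold I ∞ M] [J.Boundaryless] {n : ℕ}
  (gM : ContMDiffRiemannianMetric I ∞ E (fun x : M => TangentSpace I x))

theorem LocalParam.aemeasurable_density {S : Set M} (φ : LocalParam I n S)
    {A : Set (EuclideanSpace ℝ (Fin n))} (hA : A ⊆ φ.source) :
    AEMeasurable (areaDensity gM.inner φ.toFun) (volume.restrict A) :=
  ((continuousOn_areaDensity gM φ.isOpen_source φ.contMDiffOn).aemeasurable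
    φ.isOpen_source.measurableSet).mono_measure (Measure.restrict_mono hA le_rfl)

omit [J.Boundaryless] in
theorem lintegral_prodCoord (C : ChartPartition J Y) {S : Set M} {S' : Set (M × Y)}
    (φ : LocalParam I n S) (hS : S ×ˢ univ ⊆ S') {A : Set (EuclideanSpace ℝ (Fin n))}
    (hA : MeasurableSet A) (hA' : A ⊆ φ.source) (j : Fin C.num) :
    ∫⁻ u in splitCoord n m ⁻¹' (C.piece j ×ˢ A), areaDensity (productMetric gM.inner gY.inner)
      (φ.prodCoord hS (C.chart j) (C.isInteriorCoord j)).toFun u =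
      C.pieceVolume gY j * ∫⁻ u in A, areaDensity gM.inner φ.toFun u := by
  have hBA : MeasurableSet (C.piece j ×ˢ A) := (C.measurableSet_piece j).prod hA
  have h1 : ∀ u ∈ splitCoord n m ⁻¹' (C.piece j ×ˢ A),
      areaDensity (productMetric gM.inner gY.inner)
        (φ.prodCoord hS (C.chart j) (C.isInteriorCoord j)).toFun u =
      (fun p : EuclideanSpace ℝ (Fin m) × EuclideanSpace ℝ (Fin n) =>
        areaDensity gY.inner (C.chart j).symm p.1 * areaDensity gM.inner φ.toFun p.2)
        (splitCoord n m u) := fun u hu =>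
    areaDensity_prodCoord gM gY (φ.contMDiffOn.mdifferentiableAt_of_isOpen φ.isOpen_source
      (hA' hu.2)) ((C.isInteriorCoord j).smooth_symm.mdifferentiableAt_of_isOpen
        (C.chart j).open_target (C.piece_subset j hu.1))
  rw [setLIntegral_congr_fun (hBA.preimage (splitCoord n m).continuous.measurable) h1]
  refine (measurePreserving_splitCoord.setLIntegral_comp_preimage_emb
    (splitCoord n m).toHomeomorph.measurableEmbedding
    (fun p => areaDensity gY.inner (C.chart j).symm p.1 * areaDensity gM.inner φ.toFun p.2)
    (C.piece j ×ˢ A)).trans ?_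
  rw [Measure.volume_eq_prod, ← Measure.prod_restrict, lintegral_prod_mul
      (C.aemeasurable_density gY j) (φ.aemeasurable_density gM hA')]
  rfl

/-- Patches covering the interior of `X`, multiplied by the chart pieces of `Y`, cover the interior
of `X × Y`, and the area of each product is a product of integrals. -/
theorem area_prod_univ_le [Nonempty M] [Nonempty Y] (C : ChartPartition J Y) (X : Set M) :
    area (I.prod J) (productMetric gM.inner gY.inner) (n + m) (X ×ˢ (univ : Set Y)) ≤
      area I gM.inner n X * C.totalVolume gY := by
  -- Dividing by the volume, which is finite and nonzero, frees the infimum that defines the area of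
  -- `X`.
  rw [← ENNReal.div_le_iff_le_mul (Or.inl (C.totalVolume_ne_zero gY))
    (Or.inl (C.totalVolume_ne_top gY))]
  refine le_iInf₂ fun φ A => le_iInf₂ fun hA hX => ?_
  rw [ENNReal.div_le_iff_le_mul (Or.inl (C.totalVolume_ne_zero gY))
    (Or.inl (C.totalVolume_ne_top gY))]
  have hS : (X \ I.boundary M) ×ˢ (univ : Set Y) ⊆ X ×ˢ univ \ (I.prod J).boundary (M × Y) :=
    fun p hp => ⟨⟨hp.1.1, mem_univ _⟩, fun hb => hp.1.2 (mem_boundary_prod.1 hb)⟩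
  refine (area_le_tsum (ι := ℕ × Fin C.num) (productMetric gM.inner gY.inner)
    (fun i => (φ i.1).prodCoord hS (C.chart i.2) (C.isInteriorCoord i.2))
    (fun i => splitCoord n m ⁻¹' (C.piece i.2 ×ˢ A i.1))
    (fun i => ((C.measurableSet_piece i.2).prod (hA i.1).1).preimage
      (splitCoord n m).continuous.measurable)
    (fun i => preimage_mono (prod_mono (C.piece_subset i.2) (hA i.1).2)) ?_).trans_eq ?_
  · rintro ⟨x, y⟩ ⟨⟨hx, -⟩, hb⟩
    obtain ⟨i, a, ha, hax⟩ := mem_iUnion.1 (hX ⟨hx, fun h => hb (mem_boundary_prod.2 h)⟩)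
    obtain ⟨j, b, hb, hby⟩ := mem_iUnion.1 (C.iUnion_eq.symm ▸ mem_univ y)
    refine mem_iUnion.2 ⟨(i, j), (splitCoord n m).symm (b, a), ?_, ?_⟩
    · rw [mem_preimage, ContinuousLinearEquiv.apply_symm_apply]
      exact ⟨hb, ha⟩
    · refine Prod.ext ?_ ?_
      · change (φ i).toFun (splitCoord n m ((splitCoord n m).symm (b, a))).2 = x
        rw [ContinuousLinearEquiv.apply_symm_apply]
        exact hax
      · change (C.chart j).symm (splitCoord n m ((splitCoord n m).symm (b, a))).1 = y
        rw [ContinuousLinearEquiv.apply_symm_apply]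
        exact hby
  · rw [tsum_congr fun i : ℕ × Fin C.num =>
      lintegral_prodCoord gY gM C (φ i.1) hS (hA i.1).1 (hA i.1).2 i.2,
      ENNReal.tsum_prod (f := fun i j => C.pieceVolume gY j *
        ∫⁻ u in A i, areaDensity gM.inner (φ i).toFun u), ← ENNReal.tsum_mul_right]
    refine tsum_congr fun i => ?_
    rw [tsum_fintype, ChartPartition.totalVolume, ← Finset.sum_mul, mul_comm]
    rfl

end Volume

/-! ### The coarea inequality in fibred coordinates. -/

section Coarea

variable {E : Type*} [NormedAddCommGroup E] [NormedSpace ℝ E]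
  {H : Type*} [TopologicalSpace H]
  {I : ModelWithCorners ℝ E H} {M : Type*} [TopologicalSpace M] [ChartedSpace H M]
  {n m : ℕ} {G : Type*} [TopologicalSpace G]
  {J : ModelWithCorners ℝ (EuclideanSpace ℝ (Fin m)) G} {Y : Type*} [TopologicalSpace Y]
  [ChartedSpace G Y]

/-- A parametrization of a hypersurface in `M × Y` which is fibered over coordinates of `Y`. -/
structure FiberedParam (I : ModelWithCorners ℝ E H)
    (J : ModelWithCorners ℝ (EuclideanSpace ℝ (Fin m)) G) (n : ℕ) (S : Set (M × Y))
    (ψ : EuclideanSpace ℝ (Fin m) → Y) where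
  source : Set (EuclideanSpace ℝ (Fin m) × EuclideanSpace ℝ (Fin n))
  toFun : EuclideanSpace ℝ (Fin m) × EuclideanSpace ℝ (Fin n) → M × Y
  isOpen_source : IsOpen source
  contMDiffOn : ContMDiffOn 𝓘(ℝ, EuclideanSpace ℝ (Fin m) × EuclideanSpace ℝ (Fin n))
    (I.prod J) ∞ toFun source
  injOn : InjOn toFun source
  immersion : ∀ p ∈ source, Function.Injective
    (mfderiv 𝓘(ℝ, EuclideanSpace ℝ (Fin m) × EuclideanSpace ℝ (Fin n)) (I.prod J) toFun p)
  mapsTo : MapsTo toFun source S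
  snd_eq : ∀ p ∈ source, (toFun p).2 = ψ p.1

namespace FiberedParam

variable {S : Set (M × Y)} {ψ : EuclideanSpace ℝ (Fin m) → Y} (Φ : FiberedParam I J n S ψ)

theorem hasFDerivAt_slice (v : EuclideanSpace ℝ (Fin m)) (w : EuclideanSpace ℝ (Fin n)) :
    HasFDerivAt (fun w : EuclideanSpace ℝ (Fin n) => (v, w)) (ContinuousLinearMap.inr ℝ
      (EuclideanSpace ℝ (Fin m)) (EuclideanSpace ℝ (Fin n))) w :=
  hasFDerivAt_prodMk_right v w

/-- The parametrization of the slice over `v`. -/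
def slice (v : EuclideanSpace ℝ (Fin m)) : LocalParam I n {x | (x, ψ v) ∈ S} where
  source := {w | (v, w) ∈ Φ.source}
  toFun w := (Φ.toFun (v, w)).1
  isOpen_source := Φ.isOpen_source.preimage (by fun_prop)
  contMDiffOn := by
    have h : ContMDiff (𝓡 n) 𝓘(ℝ, EuclideanSpace ℝ (Fin m) × EuclideanSpace ℝ (Fin n)) ∞
        (fun w : EuclideanSpace ℝ (Fin n) => (v, w)) :=
      (contDiff_const.prodMk contDiff_id).contMDiff
    exact contMDiff_fst.comp_contMDiffOn (Φ.contMDiffOn.comp h.contMDiffOn fun w hw => hw)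
  injOn := by
    intro w hw w' hw' h
    have h1 := Φ.injOn hw hw' (Prod.ext h ((Φ.snd_eq _ hw).trans (Φ.snd_eq _ hw').symm))
    exact congrArg Prod.snd h1
  immersion := by
    intro w hw c c' h
    have hd := Φ.contMDiffOn.mdifferentiableAt_of_isOpen Φ.isOpen_source hw
    have hτ : MDifferentiableAt (𝓡 n) 𝓘(ℝ, EuclideanSpace ℝ (Fin m) × EuclideanSpace ℝ (Fin n))
        (fun w : EuclideanSpace ℝ (Fin n) => (v, w)) w :=
      (hasFDerivAt_slice v w).differentiableAt.mdifferentiableAt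
    have hc := hd.comp w hτ
    have h1 : mfderiv (𝓡 n) (I.prod J) (fun w => Φ.toFun (v, w)) w =
        (mfderiv (𝓡 n) I (fun w => (Φ.toFun (v, w)).1) w).prod
          (mfderiv (𝓡 n) J (fun w => (Φ.toFun (v, w)).2) w) := hc.fst.mfderiv_prod hc.snd
    have h2 : mfderiv (𝓡 n) J (fun w => (Φ.toFun (v, w)).2) w = 0 := by
      have : (fun w => (Φ.toFun (v, w)).2) =ᶠ[nhds w] fun _ => ψ v := by
        filter_upwards [(Φ.isOpen_source.preimage (f := fun w : EuclideanSpace ℝ (Fin n) => (v, w))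
          (by fun_prop)).mem_nhds hw] with z hz
        exact Φ.snd_eq _ hz
      exact this.mfderiv_eq.trans mfderiv_const
    have h3 : ∀ c, mfderiv (𝓡 n) (I.prod J) (fun w => Φ.toFun (v, w)) w c =
        (mfderiv (𝓡 n) I (fun w => (Φ.toFun (v, w)).1) w c, 0) := fun c =>
      (congrArg (fun T => T c) h1).trans (congrArg (fun z : EuclideanSpace ℝ (Fin m) =>
        ((mfderiv (𝓡 n) I (fun w => (Φ.toFun (v, w)).1) w c : E), z)) (congrArg (fun T => T c) h2))
    have h4 : mfderiv (𝓡 n) (I.prod J) (fun w => Φ.toFun (v, w)) w c =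
        mfderiv (𝓡 n) (I.prod J) (fun w => Φ.toFun (v, w)) w c' :=
      (h3 c).trans ((congrArg (fun z => (z, 0)) h).trans (h3 c').symm)
    have h5 : ∀ c, mfderiv (𝓡 n) (I.prod J) (fun w => Φ.toFun (v, w)) w c =
        mfderiv 𝓘(ℝ, EuclideanSpace ℝ (Fin m) × EuclideanSpace ℝ (Fin n)) (I.prod J) Φ.toFun (v, w)
          ((0, c) : EuclideanSpace ℝ (Fin m) × EuclideanSpace ℝ (Fin n)) := fun c =>
      (mfderiv_comp_apply w hd hτ c).trans (congrArg (mfderiv 𝓘(ℝ, EuclideanSpace ℝ (Fin m) ×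
        EuclideanSpace ℝ (Fin n)) (I.prod J) Φ.toFun (v, w))
          (congrArg (fun T => T c) ((hasFDerivAt_slice v w).hasMFDerivAt).mfderiv))
    have h6 := Φ.immersion _ hw ((h5 c).symm.trans (h4.trans (h5 c')))
    exact congrArg Prod.snd h6
  mapsTo := by
    intro w hw
    have h := Φ.mapsTo hw
    rwa [← Prod.mk.eta (p := Φ.toFun (v, w)), Φ.snd_eq _ hw] at h

variable [IsManifold I ∞ M] [IsManifold J ∞ Y]
  (gM : ContMDiffRiemannianMetric I ∞ E (fun x : M => TangentSpace I x))
  (gY : ContMDiffRiemannianMetric J ∞ (EuclideanSpace ℝ (Fin m)) (fun y : Y => TangentSpace J y))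

omit [IsManifold J ∞ Y] in
theorem pullbackForm_slice {v : EuclideanSpace ℝ (Fin m)} {w : EuclideanSpace ℝ (Fin n)}
    (hw : (v, w) ∈ Φ.source) (a b : EuclideanSpace ℝ (Fin n)) :
    pullbackForm gM.inner (Φ.slice v).toFun w a b =
      pullbackForm gM.inner (fun p => (Φ.toFun p).1) (v, w) (0, a) (0, b) := by
  have hd := (Φ.contMDiffOn.mdifferentiableAt_of_isOpen Φ.isOpen_source hw).fst
  have h := pullbackForm_comp gM.inner (W' := EuclideanSpace ℝ (Fin n)) (q := w)
    (Φ := fun p => (Φ.toFun p).1) (τ := fun w => (v, w)) hd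
    (hasFDerivAt_slice v w).differentiableAt a b
  rw [(hasFDerivAt_slice v w).fderiv] at h
  exact h

omit [IsManifold J ∞ Y] in
theorem areaDensity_slice {v : EuclideanSpace ℝ (Fin m)} {w : EuclideanSpace ℝ (Fin n)}
    (hw : (v, w) ∈ Φ.source) :
    areaDensity gM.inner (Φ.slice v).toFun w = ENNReal.ofReal (Real.sqrt (gramMatrix
      (pullbackForm gM.inner (fun p => (Φ.toFun p).1) (v, w)) (fun a => (0, stdVec a))).det) := by
  rw [areaDensity_eq]
  refine congrArg (fun A : Matrix (Fin n) (Fin n) ℝ => ENNReal.ofReal (Real.sqrt A.det)) ?_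
  ext a b
  exact Φ.pullbackForm_slice gM hw _ _

omit [IsManifold I ∞ M] in
theorem pullbackForm_snd {p : EuclideanSpace ℝ (Fin m) × EuclideanSpace ℝ (Fin n)}
    (hp : p ∈ Φ.source) (hψ : MDifferentiableAt (𝓡 m) J ψ p.1)
    (a b : EuclideanSpace ℝ (Fin m) × EuclideanSpace ℝ (Fin n)) :
    pullbackForm gY.inner (fun p => (Φ.toFun p).2) p a b = pullbackForm gY.inner ψ p.1 a.1 b.1 := by
  have h : (fun p => (Φ.toFun p).2) =ᶠ[nhds p] ψ ∘ Prod.fst := by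
    filter_upwards [Φ.isOpen_source.mem_nhds hp] with z hz
    exact Φ.snd_eq z hz
  rw [pullbackForm_congr gY.inner h, pullbackForm_comp gY.inner hψ differentiableAt_fst]
  rw [fderiv_fst]
  rfl

/-- The pointwise coarea inequality. In fibred coordinates the `Y`-component depends on `v` alone,
so the metric of `Y` adds `K` to the lower right block only; the rest is a positive semidefinite
Gram matrix whose upper left block `A` is the metric of the slice. Now
`det_mul_det_le_det_fromBlocks` applies. -/
theorem areaDensity_mul_le {p : EuclideanSpace ℝ (Fin m) × EuclideanSpace ℝ (Fin n)}
    (hp : p ∈ Φ.source) (hψ : MDifferentiableAt (𝓡 m) J ψ p.1) :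
    areaDensity gY.inner ψ p.1 * areaDensity gM.inner (Φ.slice p.1).toFun p.2 ≤
      areaDensity (productMetric gM.inner gY.inner) (Φ.toFun ∘ splitCoord n m)
        ((splitCoord n m).symm p) := by
  have hd := Φ.contMDiffOn.mdifferentiableAt_of_isOpen Φ.isOpen_source hp
  have key : ∀ a b, pullbackForm (productMetric gM.inner gY.inner) (Φ.toFun ∘ splitCoord n m)
      ((splitCoord n m).symm p) a b =
      pullbackForm gM.inner (fun p => (Φ.toFun p).1) p (splitCoord n m a) (splitCoord n m b) +
      pullbackForm gY.inner ψ p.1 (splitCoord n m a).1 (splitCoord n m b).1 := by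
    intro a b
    have hs : splitCoord n m ((splitCoord n m).symm p) = p :=
      (splitCoord n m).apply_symm_apply p
    rw [pullbackForm_comp _ (by rw [hs]; exact hd) (splitCoord n m).differentiableAt,
      ContinuousLinearEquiv.fderiv, hs, pullbackForm_productMetric _ _ hd,
      Φ.pullbackForm_snd gY hp hψ]
    rfl
  let A : Matrix (Fin n) (Fin n) ℝ := gramMatrix
    (pullbackForm gM.inner (fun p => (Φ.toFun p).1) p) (fun a => (0, stdVec a))
  let B : Matrix (Fin n) (Fin m) ℝ := Matrix.of fun a b =>
    pullbackForm gM.inner (fun p => (Φ.toFun p).1) p (0, stdVec a) (stdVec b, 0)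
  let D : Matrix (Fin m) (Fin m) ℝ := gramMatrix
    (pullbackForm gM.inner (fun p => (Φ.toFun p).1) p) (fun b => (stdVec b, 0))
  let K : Matrix (Fin m) (Fin m) ℝ := gramMatrix (pullbackForm gY.inner ψ p.1) stdVec
  have hK : K.PosSemidef :=
    posSemidef_gramMatrix (pullbackForm_symm gY ψ _) (pullbackForm_nonneg gY ψ _) _
  have hM : (Matrix.fromBlocks A B B.conjTranspose D).PosSemidef := by
    have := posSemidef_gramMatrix (pullbackForm_symm gM (fun p => (Φ.toFun p).1) p)
      (pullbackForm_nonneg gM (fun p => (Φ.toFun p).1) p)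
      (Sum.elim (fun a : Fin n => ((0, stdVec a) : EuclideanSpace ℝ (Fin m) ×
        EuclideanSpace ℝ (Fin n))) (fun b : Fin m => (stdVec b, 0)))
    convert this using 1
    ext (i | i) (j | j)
    · rfl
    · rfl
    · exact pullbackForm_symm gM (fun p => (Φ.toFun p).1) p _ _
    · rfl
  have h1 : (gramMatrix (pullbackForm (productMetric gM.inner gY.inner)
      (Φ.toFun ∘ splitCoord n m) ((splitCoord n m).symm p)) stdVec).det =
      (Matrix.fromBlocks A B B.conjTranspose (D + K)).det := by
    rw [← gramMatrix_reindex _ _ finSumFinEquiv]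
    congr 1
    ext (i | i) (j | j)
    · simp only [gramMatrix, Matrix.of_apply, key, splitCoord_inl, map_zero,
        add_zero, Matrix.fromBlocks_apply₁₁, A]
    · simp only [gramMatrix, Matrix.of_apply, key, splitCoord_inl, splitCoord_inr, map_zero,
        LinearMap.zero_apply, add_zero, Matrix.fromBlocks_apply₁₂, B]
    · simp only [gramMatrix, Matrix.of_apply, key, splitCoord_inl, splitCoord_inr, map_zero,
        add_zero, Matrix.fromBlocks_apply₂₁, B, Matrix.conjTranspose_apply,
        star_trivial]
      exact pullbackForm_symm gM (fun p => (Φ.toFun p).1) p _ _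
    · simp only [gramMatrix, Matrix.of_apply, key, splitCoord_inr, Matrix.fromBlocks_apply₂₂,
        Matrix.add_apply, D, K]
  rw [areaDensity_eq (productMetric gM.inner gY.inner), h1, Φ.areaDensity_slice gM hp,
    areaDensity_eq, ← ENNReal.ofReal_mul (Real.sqrt_nonneg _), ← Real.sqrt_mul hK.det_nonneg,
    mul_comm]
  exact ENNReal.ofReal_le_ofReal (Real.sqrt_le_sqrt (det_mul_det_le_det_fromBlocks hM hK))

/-- The coarea inequality for a fibered parametrization. -/
theorem exists_coarea [FiniteDimensional ℝ E] {T : Set (EuclideanSpace ℝ (Fin m))} (hT : IsOpen T)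
    (hψ : ContMDiffOn (𝓡 m) J ∞ ψ T) (hsub : ∀ p ∈ Φ.source, p.1 ∈ T)
    {D : Set (EuclideanSpace ℝ (Fin m) × EuclideanSpace ℝ (Fin n))} (hD : MeasurableSet D)
    (hD' : D ⊆ Φ.source) :
    ∃ g : EuclideanSpace ℝ (Fin m) → ℝ≥0∞, Measurable g ∧
      (∀ v, MeasurableSet {w | (v, w) ∈ D} ∧
        ∫⁻ w in {w | (v, w) ∈ D}, areaDensity gM.inner (Φ.slice v).toFun w = g v) ∧
      ∫⁻ v, areaDensity gY.inner ψ v * g v ≤ ∫⁻ u in splitCoord n m ⁻¹' D,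
        areaDensity (productMetric gM.inner gY.inner) (Φ.toFun ∘ splitCoord n m) u := by
  let δ : EuclideanSpace ℝ (Fin m) × EuclideanSpace ℝ (Fin n) → ℝ≥0∞ := fun p =>
    ENNReal.ofReal (Real.sqrt (gramMatrix
      (pullbackForm gM.inner (fun p => (Φ.toFun p).1) p) (fun a : Fin n => (0, stdVec a))).det)
  have hδ : ContinuousOn δ Φ.source :=
    ENNReal.continuous_ofReal.comp_continuousOn (Real.continuous_sqrt.comp_continuousOn
      (continuousOn_det_gramMatrix gM Φ.isOpen_source
        (contMDiff_fst.comp_contMDiffOn Φ.contMDiffOn) _))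
  have hη : ContinuousOn (fun p : EuclideanSpace ℝ (Fin m) × EuclideanSpace ℝ (Fin n) =>
      areaDensity gY.inner ψ p.1) Φ.source :=
    (continuousOn_areaDensity gY hT hψ).comp continuousOn_fst hsub
  have hmeas : ∀ f : EuclideanSpace ℝ (Fin m) × EuclideanSpace ℝ (Fin n) → ℝ≥0∞,
      ContinuousOn f Φ.source → Measurable (D.indicator f) := by
    classical
    intro f hf
    rw [← piecewise_eq_indicator]
    exact (hf.mono hD').measurable_piecewise continuousOn_const hD
  have hδ' := hmeas δ hδ
  have hDv : ∀ v, MeasurableSet {w | (v, w) ∈ D} := fun v => hD.preimage (by fun_prop)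
  have hprod : Measurable (D.indicator fun p => areaDensity gY.inner ψ p.1 * δ p) := by
    have : (D.indicator fun p => areaDensity gY.inner ψ p.1 * δ p) = fun p =>
        D.indicator (fun p => areaDensity gY.inner ψ p.1) p * D.indicator δ p := by
      ext p
      by_cases hp : p ∈ D <;> simp [hp]
    rw [this]
    exact (hmeas _ hη).mul hδ'
  refine ⟨fun v => ∫⁻ w, D.indicator δ (v, w), hδ'.lintegral_prod_right', fun v => ⟨hDv v, ?_⟩, ?_⟩
  · rw [← lintegral_indicator (hDv v)]
    refine lintegral_congr fun w => ?_
    by_cases hw : (v, w) ∈ D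
    · rw [indicator_of_mem hw, indicator_of_mem (show w ∈ {w | (v, w) ∈ D} from hw)]
      exact Φ.areaDensity_slice gM (hD' hw)
    · rw [indicator_of_notMem hw, indicator_of_notMem (show w ∉ {w | (v, w) ∈ D} from hw)]
  · have h1 : ∀ v, areaDensity gY.inner ψ v * ∫⁻ w, D.indicator δ (v, w) =
        ∫⁻ w, D.indicator (fun p => areaDensity gY.inner ψ p.1 * δ p) (v, w) := by
      intro v
      rw [← lintegral_const_mul' (areaDensity gY.inner ψ v) _ ENNReal.ofReal_ne_top]
      refine lintegral_congr fun w => ?_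
      by_cases hw : (v, w) ∈ D <;> simp [hw]
    simp only [h1]
    rw [← lintegral_prod _ hprod.aemeasurable, lintegral_indicator hD]
    have h2 := measurePreserving_splitCoord.setLIntegral_comp_preimage_emb
      (splitCoord n m).toHomeomorph.measurableEmbedding
      (fun p => areaDensity (productMetric gM.inner gY.inner) (Φ.toFun ∘ splitCoord n m)
        ((splitCoord n m).symm p)) D
    simp only [ContinuousLinearEquiv.symm_apply_apply] at h2
    rw [h2]
    refine setLIntegral_mono' hD fun p hp => ?_
    have h3 := Φ.areaDensity_mul_le gM gY (hD' hp)
      (hψ.mdifferentiableAt_of_isOpen hT (hsub p (hD' hp)))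
    rwa [Φ.areaDensity_slice gM (hD' hp)] at h3

end FiberedParam

end Coarea

/-! ### The coarea inequality on a coordinate patch. -/

section CoareaPatch

variable {E : Type*} [NormedAddCommGroup E] [NormedSpace ℝ E] [FiniteDimensional ℝ E]
  {H : Type*} [TopologicalSpace H]
  {I : ModelWithCorners ℝ E H} {M : Type*} [TopologicalSpace M] [ChartedSpace H M]
  {n m : ℕ} {G : Type*} [TopologicalSpace G]
  {J : ModelWithCorners ℝ (EuclideanSpace ℝ (Fin m)) G} {Y : Type*} [TopologicalSpace Y]
  [ChartedSpace G Y]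

theorem injective_fderiv_symm {E F : Type*} [NormedAddCommGroup E] [NormedSpace ℝ E]
    [NormedAddCommGroup F] [NormedSpace ℝ F] {e : OpenPartialHomeomorph E F}
    (he : ContDiffOn ℝ ∞ e e.source) (he' : ContDiffOn ℝ ∞ e.symm e.target) {p : F}
    (hp : p ∈ e.target) : Function.Injective (fderiv ℝ e.symm p) := by
  have h1 : DifferentiableAt ℝ e.symm p :=
    (he'.contDiffAt (e.open_target.mem_nhds hp)).differentiableAt (by simp)
  have h2 : DifferentiableAt ℝ e (e.symm p) :=
    (he.contDiffAt (e.open_source.mem_nhds (e.map_target hp))).differentiableAt (by simp)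
  have h3 := fderiv_comp p h2 h1
  have h4 : (e ∘ e.symm) =ᶠ[nhds p] id := by
    filter_upwards [e.open_target.mem_nhds hp] with z hz
    exact e.right_inv hz
  rw [h4.fderiv_eq, fderiv_id] at h3
  exact Function.LeftInverse.injective (g := fderiv ℝ e (e.symm p)) fun c =>
    (congrArg (fun T => T c) h3).symm

variable {S : Set (M × Y)} (φ : LocalParam (I.prod J) (n + m) S)
  {κ : OpenPartialHomeomorph Y (EuclideanSpace ℝ (Fin m))}

/-- A straightening of the coordinates makes a coordinate patch fibered. -/
def LocalParam.fibered (e : OpenPartialHomeomorph (EuclideanSpace ℝ (Fin (n + m)))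
      (EuclideanSpace ℝ (Fin m) × EuclideanSpace ℝ (Fin n)))
    (he : ContDiffOn ℝ ∞ e e.source) (he' : ContDiffOn ℝ ∞ e.symm e.target)
    (hsub : ∀ u ∈ e.source, u ∈ φ.source ∧ (φ.toFun u).2 ∈ κ.source)
    (hfst : ∀ u ∈ e.source, (e u).1 = κ (φ.toFun u).2) : FiberedParam I J n S κ.symm where
  source := e.target
  toFun := φ.toFun ∘ e.symm
  isOpen_source := e.open_target
  contMDiffOn := φ.contMDiffOn.comp he'.contMDiffOn fun p hp => (hsub _ (e.map_target hp)).1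
  injOn := by
    intro p hp p' hp' h
    exact e.symm.injOn hp hp'
      (φ.injOn (hsub _ (e.map_target hp)).1 (hsub _ (e.map_target hp')).1 h)
  immersion := by
    intro p hp
    have h1 : DifferentiableAt ℝ e.symm p :=
      (he'.contDiffAt (e.open_target.mem_nhds hp)).differentiableAt (by simp)
    have h2 := φ.contMDiffOn.mdifferentiableAt_of_isOpen φ.isOpen_source
      (hsub _ (e.map_target hp)).1
    rw [mfderiv_comp p h2 h1.mdifferentiableAt, mfderiv_eq_fderiv]
    exact (φ.immersion _ (hsub _ (e.map_target hp)).1).comp (injective_fderiv_symm he he' hp)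
  mapsTo := fun p hp => φ.mapsTo (hsub _ (e.map_target hp)).1
  snd_eq := by
    intro p hp
    have h1 := hfst _ (e.map_target hp)
    rw [e.right_inv hp] at h1
    rw [h1, κ.left_inv (hsub _ (e.map_target hp)).2]
    rfl

omit [FiniteDimensional ℝ E] in
theorem contMDiffOn_chart_comp_snd (hκ : IsInteriorCoord J κ) :
    ContDiffOn ℝ ∞ (fun u => κ (φ.toFun u).2)
      (φ.source ∩ (fun u => (φ.toFun u).2) ⁻¹' κ.source) :=
  (hκ.smooth.comp ((contMDiff_snd.comp_contMDiffOn φ.contMDiffOn).mono inter_subset_left)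
    fun _ hu => hu.2).contDiffOn

omit [FiniteDimensional ℝ E] in
theorem isOpen_source_inter_chart :
    IsOpen (φ.source ∩ (fun u => (φ.toFun u).2) ⁻¹' κ.source) :=
  (continuous_snd.comp_continuousOn φ.contMDiffOn.continuousOn).isOpen_inter_preimage
    φ.isOpen_source κ.open_source

/-- The coarea inequality for a coordinate patch. -/
theorem LocalParam.exists_coarea [IsManifold I ∞ M] [IsManifold J ∞ Y]
    (gM : ContMDiffRiemannianMetric I ∞ E (fun x : M => TangentSpace I x))
    (gY : ContMDiffRiemannianMetric J ∞ (EuclideanSpace ℝ (Fin m))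
      (fun y : Y => TangentSpace J y)) (hκ : IsInteriorCoord J κ)
    {A : Set (EuclideanSpace ℝ (Fin (n + m)))} (hA : MeasurableSet A) (hA' : A ⊆ φ.source) :
    ∃ g : EuclideanSpace ℝ (Fin m) → ℝ≥0∞, Measurable g ∧
      ∫⁻ v in κ.target, areaDensity gY.inner κ.symm v * g v ≤
        ∫⁻ u in A, areaDensity (productMetric gM.inner gY.inner) φ.toFun u ∧
      ∀ v, ∃ (ι : Type) (_ : Countable ι) (ξ : ι → LocalParam I n {x | (x, κ.symm v) ∈ S})
        (D : ι → Set (EuclideanSpace ℝ (Fin n))),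
        (∀ k, MeasurableSet (D k)) ∧ (∀ k, D k ⊆ (ξ k).source) ∧
        (∀ u ∈ A, (φ.toFun u).2 ∈ κ.source → κ (φ.toFun u).2 = v →
          Function.Surjective (fderiv ℝ (fun u => κ (φ.toFun u).2) u) →
          (φ.toFun u).1 ∈ ⋃ k, (ξ k).toFun '' D k) ∧
        ∑' k, ∫⁻ w in D k, areaDensity gM.inner (ξ k).toFun w ≤ g v := by
  let O := φ.source ∩ (fun u => (φ.toFun u).2) ⁻¹' κ.source
  let f : EuclideanSpace ℝ (Fin (n + m)) → EuclideanSpace ℝ (Fin m) := fun u => κ (φ.toFun u).2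
  have hO : IsOpen O := isOpen_source_inter_chart φ
  have hf : ContDiffOn ℝ ∞ f O := contMDiffOn_chart_comp_snd φ hκ
  -- Critical points of the projection to `Y` are discarded. This only lowers the integral being
  -- bounded, and they do not occur in transverse slices.
  let Dreg : Set (EuclideanSpace ℝ (Fin (n + m))) :=
    {u | u ∈ O ∧ Function.Surjective (fderiv ℝ f u)}
  have hex : ∀ u : Dreg, ∃ e : OpenPartialHomeomorph (EuclideanSpace ℝ (Fin (n + m)))
      (EuclideanSpace ℝ (Fin m) × EuclideanSpace ℝ (Fin n)), (u : EuclideanSpace ℝ _) ∈ e.source ∧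
      e.source ⊆ O ∧ (∀ u ∈ e.source, (e u).1 = f u) ∧ ContDiffOn ℝ ∞ e e.source ∧
      ContDiffOn ℝ ∞ e.symm e.target := by
    rintro ⟨u, hu, hs⟩
    obtain ⟨P, c, hc⟩ := exists_complementary_map (K := EuclideanSpace ℝ (Fin n)) (fderiv ℝ f u) hs
      (by simp [add_comm])
    obtain ⟨e, h1, h2, h3, h4⟩ := exists_straightening hO hu hf P c hc
    refine ⟨e, h1, h2, fun u _ => congrArg Prod.fst (h3 u), ?_, h4⟩
    exact ((hf.mono h2).prodMk P.contDiff.contDiffOn).congr fun u _ => h3 u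
  choose e he1 he2 he3 he4 he5 using hex
  obtain ⟨t, htc, ht⟩ := TopologicalSpace.isOpen_iUnion_countable (fun u => (e u).source)
    (fun u => (e u).open_source)
  have : Countable t := htc.to_subtype
  obtain ⟨r, hr⟩ := exists_injective_nat t
  -- Countably many straightened domains are made disjoint by removing those of smaller rank `r`.
  let A' : t → Set (EuclideanSpace ℝ (Fin (n + m))) := fun k =>
    (A ∩ (e k).source) \ ⋃ l : t, ⋃ _ : r l < r k, (e l).source
  have hA'm : ∀ k, MeasurableSet (A' k) := fun k =>
    (hA.inter (e k).open_source.measurableSet).diff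
      (.iUnion fun l => .iUnion fun _ => (e l).open_source.measurableSet)
  have hdisj : Pairwise (Function.onFun Disjoint A') := by
    have key : ∀ k l, r k < r l → Disjoint (A' k) (A' l) := fun k l hkl =>
      Set.disjoint_left.2 fun u hu hu' => hu'.2 (mem_iUnion₂.2 ⟨k, hkl, hu.1.2⟩)
    intro k l hkl
    rcases lt_or_gt_of_ne (hr.ne hkl) with h | h
    · exact key k l h
    · exact (key l k h).symm
  let D : t → Set (EuclideanSpace ℝ (Fin m) × EuclideanSpace ℝ (Fin n)) := fun k =>
    (e k).target ∩ (e k).symm ⁻¹' A' k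
  have hDm : ∀ k, MeasurableSet (D k) := fun k => by
    have h1 : Measurable ((e k).target.domRestrict (e k).symm) :=
      (continuousOn_iff_continuous_domRestrict.1 (e k).symm.continuousOn).measurable
    have h2 := ((e k).open_target.measurableSet).subtype_image (h1 (hA'm k))
    convert h2 using 1
    ext p
    exact ⟨fun hp => ⟨⟨p, hp.1⟩, hp.2, rfl⟩, by rintro ⟨⟨q, hq⟩, hq', rfl⟩; exact ⟨hq, hq'⟩⟩
  let Φ : t → FiberedParam I J n S κ.symm := fun k =>
    φ.fibered (e k) (he4 k) (he5 k) (fun u hu => he2 k hu) (he3 k)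
  have hco := fun k => (Φ k).exists_coarea gM gY κ.open_target hκ.smooth_symm
    (fun p hp => by
      have h1 := he3 k _ ((e k).map_target hp)
      rw [(e k).right_inv hp] at h1
      rw [h1]
      exact κ.map_source (he2 k ((e k).map_target hp)).2) (hDm k) inter_subset_left
  choose g hgm hgs hgi using hco
  refine ⟨fun v => ∑' k, g k v, Measurable.tsum hgm, ?_, fun v => ⟨t, inferInstance,
    fun k => (Φ k).slice v, fun k => {w | (v, w) ∈ D k}, fun k => (hgs k v).1, fun k w hw => hw.1,
    ?_, ?_⟩⟩
  · have hη : AEMeasurable (areaDensity gY.inner κ.symm) (volume.restrict κ.target) :=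
      (continuousOn_areaDensity gY κ.open_target hκ.smooth_symm).aemeasurable
        κ.open_target.measurableSet
    calc ∫⁻ v in κ.target, areaDensity gY.inner κ.symm v * ∑' k, g k v
        = ∫⁻ v in κ.target, ∑' k, areaDensity gY.inner κ.symm v * g k v := by
          simp only [ENNReal.tsum_mul_left]
      _ = ∑' k, ∫⁻ v in κ.target, areaDensity gY.inner κ.symm v * g k v :=
          lintegral_tsum fun k => hη.mul (hgm k).aemeasurable
      _ ≤ ∑' k, ∫⁻ u in A' k, areaDensity (productMetric gM.inner gY.inner) φ.toFun u := by
          refine ENNReal.tsum_le_tsum fun k => (setLIntegral_le_lintegral _ _).trans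
            ((hgi k).trans_eq ?_)
          have hmap : ∀ u ∈ splitCoord n m ⁻¹' D k, splitCoord n m u ∈ (e k).target :=
            fun u hu => hu.1
          have hτ : (fun u => (e k).symm (splitCoord n m u)) '' (splitCoord n m ⁻¹' D k) =
              A' k := by
            ext u
            constructor
            · rintro ⟨u', hu', rfl⟩
              exact hu'.2
            · intro hu
              refine ⟨(splitCoord n m).symm (e k u), ?_, ?_⟩
              · rw [mem_preimage, ContinuousLinearEquiv.apply_symm_apply]
                refine ⟨(e k).map_source hu.1.2, ?_⟩
                rw [mem_preimage, (e k).left_inv hu.1.2]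
                exact hu
              · simp only [ContinuousLinearEquiv.apply_symm_apply]
                exact (e k).left_inv hu.1.2
          rw [← hτ, lintegral_image_areaDensity (productMetric gM.inner gY.inner)
            ((hDm k).preimage (splitCoord n m).continuous.measurable)]
          · rfl
          · exact fun u hu => φ.contMDiffOn.mdifferentiableAt_of_isOpen φ.isOpen_source
              (he2 k ((e k).map_target (hmap u hu))).1
          · intro u hu
            exact (((he5 k).contDiffAt ((e k).open_target.mem_nhds (hmap u hu))).differentiableAt
              (by simp)).comp u (splitCoord n m).differentiableAt
          · intro u hu u' hu' h
            exact (splitCoord n m).injective ((e k).symm.injOn (hmap u hu) (hmap u' hu') h)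
      _ = ∫⁻ u in ⋃ k, A' k, areaDensity (productMetric gM.inner gY.inner) φ.toFun u :=
          (lintegral_iUnion hA'm hdisj _).symm
      _ ≤ ∫⁻ u in A, areaDensity (productMetric gM.inner gY.inner) φ.toFun u :=
          lintegral_mono_set (iUnion_subset fun k => sdiff_subset.trans inter_subset_left)
  · intro u hu huκ huv hs
    have hu1 : ∃ k : t, u ∈ (e k).source := by
      have : u ∈ ⋃ i, (e i).source := mem_iUnion.2 ⟨⟨u, ⟨hA' hu, huκ⟩, hs⟩, he1 _⟩
      rw [← ht] at this
      obtain ⟨k, hk, huk⟩ := mem_iUnion₂.1 this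
      exact ⟨⟨k, hk⟩, huk⟩
    obtain ⟨k, hk⟩ := exists_minimalFor_of_wellFoundedLT (fun k : t => u ∈ (e k).source) r hu1
    have huk : u ∈ (e k).source := hk.1
    have huA : u ∈ A' k := by
      refine ⟨⟨hu, huk⟩, fun h => ?_⟩
      obtain ⟨l, hl, hul⟩ := mem_iUnion₂.1 h
      exact hl.not_ge (hk.2 hul hl.le)
    have h1 : (v, (e k u).2) = e k u := Prod.ext (huv.symm.trans (he3 k u huk).symm) rfl
    refine mem_iUnion.2 ⟨k, (e k u).2, ?_, ?_⟩
    · change (v, (e k u).2) ∈ D k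
      rw [h1]
      refine ⟨(e k).map_source huk, ?_⟩
      rw [mem_preimage, (e k).left_inv huk]
      exact huA
    · change (φ.toFun ((e k).symm (v, (e k u).2))).1 = _
      rw [h1, (e k).left_inv huk]
  · exact (tsum_congr fun k => (hgs k v).2).le

/-- By dimension count the tangent space of the patch is all of `ker df`. Transversality gives a
horizontal vector `t₀` with `df (t₀, 0) ≠ 0`, and subtracting a multiple of it moves any vertical
vector into `ker df` without changing its `Y`-component. -/
theorem surjective_fderiv_of_isTransverseAt (hE : Module.finrank ℝ E = n + 1)
    (hκ : IsInteriorCoord J κ) {X : Set (M × Y)} (hSX : S ⊆ X)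
    {u : EuclideanSpace ℝ (Fin (n + m))} (hu : u ∈ φ.source) (huκ : (φ.toFun u).2 ∈ κ.source)
    (h : IsTransverseAt I J X (φ.toFun u)) :
    Function.Surjective (fderiv ℝ (fun u => κ (φ.toFun u).2) u) := by
  obtain ⟨U, f, hU, hpU, hf, hXU, hdf⟩ := h
  have hφ := φ.contMDiffOn.mdifferentiableAt_of_isOpen φ.isOpen_source hu
  have hfd := hf.mdifferentiableAt_of_isOpen hU hpU
  let A : EuclideanSpace ℝ (Fin (n + m)) →L[ℝ] E × EuclideanSpace ℝ (Fin m) :=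
    mfderiv (𝓡 (n + m)) (I.prod J) φ.toFun u
  let ℓ : E × EuclideanSpace ℝ (Fin m) →L[ℝ] ℝ := mvfderiv (I.prod J) f (φ.toFun u)
  have hℓA : ∀ c, ℓ (A c) = 0 := by
    intro c
    have h1 := mvfderiv_comp_apply u (g := f) (f := φ.toFun) hfd hφ c
    have h2 : f ∘ φ.toFun =ᶠ[nhds u] fun _ => (0 : ℝ) := by
      have hc := (φ.contMDiffOn.continuousOn.continuousAt (φ.isOpen_source.mem_nhds hu))
      filter_upwards [φ.isOpen_source.mem_nhds hu, hc.preimage_mem_nhds (hU.mem_nhds hpU)]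
        with z hz hzU
      have : φ.toFun z ∈ X ∩ U := ⟨hSX (φ.mapsTo hz), hzU⟩
      rw [hXU] at this
      exact this.2
    have h3 : mvfderiv (𝓡 (n + m)) (f ∘ φ.toFun) u = 0 := by
      rw [mvfderiv, h2.mfderiv_eq, mfderiv_const]
      ext
      rfl
    rw [h3] at h1
    exact h1.symm
  have hAinj : Function.Injective A := φ.immersion u hu
  obtain ⟨t₀, ht₀⟩ : ∃ t₀ : E, ℓ (t₀, 0) ≠ 0 := by
    by_contra! hcon
    refine hdf (ContinuousLinearMap.ext fun t => ?_)
    exact (mvfderiv_slice (x := (φ.toFun u).1) (y := (φ.toFun u).2) hfd t).trans (hcon t)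
  have hker : LinearMap.range (A : EuclideanSpace ℝ (Fin (n + m)) →ₗ[ℝ] E × EuclideanSpace ℝ (Fin m)) =
      LinearMap.ker (ℓ : E × EuclideanSpace ℝ (Fin m) →ₗ[ℝ] ℝ) := by
    apply Submodule.eq_of_le_of_finrank_eq
    · rintro _ ⟨c, rfl⟩
      exact hℓA c
    · have h1 := LinearMap.finrank_range_of_inj (f := (A : EuclideanSpace ℝ (Fin (n + m)) →ₗ[ℝ]
        E × EuclideanSpace ℝ (Fin m))) hAinj
      have h2 := LinearMap.finrank_range_add_finrank_ker
        (ℓ : E × EuclideanSpace ℝ (Fin m) →ₗ[ℝ] ℝ)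
      have h3 : LinearMap.range (ℓ : E × EuclideanSpace ℝ (Fin m) →ₗ[ℝ] ℝ) = ⊤ :=
        LinearMap.range_eq_top.2 (LinearMap.surjective (f := (ℓ : E × EuclideanSpace ℝ (Fin m) →ₗ[ℝ] ℝ))
          (fun h0 => ht₀ (congrArg (fun T => T (t₀, 0)) h0)))
      rw [h3, finrank_top, Module.finrank_prod, hE] at h2
      simp only [Module.finrank_self, finrank_euclideanSpace, Fintype.card_fin] at h1 h2
      omega
  intro w
  let w' : EuclideanSpace ℝ (Fin m) := mfderiv 𝓘(ℝ, EuclideanSpace ℝ (Fin m)) J κ.symm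
    (κ (φ.toFun u).2) w
  have hmem : (-(ℓ (0, w') / ℓ (t₀, 0)) • t₀, w') ∈
      LinearMap.ker (ℓ : E × EuclideanSpace ℝ (Fin m) →ₗ[ℝ] ℝ) := by
    have h1 : ((-(ℓ (0, w') / ℓ (t₀, 0)) • t₀, w') : E × EuclideanSpace ℝ (Fin m)) =
        -(ℓ (0, w') / ℓ (t₀, 0)) • ((t₀, 0) : E × EuclideanSpace ℝ (Fin m)) + (0, w') :=
      Prod.ext (by simp) (by simp)
    rw [LinearMap.mem_ker, h1]
    change ℓ _ = 0
    rw [map_add, map_smul, smul_eq_mul]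
    field_simp
    ring
  rw [← hker] at hmem
  obtain ⟨c, hc⟩ := hmem
  refine ⟨c, ?_⟩
  have hκd : MDifferentiableAt J 𝓘(ℝ, EuclideanSpace ℝ (Fin m)) κ (φ.toFun u).2 :=
    hκ.smooth.mdifferentiableAt_of_isOpen κ.open_source huκ
  have h1 := mfderiv_comp_apply u hκd hφ.snd c
  rw [mfderiv_eq_fderiv] at h1
  have h2 := mfderiv_comp_apply u (mdifferentiableAt_snd (I := I) (I' := J) (x := φ.toFun u)) hφ c
  rw [mfderiv_snd] at h2
  have h3 : mfderiv (𝓡 (n + m)) J (fun u => (φ.toFun u).2) u c = w' :=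
    h2.trans (congrArg Prod.snd hc)
  exact h1.trans ((congrArg (mfderiv J 𝓘(ℝ, EuclideanSpace ℝ (Fin m)) κ (φ.toFun u).2) h3).trans
    (hκ.mfderiv_comp_mfderiv_symm huκ w))

end CoareaPatch

/-! ### The coarea inequality for whole surfaces, and its equality case. -/

section Slicing

variable {E : Type*} [NormedAddCommGroup E] [NormedSpace ℝ E] [FiniteDimensional ℝ E]
  {H : Type*} [TopologicalSpace H]
  {I : ModelWithCorners ℝ E H} {M : Type*} [TopologicalSpace M] [ChartedSpace H M]
  {n m : ℕ} {G : Type*} [TopologicalSpace G]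
  {J : ModelWithCorners ℝ (EuclideanSpace ℝ (Fin m)) G} {Y : Type*} [TopologicalSpace Y]
  [ChartedSpace G Y]

/-- A coordinate patch of a set is a coordinate patch of a larger set. -/
def LocalParam.mono {d : ℕ} {S S' : Set M} (φ : LocalParam I d S) (h : S ⊆ S') :
    LocalParam I d S' :=
  { φ with mapsTo := φ.mapsTo.mono_right h }

variable [IsManifold I ∞ M] [IsManifold J ∞ Y] [J.Boundaryless]
  (gM : ContMDiffRiemannianMetric I ∞ E (fun x : M => TangentSpace I x))
  (gY : ContMDiffRiemannianMetric J ∞ (EuclideanSpace ℝ (Fin m))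
    (fun y : Y => TangentSpace J y)) (C : ChartPartition J Y)

/-- The coarea inequality for a family of pieces of a surface. -/
theorem exists_coarea_of_family [Nonempty M] (hE : Module.finrank ℝ E = n + 1) {X : Set (M × Y)}
    (φ : ℕ → LocalParam (I.prod J) (n + m) (X \ (I.prod J).boundary (M × Y)))
    (A : ℕ → Set (EuclideanSpace ℝ (Fin (n + m)))) (hA : ∀ i, MeasurableSet (A i))
    (hA' : ∀ i, A i ⊆ (φ i).source) :
    ∃ g : Fin C.num → EuclideanSpace ℝ (Fin m) → ℝ≥0∞, (∀ j, Measurable (g j)) ∧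
      ∑ j, ∫⁻ v in C.piece j, areaDensity gY.inner (C.chart j).symm v * g j v ≤
        ∑' i, ∫⁻ u in A i, areaDensity (productMetric gM.inner gY.inner) (φ i).toFun u ∧
      ∀ j, ∀ v ∈ C.piece j, (∀ x, x ∉ I.boundary M → (x, (C.chart j).symm v) ∈ X →
        IsTransverseAt I J X (x, (C.chart j).symm v) ∧
          (x, (C.chart j).symm v) ∈ ⋃ i, (φ i).toFun '' A i) →
        area I gM.inner n {x | (x, (C.chart j).symm v) ∈ X} ≤ g j v := by
  let f : ℕ → Fin C.num → EuclideanSpace ℝ (Fin (n + m)) → EuclideanSpace ℝ (Fin m) :=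
    fun i j u => C.chart j ((φ i).toFun u).2
  let O : ℕ → Fin C.num → Set (EuclideanSpace ℝ (Fin (n + m))) := fun i j =>
    (φ i).source ∩ (fun u => ((φ i).toFun u).2) ⁻¹' (C.chart j).source
  -- `B i j` is the part of the `i`-th piece lying over the `j`-th piece of `Y`; for fixed `i` these
  -- are disjoint.
  let B : ℕ → Fin C.num → Set (EuclideanSpace ℝ (Fin (n + m))) := fun i j =>
    A i ∩ (O i j ∩ f i j ⁻¹' C.piece j)
  have hB : ∀ i j, MeasurableSet (B i j) := fun i j => by
    refine (hA i).inter ?_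
    have hO : IsOpen (O i j) := isOpen_source_inter_chart (φ i)
    have h1 : Measurable ((O i j).domRestrict (f i j)) := (continuousOn_iff_continuous_domRestrict.1
      (contMDiffOn_chart_comp_snd (φ i) (C.isInteriorCoord j)).continuousOn).measurable
    have h2 := hO.measurableSet.subtype_image (h1 (C.measurableSet_piece j))
    convert h2 using 1
    ext p
    exact ⟨fun hp => ⟨⟨p, hp.1⟩, hp.2, rfl⟩, by rintro ⟨⟨q, hq⟩, hq', rfl⟩; exact ⟨hq, hq'⟩⟩
  have hBd : ∀ i, Pairwise (Function.onFun Disjoint (B i)) := by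
    intro i j k hjk
    rw [Function.onFun, Set.disjoint_left]
    intro u hu hu'
    have hd := Set.disjoint_left.1 (C.disjoint j k hjk)
    exact @hd ((φ i).toFun u).2 ⟨_, hu.2.2, (C.chart j).left_inv hu.2.1.2⟩ ⟨_, hu'.2.2, (C.chart k).left_inv hu'.2.1.2⟩
  have hco := fun i j => (φ i).exists_coarea gM gY (C.isInteriorCoord j) (hB i j)
    (inter_subset_left.trans (hA' i))
  choose g hgm hgi hgs using hco
  refine ⟨fun j v => ∑' i, g i j v, fun j => Measurable.tsum fun i => hgm i j, ?_, ?_⟩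
  · calc ∑ j, ∫⁻ v in C.piece j, areaDensity gY.inner (C.chart j).symm v * ∑' i, g i j v
        = ∑ j, ∑' i, ∫⁻ v in C.piece j, areaDensity gY.inner (C.chart j).symm v * g i j v := by
          refine Finset.sum_congr rfl fun j _ => ?_
          simp only [← ENNReal.tsum_mul_left]
          exact lintegral_tsum fun i => (C.aemeasurable_density gY j).mul (hgm i j).aemeasurable
      _ ≤ ∑ j, ∑' i, ∫⁻ u in B i j,
            areaDensity (productMetric gM.inner gY.inner) (φ i).toFun u :=
          Finset.sum_le_sum fun j _ => ENNReal.tsum_le_tsum fun i =>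
            (lintegral_mono_set (C.piece_subset j)).trans (hgi i j)
      _ = ∑' i, ∑ j, ∫⁻ u in B i j,
            areaDensity (productMetric gM.inner gY.inner) (φ i).toFun u :=
          (Summable.tsum_finsetSum fun _ _ => ENNReal.summable).symm
      _ ≤ _ := by
          refine ENNReal.tsum_le_tsum fun i => ?_
          rw [← tsum_fintype (L := SummationFilter.unconditional _), ← lintegral_iUnion (hB i) (hBd i)]
          exact lintegral_mono_set (iUnion_subset fun j => inter_subset_left)
  -- Only the slice over `v` has to be covered, not all of `X`. This allows part of the surface to
  -- be removed beforehand, as in the uniqueness argument.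
  · intro j v hv hcov
    have hvt := C.piece_subset j hv
    have hgs' := fun i => hgs i j v
    choose ι hι ξ D hD hD' hcover hsum using hgs'
    have hslice : {x | (x, (C.chart j).symm v) ∈ X \ (I.prod J).boundary (M × Y)} ⊆
        {x | (x, (C.chart j).symm v) ∈ X} \ I.boundary M :=
      fun x hx => ⟨hx.1, fun hb => hx.2 (mem_boundary_prod.2 hb)⟩
    refine (area_le_tsum (ι := Σ i, ι i) gM.inner (fun k => (ξ k.1 k.2).mono hslice)
      (fun k => D k.1 k.2) (fun k => hD k.1 k.2) (fun k => hD' k.1 k.2) ?_).trans ?_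
    · rintro x ⟨hxX, hxb⟩
      obtain ⟨htr, hx⟩ := hcov x hxb hxX
      obtain ⟨i, u, hu, hux⟩ := mem_iUnion.1 hx
      have hu2 : ((φ i).toFun u).2 = (C.chart j).symm v := congrArg Prod.snd hux
      have h1 : ((φ i).toFun u).2 ∈ (C.chart j).source := hu2 ▸ (C.chart j).map_target hvt
      have h2 : C.chart j ((φ i).toFun u).2 = v := by rw [hu2, (C.chart j).right_inv hvt]
      have h3 := hcover i u ⟨hu, ⟨hA' i hu, h1⟩, (h2.symm ▸ hv : C.chart j ((φ i).toFun u).2 ∈ C.piece j)⟩ h1 h2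
        (surjective_fderiv_of_isTransverseAt (φ i) hE (C.isInteriorCoord j) sdiff_subset (hA' i hu)
          h1 (hux ▸ htr))
      rw [hux] at h3
      obtain ⟨k, hk⟩ := mem_iUnion.1 h3
      exact mem_iUnion.2 ⟨⟨i, k⟩, hk⟩
    · rw [ENNReal.tsum_sigma (f := fun i k => ∫⁻ u in D i k, areaDensity gM.inner
        ((ξ i k).mono hslice).toFun u)]
      exact ENNReal.tsum_le_tsum hsum

/-- The coarea inequality for a surface almost all of whose slices are transverse. -/
theorem exists_coarea_of_ae_isTransverseAt [Nonempty M] (hE : Module.finrank ℝ E = n + 1)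
    {X : Set (M × Y)} (htr : ∀ j, ∀ᵐ v, v ∈ (C.chart j).target → ∀ x, x ∉ I.boundary M →
      (x, (C.chart j).symm v) ∈ X → IsTransverseAt I J X (x, (C.chart j).symm v)) :
    ∃ g : Fin C.num → EuclideanSpace ℝ (Fin m) → ℝ≥0∞, (∀ j, Measurable (g j)) ∧
      ∑ j, ∫⁻ v in C.piece j, areaDensity gY.inner (C.chart j).symm v * g j v ≤
        area (I.prod J) (productMetric gM.inner gY.inner) (n + m) X ∧
      ∀ j, ∀ᵐ v, v ∈ C.piece j →
        area I gM.inner n {x | (x, (C.chart j).symm v) ∈ X} ≤ g j v := by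
  set a := area (I.prod J) (productMetric gM.inner gY.inner) (n + m) X with ha
  by_cases htop : a = ⊤
  · exact ⟨fun _ _ => ⊤, fun _ => measurable_const, le_top.trans_eq htop.symm,
      fun j => Filter.Eventually.of_forall fun v _ => le_top⟩
  -- Coverings whose total is within `1 / (l + 1)` of the area give measurable majorants of the
  -- slice areas, and their infimum over `l` is the required `g`. The slice area itself is never
  -- shown to be measurable.
  have hex : ∀ l : ℕ, ∃ g : Fin C.num → EuclideanSpace ℝ (Fin m) → ℝ≥0∞, (∀ j, Measurable (g j)) ∧
      ∑ j, ∫⁻ v in C.piece j, areaDensity gY.inner (C.chart j).symm v * g j v ≤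
        a + (l + 1 : ℝ≥0∞)⁻¹ ∧ ∀ j, ∀ᵐ v, v ∈ C.piece j →
        area I gM.inner n {x | (x, (C.chart j).symm v) ∈ X} ≤ g j v := by
    intro l
    have hlt : area (I.prod J) (productMetric gM.inner gY.inner) (n + m) X <
        a + (l + 1 : ℝ≥0∞)⁻¹ := by
      rw [← ha]
      exact ENNReal.lt_add_right htop (by simp [ENNReal.inv_eq_zero])
    simp only [area, iInf_lt_iff] at hlt
    obtain ⟨φ, A, hA, hX, hlt⟩ := hlt
    obtain ⟨g, hg1, hg2, hg3⟩ := exists_coarea_of_family gM gY C hE φ A (fun i => (hA i).1)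
      (fun i => (hA i).2)
    refine ⟨g, hg1, hg2.trans hlt.le, fun j => ?_⟩
    filter_upwards [htr j] with v hv hvp
    refine hg3 j v hvp fun x hx hxX => ⟨hv (C.piece_subset j hvp) x hx hxX, hX ⟨hxX, fun hb => ?_⟩⟩
    exact hx (mem_boundary_prod.1 hb)
  choose g hg1 hg2 hg3 using hex
  refine ⟨fun j v => ⨅ l, g l j v, fun j => Measurable.iInf fun l => hg1 l j, ?_, fun j => ?_⟩
  · have h1 : ∀ l : ℕ, ∑ j, ∫⁻ v in C.piece j, areaDensity gY.inner (C.chart j).symm v *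
        ⨅ l, g l j v ≤ a + (l + 1 : ℝ≥0∞)⁻¹ := fun l =>
      (Finset.sum_le_sum fun j _ => lintegral_mono fun v => by gcongr; exact iInf_le _ l).trans
        (hg2 l)
    have h2 : Filter.Tendsto (fun l : ℕ => a + (l + 1 : ℝ≥0∞)⁻¹) Filter.atTop (nhds (a + 0)) := by
      refine Filter.Tendsto.const_add _ ?_
      have := (Filter.tendsto_add_atTop_iff_nat 1).2 ENNReal.tendsto_inv_nat_nhds_zero
      simpa using this
    rw [add_zero] at h2
    exact ge_of_tendsto' h2 h1
  · filter_upwards [ae_all_iff.2 fun l => hg3 l j] with v hv hvp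
    exact le_iInf fun l => hv l hvp

omit [J.Boundaryless] in
/-- The area times the volume of `Y`, as a sum over the pieces of `Y`. -/
theorem ChartPartition.sum_lintegral_const (a : ℝ≥0∞) :
    ∑ j, ∫⁻ v in C.piece j, areaDensity gY.inner (C.chart j).symm v * a = a * C.totalVolume gY := by
  rw [ChartPartition.totalVolume, Finset.mul_sum]
  refine Finset.sum_congr rfl fun j _ => ?_
  rw [lintegral_mul_const'' _ (C.aemeasurable_density gY j), mul_comm]
  rfl

omit [J.Boundaryless] in
theorem ChartPartition.mul_totalVolume_le {a : ℝ≥0∞}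
    {g : Fin C.num → EuclideanSpace ℝ (Fin m) → ℝ≥0∞}
    (h : ∀ j, ∀ᵐ v, v ∈ C.piece j → a ≤ g j v) :
    a * C.totalVolume gY ≤
      ∑ j, ∫⁻ v in C.piece j, areaDensity gY.inner (C.chart j).symm v * g j v := by
  rw [← C.sum_lintegral_const gY]
  refine Finset.sum_le_sum fun j _ => ?_
  refine lintegral_mono_ae ((ae_restrict_iff' (C.measurableSet_piece j)).2 ?_)
  filter_upwards [h j] with v hv hvp
  gcongr
  exact hv hvp

omit [J.Boundaryless] in
/-- Equality in the previous estimate. -/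
theorem ChartPartition.ae_eq_of_le_mul_totalVolume {a : ℝ≥0∞} (ha : a ≠ ⊤)
    {g : Fin C.num → EuclideanSpace ℝ (Fin m) → ℝ≥0∞} (hg : ∀ j, Measurable (g j))
    (h : ∀ j, ∀ᵐ v, v ∈ C.piece j → a ≤ g j v)
    (hle : ∑ j, ∫⁻ v in C.piece j, areaDensity gY.inner (C.chart j).symm v * g j v ≤
      a * C.totalVolume gY) :
    ∀ j, ∀ᵐ v, v ∈ C.piece j → g j v = a := by
  intro j
  let η := areaDensity gY.inner (C.chart j).symm
  have hmono : ∀ i, ∫⁻ v in C.piece i, areaDensity gY.inner (C.chart i).symm v * a ≤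
      ∫⁻ v in C.piece i, areaDensity gY.inner (C.chart i).symm v * g i v := fun i => by
    refine lintegral_mono_ae ((ae_restrict_iff' (C.measurableSet_piece i)).2 ?_)
    filter_upwards [h i] with v hv hvp
    gcongr
    exact hv hvp
  have hfin : ∀ i, ∫⁻ v in C.piece i, areaDensity gY.inner (C.chart i).symm v * a ≠ ⊤ := fun i => by
    rw [lintegral_mul_const'' _ (C.aemeasurable_density gY i)]
    exact ENNReal.mul_ne_top (C.pieceVolume_ne_top gY i) ha
  -- The terms with `i ≠ j` only grow when `a` is replaced by `g i`, and with `a` they are finite,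
  -- so they can be cancelled from the inequality of sums.
  have hlej : ∫⁻ v in C.piece j, areaDensity gY.inner (C.chart j).symm v * g j v ≤
      ∫⁻ v in C.piece j, areaDensity gY.inner (C.chart j).symm v * a := by
    rw [← C.sum_lintegral_const gY, ← Finset.add_sum_erase _ _ (Finset.mem_univ j),
      ← Finset.add_sum_erase _ _ (Finset.mem_univ j)] at hle
    have h2 := (add_le_add_right (Finset.sum_le_sum
      (fun i (_ : i ∈ Finset.univ.erase j) => hmono i))
      (∫⁻ v in C.piece j, areaDensity gY.inner (C.chart j).symm v * g j v)).trans hle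
    exact (ENNReal.add_le_add_iff_right (ENNReal.sum_ne_top.2 fun i _ => hfin i)).1 h2
  have h3 := ae_eq_of_ae_le_of_lintegral_le (μ := volume.restrict (C.piece j))
    (f := fun v => η v * a) (g := fun v => η v * g j v) ?_ (hfin j)
    ((C.aemeasurable_density gY j).mul (hg j).aemeasurable) hlej
  · have h4 := (ae_restrict_iff' (C.measurableSet_piece j)).1 h3
    filter_upwards [h4] with v hv hvp
    exact ((ENNReal.mul_right_inj (C.density_pos gY j (C.piece_subset j hvp)).ne'
      (C.density_ne_top gY j v)).1 (hv hvp)).symm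
  · refine (ae_restrict_iff' (C.measurableSet_piece j)).2 ?_
    filter_upwards [h j] with v hv hvp
    gcongr
    exact hv hvp

end Slicing

/-! ### Local comparison of a metric with the coordinate norm. -/

section MetricBound

variable {E : Type*} [NormedAddCommGroup E] [NormedSpace ℝ E] [FiniteDimensional ℝ E]
  {H : Type*} [TopologicalSpace H]
  {I : ModelWithCorners ℝ E H} {M : Type*} [TopologicalSpace M] [ChartedSpace H M]
  [IsManifold I ∞ M]

/-- A positive continuous function on the compact product of a closed ball and the unit sphere
attains a positive minimum `c`; homogeneity gives all vectors. -/
theorem exists_mul_norm_sq_le_pullbackForm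
    (g : ContMDiffRiemannianMetric I ∞ E (fun x : M => TangentSpace I x))
    {κ : OpenPartialHomeomorph M E} (hκ : IsInteriorCoord I κ) {z₀ : E} (hz₀ : z₀ ∈ κ.target) :
    ∃ c > 0, ∃ r > 0, Metric.ball z₀ r ⊆ κ.target ∧ ∀ z ∈ Metric.ball z₀ r, ∀ a : E,
      c * ‖a‖ ^ 2 ≤ pullbackForm g.inner κ.symm z a a := by
  obtain ⟨r, hr, hrt⟩ := Metric.nhds_basis_closedBall.mem_iff.1 (κ.open_target.mem_nhds hz₀)
  let b := Module.finBasis ℝ E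
  have hF : ∀ z a, pullbackForm g.inner κ.symm z a a =
      ∑ i, ∑ j, b.repr a i * (b.repr a j * pullbackForm g.inner κ.symm z (b i) (b j)) := by
    intro z a
    conv_lhs => rw [← b.sum_repr a]
    simp only [map_sum, map_smul, LinearMap.sum_apply, LinearMap.smul_apply, smul_eq_mul,
      Finset.mul_sum]
    rw [Finset.sum_comm]
    exact Finset.sum_congr rfl fun i _ => Finset.sum_congr rfl fun j _ => mul_left_comm _ _ _
  have hrepr : ∀ i, Continuous fun a : E => b.repr a i := fun i =>
    (LinearMap.continuous_of_finiteDimensional (b.coord i))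
  have hcont : ContinuousOn (fun p : E × E => pullbackForm g.inner κ.symm p.1 p.2 p.2)
      (Metric.closedBall z₀ r ×ˢ Metric.sphere 0 1) := by
    simp only [hF]
    refine continuousOn_finsetSum _ fun i _ => continuousOn_finsetSum _ fun j _ => ?_
    refine ((hrepr i).comp continuous_snd).continuousOn.mul
      (((hrepr j).comp continuous_snd).continuousOn.mul ?_)
    exact (continuousOn_pullbackForm g κ.open_target hκ.smooth_symm _ _).comp continuousOn_fst
      fun p hp => hrt hp.1
  obtain ⟨c, hc, hcb⟩ : ∃ c > 0, ∀ z ∈ Metric.closedBall z₀ r, ∀ a ∈ Metric.sphere (0 : E) 1,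
      c ≤ pullbackForm g.inner κ.symm z a a := by
    rcases (Metric.closedBall z₀ r ×ˢ Metric.sphere (0 : E) 1).eq_empty_or_nonempty with he | hne
    · exact ⟨1, one_pos, fun z hz a ha => ((he ▸ (⟨hz, ha⟩ : (z, a) ∈ Metric.closedBall z₀ r ×ˢ
        Metric.sphere (0 : E) 1) : (z, a) ∈ (∅ : Set (E × E)))).elim⟩
    · obtain ⟨p, hp, hmin⟩ := ((isCompact_closedBall z₀ r).prod
        (isCompact_sphere (0 : E) 1)).exists_isMinOn hne hcont
      refine ⟨_, pullbackForm_pos g (hκ.injective_mfderiv_symm (hrt hp.1)) ?_,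
        fun z hz a ha => hmin (show (z, a) ∈ _ from ⟨hz, ha⟩)⟩
      exact ne_zero_of_mem_unit_sphere (⟨p.2, hp.2⟩ : Metric.sphere (0 : E) 1)
  refine ⟨c, hc, r, hr, Metric.ball_subset_closedBall.trans hrt, fun z hz a => ?_⟩
  by_cases ha : a = 0
  · simp [ha]
  · have h1 := hcb z (Metric.ball_subset_closedBall hz) (‖a‖⁻¹ • a) (by simp [norm_smul, ha])
    simp only [map_smul, LinearMap.smul_apply, smul_eq_mul] at h1
    have h2 : 0 < ‖a‖ := norm_pos_iff.2 ha
    have h3 := mul_le_mul_of_nonneg_right h1 (sq_nonneg ‖a‖)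
    refine h3.trans_eq ?_
    field_simp

variable {W : Type*} [NormedAddCommGroup W] [NormedSpace ℝ W]

omit [FiniteDimensional ℝ E] in
theorem pullbackForm_chart (g : ContMDiffRiemannianMetric I ∞ E (fun x : M => TangentSpace I x))
    {κ : OpenPartialHomeomorph M E} (hκ : IsInteriorCoord I κ) {Φ : W → M} {p : W}
    (hΦ : MDifferentiableAt 𝓘(ℝ, W) I Φ p) (hp : Φ p ∈ κ.source) (a b : W) :
    pullbackForm g.inner Φ p a b = pullbackForm g.inner κ.symm (κ (Φ p))
      (fderiv ℝ (fun q => κ (Φ q)) p a) (fderiv ℝ (fun q => κ (Φ q)) p b) := by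
  have h1 : Φ =ᶠ[nhds p] κ.symm ∘ fun q => κ (Φ q) := by
    filter_upwards [hΦ.continuousAt.preimage_mem_nhds (κ.open_source.mem_nhds hp)] with q hq
    exact (κ.left_inv hq).symm
  have h2 : MDifferentiableAt 𝓘(ℝ, W) 𝓘(ℝ, E) (fun q => κ (Φ q)) p :=
    (hκ.smooth.mdifferentiableAt_of_isOpen κ.open_source hp).comp p hΦ
  rw [pullbackForm_congr g.inner h1]
  exact pullbackForm_comp g.inner (τ := fun q => κ (Φ q))
    (hκ.smooth_symm.mdifferentiableAt_of_isOpen κ.open_target (κ.map_source hp))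
    (mdifferentiableAt_iff_differentiableAt.1 h2) a b

end MetricBound

/-! ### Jacobian bounded by area density. -/

section DetBound

/-- The hypothesis says that `Tᵀ T ≤ c B` as forms. Determinants are monotone by `det_le_det_add`,
the left one is `T.det ^ 2`, and scaling by `c` in dimension `d` gives `c ^ d`. -/
theorem abs_det_le_sqrt_det_gramMatrix {d : ℕ}
    {B : LinearMap.BilinForm ℝ (EuclideanSpace ℝ (Fin d))} (hs : ∀ x y, B x y = B y x)
    (T : EuclideanSpace ℝ (Fin d) →L[ℝ] EuclideanSpace ℝ (Fin d)) {c : ℝ} (hc : 0 ≤ c)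
    (hT : ∀ x, ‖T x‖ ^ 2 ≤ c * B x x) :
    |T.det| ≤ Real.sqrt (c ^ d) * Real.sqrt (gramMatrix B stdVec).det := by
  let A : LinearMap.BilinForm ℝ (EuclideanSpace ℝ (Fin d)) := innerₗ _
  have h1 : (gramMatrix A stdVec).det = 1 := by
    have : gramMatrix A (stdVec (d := d)) = 1 := by
      ext i j
      simp [gramMatrix, A, stdVec, Matrix.one_apply, EuclideanSpace.inner_single_left]
    rw [this, Matrix.det_one]
  let A' := A.comp (T : EuclideanSpace ℝ (Fin d) →ₗ[ℝ] EuclideanSpace ℝ (Fin d))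
    (T : EuclideanSpace ℝ (Fin d) →ₗ[ℝ] EuclideanSpace ℝ (Fin d))
  have hA' : ∀ x y, A' x y = inner ℝ (T x) (T y) := fun x y => rfl
  have h2 : (gramMatrix A' stdVec).det = T.det ^ 2 := by
    rw [det_gramMatrix_comp, h1, mul_one]
  have h3 : (gramMatrix A' (stdVec (d := d))).PosSemidef := posSemidef_gramMatrix
    (fun x y => real_inner_comm (T y) (T x)) (fun x => (real_inner_self_nonneg (x := T x))) _
  have h4 : (gramMatrix (c • B - A') (stdVec (d := d))).PosSemidef := by
    refine posSemidef_gramMatrix (fun x y => ?_) (fun x => ?_) _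
    · simp only [LinearMap.sub_apply, LinearMap.smul_apply, hA', hs x y, real_inner_comm]
    · simp only [LinearMap.sub_apply, LinearMap.smul_apply, hA', real_inner_self_eq_norm_sq,
        smul_eq_mul]
      linarith [hT x]
  have h5 := det_le_det_add h3 h4
  have h6 : gramMatrix A' stdVec + gramMatrix (c • B - A') stdVec =
      c • gramMatrix B (stdVec (d := d)) := by
    ext i j
    simp [gramMatrix]
  rw [h6, h2, Matrix.det_smul, Fintype.card_fin] at h5
  rw [← Real.sqrt_mul (pow_nonneg hc _), ← Real.sqrt_sq_eq_abs]
  exact Real.sqrt_le_sqrt h5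

end DetBound

/-! ### A surface has a definite amount of area near an interior point. -/

section LowerBound

variable {E : Type*} [NormedAddCommGroup E] [NormedSpace ℝ E] [FiniteDimensional ℝ E]
  {H : Type*} [TopologicalSpace H]
  {I : ModelWithCorners ℝ E H} {N : Type*} [TopologicalSpace N] [ChartedSpace H N] {d : ℕ}

/-- Near an interior point, the area of a surface is bounded below. -/
theorem exists_area_lower_bound (hE : Module.finrank ℝ E = d + 1)
    (g : ∀ p : N, TangentSpace I p →L[ℝ] TangentSpace I p →L[ℝ] ℝ)
    (hs : ∀ p v w, g p v w = g p w v) {χ : OpenPartialHomeomorph N E} (hχ : IsInteriorCoord I χ)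
    {V : Set N} (hV : IsOpen V) {c : ℝ} (hc : 0 < c)
    (hbound : ∀ (φ : EuclideanSpace ℝ (Fin d) → N) (u : EuclideanSpace ℝ (Fin d)),
      MDifferentiableAt (𝓡 d) I φ u → φ u ∈ V → ∀ a,
      ‖fderiv ℝ (fun u => χ (φ u)) u a‖ ^ 2 ≤ c * pullbackForm g φ u a a)
    {S : Set N} {f : N → ℝ} (hVχ : V ⊆ χ.source) (hf : ContMDiffOn I 𝓘(ℝ, ℝ) ∞ f V)
    (hX : ∀ q ∈ V, f q = 0 → q ∈ S) {p : N} (hp : p ∈ V) (hfp : f p = 0)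
    (hdf : mvfderiv I f p ≠ 0) :
    ∃ W : Set N, IsOpen W ∧ p ∈ W ∧ W ⊆ V ∧ ∃ δ : ℝ≥0∞, δ ≠ 0 ∧
      ∀ (φ : ℕ → LocalParam I d S) (A : ℕ → Set (EuclideanSpace ℝ (Fin d))),
        (∀ i, MeasurableSet (A i)) → (∀ i, A i ⊆ (φ i).source) → S ⊆ ⋃ i, (φ i).toFun '' A i →
        δ ≤ ∑' i, ∫⁻ u in A i ∩ (φ i).toFun ⁻¹' W, areaDensity g (φ i).toFun u := by
  let O : Set E := χ.target ∩ χ.symm ⁻¹' V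
  have hO : IsOpen O := χ.isOpen_inter_preimage_symm hV
  have hpO : χ p ∈ O := ⟨χ.map_source (hVχ hp), by rw [mem_preimage, χ.left_inv (hVχ hp)]; exact hp⟩
  have hfO : ContDiffOn ℝ ∞ (f ∘ χ.symm) O :=
    (hf.comp (hχ.smooth_symm.mono inter_subset_left) fun z hz => hz.2).contDiffOn
  have hne : fderiv ℝ (f ∘ χ.symm) (χ p) ≠ 0 := fun h0 => hdf
    ((hχ.fderiv_comp_symm_eq_zero_iff (hVχ hp) (hf.mdifferentiableAt_of_isOpen hV hp)).1 h0)
  have hsurj : Function.Surjective (fderiv ℝ (f ∘ χ.symm) (χ p)) :=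
    LinearMap.surjective (f := (fderiv ℝ (f ∘ χ.symm) (χ p) : E →ₗ[ℝ] ℝ))
      fun h0 => hne (ContinuousLinearMap.coe_injective h0)
  obtain ⟨P, e, he⟩ := exists_complementary_map (K := EuclideanSpace ℝ (Fin d)) _ hsurj
    (by simp [hE, add_comm])
  obtain ⟨Θ, h1, h2, h3, h4⟩ := exists_straightening hO hpO hfO P e he
  let W : Set N := χ.source ∩ χ ⁻¹' Θ.source
  have hW : IsOpen W := χ.isOpen_inter_preimage Θ.open_source
  have hWV : W ⊆ V := fun q hq => by
    have := (h2 hq.2).2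
    rwa [mem_preimage, χ.left_inv hq.1] at this
  -- In the coordinates `Θ = (f, P)` the zero set of `f` is a copy of `Q`, so any family covering
  -- `S` must project under `P ∘ χ` onto all of this nonempty open set.
  let Q : Set (EuclideanSpace ℝ (Fin d)) := {w | ((0 : ℝ), w) ∈ Θ.target}
  have hQ : IsOpen Q := Θ.open_target.preimage (by fun_prop)
  have hQne : Q.Nonempty := by
    refine ⟨P (χ p), ?_⟩
    have := Θ.map_source h1
    rw [h3, Function.comp_apply, χ.left_inv (hVχ hp), hfp] at this
    exact this
  -- By `hbound`, the derivative of `P ∘ χ ∘ φ` has square norm at most `K` times the pulled back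
  -- metric; its Jacobian is then at most `√(K ^ d)` times the area density. This yields `δ = volume
  -- Q / k`.
  let K : ℝ := ‖P‖ ^ 2 * c
  have hK : 0 ≤ K := by positivity
  let k : ℝ≥0∞ := ENNReal.ofReal (Real.sqrt (K ^ d))
  refine ⟨W, hW, ⟨hVχ hp, h1⟩, hWV, volume Q / k, ?_, fun φ A hA hA' hS => ?_⟩
  · exact ENNReal.div_ne_zero.2 ⟨(hQ.measure_pos volume hQne).ne', ENNReal.ofReal_ne_top⟩
  have hmeas : ∀ i, MeasurableSet (A i ∩ (φ i).toFun ⁻¹' W) := fun i => by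
    have := ((φ i).contMDiffOn.continuousOn.isOpen_inter_preimage (φ i).isOpen_source
      hW).measurableSet
    convert (hA i).inter this using 1
    ext u
    exact ⟨fun h => ⟨h.1, hA' i h.1, h.2⟩, fun h => ⟨h.1, h.2.2⟩⟩
  have hφd : ∀ i, ∀ u ∈ A i ∩ (φ i).toFun ⁻¹' W,
      MDifferentiableAt (𝓡 d) I (φ i).toFun u := fun i u hu =>
    (φ i).contMDiffOn.mdifferentiableAt_of_isOpen (φ i).isOpen_source (hA' i hu.1)
  have hχd : ∀ i, ∀ u ∈ A i ∩ (φ i).toFun ⁻¹' W,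
      DifferentiableAt ℝ (fun u => χ ((φ i).toFun u)) u := fun i u hu =>
    mdifferentiableAt_iff_differentiableAt.1
      ((hχ.smooth.mdifferentiableAt_of_isOpen χ.open_source hu.2.1).comp u (hφd i u hu))
  have hcov : Q ⊆ ⋃ i, (fun u => P (χ ((φ i).toFun u))) '' (A i ∩ (φ i).toFun ⁻¹' W) := by
    intro w hw
    have hz := Θ.map_target hw
    have hzr := Θ.right_inv hw
    rw [h3] at hzr
    have hzO := h2 hz
    have hqW : χ.symm (Θ.symm (0, w)) ∈ W := by
      refine ⟨χ.map_target hzO.1, ?_⟩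
      rw [mem_preimage, χ.right_inv hzO.1]
      exact hz
    obtain ⟨i, u, hu, hux⟩ := mem_iUnion.1 (hS (hX _ hzO.2 (congrArg Prod.fst hzr)))
    refine mem_iUnion.2 ⟨i, u, ⟨hu, ?_⟩, ?_⟩
    · rw [mem_preimage, hux]; exact hqW
    · change P (χ ((φ i).toFun u)) = w
      rw [hux, χ.right_inv hzO.1]
      exact congrArg Prod.snd hzr
  refine ENNReal.div_le_of_le_mul ?_
  calc volume Q ≤ ∑' i, volume ((fun u => P (χ ((φ i).toFun u))) ''
          (A i ∩ (φ i).toFun ⁻¹' W)) := (measure_mono hcov).trans (measure_iUnion_le _)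
    _ ≤ ∑' i, (∫⁻ u in A i ∩ (φ i).toFun ⁻¹' W, areaDensity g (φ i).toFun u) * k := by
        refine ENNReal.tsum_le_tsum fun i => ?_
        refine (addHaar_image_le_lintegral_abs_det_fderiv volume (hmeas i) (fun u hu =>
          (P.hasFDerivAt.comp u (hχd i u hu).hasFDerivAt).hasFDerivWithinAt)).trans ?_
        rw [← lintegral_mul_const' _ _ ENNReal.ofReal_ne_top]
        refine setLIntegral_mono' (hmeas i) fun u hu => ?_
        rw [areaDensity_eq, ← ENNReal.ofReal_mul (Real.sqrt_nonneg _), mul_comm (Real.sqrt _)]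
        refine ENNReal.ofReal_le_ofReal (abs_det_le_sqrt_det_gramMatrix (fun x y => hs _ _ _) _ hK
          fun x => ?_)
        have hb := hbound (φ i).toFun u (hφd i u hu) (hWV hu.2) x
        calc ‖P (fderiv ℝ (fun u => χ ((φ i).toFun u)) u x)‖ ^ 2
            ≤ (‖P‖ * ‖fderiv ℝ (fun u => χ ((φ i).toFun u)) u x‖) ^ 2 := by
              gcongr; exact P.le_opNorm _
          _ = ‖P‖ ^ 2 * ‖fderiv ℝ (fun u => χ ((φ i).toFun u)) u x‖ ^ 2 := mul_pow _ _ _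
          _ ≤ ‖P‖ ^ 2 * (c * pullbackForm g (φ i).toFun u x x) := by gcongr
          _ = K * pullbackForm g (φ i).toFun u x x := (mul_assoc _ _ _).symm
    _ = _ := ENNReal.tsum_mul_right

end LowerBound

/-! ### Adding a small sphere to a surface. -/

section AddSphere

variable {T : Type*} [TopologicalSpace T]

theorem interior_union_of_disjoint {r B : Set T} (hr : IsClosed r) (hB : IsClosed B)
    (h : Disjoint r B) : interior (r ∪ B) = interior r ∪ interior B := by
  apply Subset.antisymm
  · intro x hx
    rcases interior_subset hx with hxr | hxB
    · left
      refine interior_maximal (fun z hz => ?_) (isOpen_interior.sdiff hB)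
        ⟨hx, Set.disjoint_left.1 h hxr⟩
      exact (interior_subset hz.1).resolve_right hz.2
    · right
      refine interior_maximal (fun z hz => ?_) (isOpen_interior.sdiff hr)
        ⟨hx, Set.disjoint_right.1 h hxB⟩
      exact (interior_subset hz.1).resolve_left hz.2
  · exact union_subset (interior_mono subset_union_left) (interior_mono subset_union_right)

theorem frontier_union_of_disjoint {r B : Set T} (hr : IsClosed r) (hB : IsClosed B)
    (h : Disjoint r B) : frontier (r ∪ B) = frontier r ∪ frontier B := by
  rw [(hr.union hB).frontier_eq, hr.frontier_eq, hB.frontier_eq,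
    interior_union_of_disjoint hr hB h]
  ext x
  have h1 : x ∈ r → x ∉ B := fun hx => Set.disjoint_left.1 h hx
  have h2 := interior_subset (s := r) (a := x)
  have h3 := interior_subset (s := B) (a := x)
  simp only [Set.mem_sdiff, mem_union]
  tauto

variable {E : Type*} [NormedAddCommGroup E] [InnerProductSpace ℝ E] [FiniteDimensional ℝ E]
  {H : Type*} [TopologicalSpace H]
  {I : ModelWithCorners ℝ E H} {M : Type*} [TopologicalSpace M] [ChartedSpace H M]
  {κ : OpenPartialHomeomorph M E} {c : E} {ρ : ℝ}

theorem isCompact_symm_image_closedBall (hρt : Metric.closedBall c ρ ⊆ κ.target) :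
    IsCompact (κ.symm '' Metric.closedBall c ρ) :=
  (isCompact_closedBall c ρ).image_of_continuousOn (κ.symm.continuousOn.mono hρt)

omit [FiniteDimensional ℝ E] [InnerProductSpace ℝ E] in
theorem isImage_closedBall (hρt : Metric.closedBall c ρ ⊆ κ.target) :
    κ.IsImage (κ.symm '' Metric.closedBall c ρ) (Metric.closedBall c ρ) := by
  intro x hx
  constructor
  · intro h
    exact ⟨κ x, h, κ.left_inv hx⟩
  · rintro ⟨w, hw, rfl⟩
    rwa [κ.right_inv (hρt hw)]

omit [FiniteDimensional ℝ E] [InnerProductSpace ℝ E] in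
theorem symm_image_closedBall_subset (hρt : Metric.closedBall c ρ ⊆ κ.target) :
    κ.symm '' Metric.closedBall c ρ ⊆ κ.source := by
  rintro _ ⟨w, hw, rfl⟩
  exact κ.map_target (hρt hw)

theorem frontier_symm_image_closedBall [T2Space M] (hρ : 0 < ρ)
    (hρt : Metric.closedBall c ρ ⊆ κ.target) :
    frontier (κ.symm '' Metric.closedBall c ρ) = κ.symm '' Metric.sphere c ρ := by
  have hcl := (isCompact_symm_image_closedBall hρt).isClosed
  have him := (isImage_closedBall hρt).frontier
  rw [frontier_closedBall c hρ.ne'] at him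
  ext x
  constructor
  · intro hx
    have hxs := symm_image_closedBall_subset hρt (hcl.frontier_subset hx)
    exact ⟨κ x, (him hxs).2 hx, κ.left_inv hxs⟩
  · rintro ⟨w, hw, rfl⟩
    have hwt := hρt (Metric.sphere_subset_closedBall hw)
    refine (him (κ.map_target hwt)).1 ?_
    rwa [κ.right_inv hwt]

theorem closure_interior_symm_image_closedBall [T2Space M] (hρ : 0 < ρ)
    (hρt : Metric.closedBall c ρ ⊆ κ.target) :
    closure (interior (κ.symm '' Metric.closedBall c ρ)) = κ.symm '' Metric.closedBall c ρ := by
  have hcl := (isCompact_symm_image_closedBall hρt).isClosed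
  have him := (isImage_closedBall hρt).interior.closure
  rw [interior_closedBall c hρ.ne', closure_ball c hρ.ne'] at him
  refine (closure_minimal interior_subset hcl).antisymm fun x hx => ?_
  have hxs := symm_image_closedBall_subset hρt hx
  exact (him hxs).1 (((isImage_closedBall hρt) hxs).2 hx)

/-- Adding a small coordinate sphere outside of the homology region. -/
theorem IsHomologous.union_sphere [T2Space M] {R X r : Set M} (h : IsHomologous I R X)
    (hr1 : closure (interior r) = r) (hr2 : r ∩ I.boundary M = R) (hr3 : frontier r = X)
    (hκ : IsInteriorCoord I κ) (hρ : 0 < ρ) (hρt : Metric.closedBall c ρ ⊆ κ.target)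
    (hdisj : Disjoint r (κ.symm '' Metric.closedBall c ρ))
    (hbd : Disjoint (I.boundary M) (κ.symm '' Metric.closedBall c ρ)) :
    IsHomologous I R (X ∪ κ.symm '' Metric.sphere c ρ) := by
  have hX := h.isSurface
  have hrc : IsClosed r := hr1 ▸ isClosed_closure
  have hXr : X ⊆ r := hr3 ▸ hrc.frontier_subset
  have hBk := isCompact_symm_image_closedBall hρt
  have hBc := hBk.isClosed
  set B := κ.symm '' Metric.closedBall c ρ with hB
  set S := κ.symm '' Metric.sphere c ρ with hS
  have hfr : frontier B = S := frontier_symm_image_closedBall hρ hρt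
  have hSB : S ⊆ B := hfr ▸ hBc.frontier_subset
  have hSk : IsCompact S := hBk.of_isClosed_subset (hfr ▸ isClosed_frontier) hSB
  have hSb : ∀ x ∈ S, x ∉ I.boundary M := fun x hx hb => Set.disjoint_left.1 hbd hb (hSB hx)
  -- Since `r` and `B` are disjoint closed sets, defining functions of `X` are used on `U \ B` and
  -- those of the sphere on `κ.source \ r`, where the other component is absent.
  have hUX : ∀ U : Set M, (X ∪ S) ∩ (U \ B) = X ∩ U := by
    intro U
    ext x
    constructor
    · rintro ⟨hx | hx, hxU, hxB⟩
      · exact ⟨hx, hxU⟩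
      · exact (hxB (hSB hx)).elim
    · rintro ⟨hx, hxU⟩
      exact ⟨Or.inl hx, hxU, Set.disjoint_left.1 hdisj (hXr hx)⟩
  have hsub : ∀ (U : Set M) (P : M → Prop), X ∩ U = {q ∈ U | P q} →
      X ∩ U = {q ∈ U \ B | P q} := by
    intro U P hP
    ext x
    have h1 := Set.ext_iff.1 hP x
    refine ⟨fun hx => ⟨⟨hx.2, Set.disjoint_left.1 hdisj (hXr hx.1)⟩, (h1.1 hx).2⟩,
      fun hx => h1.2 ⟨hx.1.1, hx.2⟩⟩
  have hbdX : (X ∪ S) ∩ I.boundary M = X ∩ I.boundary M := by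
    ext x
    refine ⟨fun hx => ⟨hx.1.resolve_right fun hs => hSb x hs hx.2, hx.2⟩,
      fun hx => ⟨Or.inl hx.1, hx.2⟩⟩
  refine ⟨⟨hX.isCompact.union hSk, ?_, ?_, ?_⟩, hbdX.trans h.boundary_eq, r ∪ B, ?_, ?_, ?_⟩
  · refine union_subset (hX.dense_interior.trans (closure_mono ?_)) fun x hx =>
      subset_closure ⟨Or.inr hx, hSb x hx⟩
    exact sdiff_subset_sdiff_left subset_union_left
  · rintro p (hp | hp) hpb
    · obtain ⟨U, f, hU, hpU, hf, hdf, hXU⟩ := hX.interior_point p hp hpb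
      refine ⟨U \ B, f, hU.sdiff hBc, ⟨hpU, Set.disjoint_left.1 hdisj (hXr hp)⟩,
        hf.mono sdiff_subset, hdf, ?_⟩
      rw [hUX]
      exact hsub U (fun q => f q = 0) hXU
    · have hps := symm_image_closedBall_subset hρt (hSB hp)
      have hf : ContMDiffOn I 𝓘(ℝ, ℝ) ∞ (fun q => ‖κ q - c‖ ^ 2 - ρ ^ 2) (κ.source \ r) := by
        have h1 : ContDiff ℝ ∞ (fun z : E => ‖z - c‖ ^ 2 - ρ ^ 2) :=
          ((contDiff_id.sub contDiff_const).norm_sq ℝ).sub contDiff_const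
        exact h1.contMDiff.comp_contMDiffOn (hκ.smooth.mono sdiff_subset)
      have hU : IsOpen (κ.source \ r) := κ.open_source.sdiff hrc
      have hpU : p ∈ κ.source \ r := ⟨hps, Set.disjoint_right.1 hdisj (hSB hp)⟩
      have hmem : ∀ q ∈ κ.source, q ∈ S ↔ ‖κ q - c‖ ^ 2 - ρ ^ 2 = 0 := by
        intro q hq
        rw [sub_eq_zero, sq_eq_sq₀ (norm_nonneg _) hρ.le, ← mem_sphere_iff_norm]
        constructor
        · rintro ⟨w, hw, rfl⟩
          rwa [κ.right_inv (hρt (Metric.sphere_subset_closedBall hw))]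
        · exact fun h => ⟨κ q, h, κ.left_inv hq⟩
      refine ⟨κ.source \ r, _, hU, hpU, hf, fun h0 => ?_, ?_⟩
      · have h1 := (hκ.fderiv_comp_symm_eq_zero_iff hps
          (hf.mdifferentiableAt_of_isOpen hU hpU)).2 h0
        have h2 : ((fun q => ‖κ q - c‖ ^ 2 - ρ ^ 2) ∘ κ.symm) =ᶠ[nhds (κ p)]
            fun z => ‖z - c‖ ^ 2 - ρ ^ 2 := by
          filter_upwards [κ.open_target.mem_nhds (κ.map_source hps)] with z hz
          simp only [Function.comp, κ.right_inv hz]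
        have h3 : HasFDerivAt (fun z : E => ‖z - c‖ ^ 2 - ρ ^ 2)
            (2 • (innerSL ℝ (κ p - c))) (κ p) :=
          (((hasFDerivAt_id (κ p)).sub_const c).norm_sq).sub_const _
        rw [h2.fderiv_eq, h3.fderiv] at h1
        -- Evaluated on the radial vector `κ p - c`, the differential is `2 ρ ^ 2`, which is not
        -- zero.
        have h4 := congrArg (fun L : E →L[ℝ] ℝ => L (κ p - c)) h1
        simp only [smul_apply, innerSL_apply_apply, real_inner_self_eq_norm_sq,
          zero_apply] at h4
        have h5 := (hmem p hps).1 hp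
        have h6 : 0 < ρ ^ 2 := by positivity
        simp only [nsmul_eq_mul, Nat.cast_ofNat] at h4
        linarith
      · ext q
        constructor
        · rintro ⟨hq | hq, hqs, hqr⟩
          · exact (hqr (hXr hq)).elim
          · exact ⟨⟨hqs, hqr⟩, (hmem q hqs).1 hq⟩
        · rintro ⟨⟨hqs, hqr⟩, hq⟩
          exact ⟨Or.inr ((hmem q hqs).2 hq), hqs, hqr⟩
  · rintro p hp hpb
    have hpX : p ∈ X := hp.resolve_right fun hs => hSb p hs hpb
    obtain ⟨U, f, g, hU, hpU, hf, hg, hli, hXU, hXU'⟩ := hX.boundary_point p hpX hpb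
    refine ⟨U \ B, f, g, hU.sdiff hBc, ⟨hpU, Set.disjoint_left.1 hdisj (hXr hpX)⟩,
      hf.mono sdiff_subset, hg.mono sdiff_subset, hli, ?_, ?_⟩
    · rw [hUX]
      exact hsub U (fun q => f q = 0 ∧ 0 ≤ g q) hXU
    · rw [hbdX]
      ext q
      have h1 := Set.ext_iff.1 hXU' q
      exact ⟨fun hq => ⟨hq.2, (h1.1 ⟨hq.1, hq.2.1⟩).2⟩, fun hq =>
        ⟨(h1.2 ⟨hq.1.1, hq.2⟩).1, hq.1⟩⟩
  · rw [interior_union_of_disjoint hrc hBc hdisj, closure_union, hr1,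
      closure_interior_symm_image_closedBall hρ hρt]
  · rw [union_inter_distrib_right, hr2, inter_comm B, hbd.inter_eq, union_empty]
  · rw [frontier_union_of_disjoint hrc hBc hdisj, hr3, hfr]

/-- A nonempty surface is never the only surface in its homology class. -/
theorem IsHomologous.exists_ne [T2Space M] [Nontrivial E] [IsManifold I ∞ M]
    {R X : Set M} (h : IsHomologous I R X) (hbc : IsClosed (I.boundary M)) (hne : X.Nonempty) :
    ∃ X', IsHomologous I R X' ∧ X' ≠ X := by
  obtain ⟨r, hr1, hr2, hr3⟩ := h.exists_region
  have hrc : IsClosed r := hr1 ▸ isClosed_closure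
  obtain ⟨x, hx⟩ := hne
  obtain ⟨q, hqX, hqb⟩ : (X \ I.boundary M).Nonempty :=
    closure_nonempty_iff.1 ⟨x, h.isSurface.dense_interior hx⟩
  -- An interior point `q` of `X` is a limit of points outside `r`; one of them off the boundary of
  -- `M` is the centre of the sphere.
  have hq : q ∈ closure rᶜ := by
    rw [← hr3, frontier_eq_closure_inter_closure] at hqX
    exact hqX.2
  obtain ⟨p, hpb, hpr⟩ := mem_closure_iff.1 hq _ hbc.isOpen_compl hqb
  let κ := interiorChart I p
  have hpκ : p ∈ κ.source := mem_interiorChart_source hpb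
  have hO : IsOpen (κ.target ∩ κ.symm ⁻¹' (rᶜ ∩ (I.boundary M)ᶜ)) :=
    κ.isOpen_inter_preimage_symm (hrc.isOpen_compl.inter hbc.isOpen_compl)
  obtain ⟨ρ, hρ, hρO⟩ := Metric.nhds_basis_closedBall.mem_iff.1 (hO.mem_nhds
    (x := κ p) ⟨κ.map_source hpκ, by rw [mem_preimage, κ.left_inv hpκ]; exact ⟨hpr, hpb⟩⟩)
  have hρt : Metric.closedBall (κ p) ρ ⊆ κ.target := hρO.trans inter_subset_left
  have hd : Disjoint r (κ.symm '' Metric.closedBall (κ p) ρ) := by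
    rw [Set.disjoint_right]
    rintro _ ⟨w, hw, rfl⟩
    exact (hρO hw).2.1
  refine ⟨_, h.union_sphere hr1 hr2 hr3 (isInteriorCoord_interiorChart p) hρ hρt hd ?_, ?_⟩
  · rw [Set.disjoint_right]
    rintro _ ⟨w, hw, rfl⟩
    exact (hρO hw).2.2
  · intro heq
    obtain ⟨w, hw⟩ := (NormedSpace.sphere_nonempty (x := κ p) (r := ρ)).2 hρ.le
    have h1 : κ.symm w ∈ X := heq ▸ Or.inr ⟨w, hw, rfl⟩
    rw [← hr3] at h1
    exact Set.disjoint_left.1 hd (hrc.frontier_subset h1)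
      ⟨w, Metric.sphere_subset_closedBall hw, rfl⟩

end AddSphere

/-! ### Local lower bound for the product metric. -/

section ProductLowerBound

variable {E : Type*} [NormedAddCommGroup E] [NormedSpace ℝ E] [FiniteDimensional ℝ E]
  {H : Type*} [TopologicalSpace H]
  {I : ModelWithCorners ℝ E H} {M : Type*} [TopologicalSpace M] [ChartedSpace H M]
  [IsManifold I ∞ M]
  {F : Type*} [NormedAddCommGroup F] [NormedSpace ℝ F] [FiniteDimensional ℝ F]
  {G : Type*} [TopologicalSpace G] {J : ModelWithCorners ℝ F G} {Y : Type*} [TopologicalSpace Y]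
  [ChartedSpace G Y] [IsManifold J ∞ Y]
  (gM : ContMDiffRiemannianMetric I ∞ E (fun x : M => TangentSpace I x))
  (gY : ContMDiffRiemannianMetric J ∞ F (fun y : Y => TangentSpace J y))

/-- In product coordinates near `p`, the product metric is bounded below by the norm. -/
theorem exists_norm_sq_le_productMetric {d : ℕ} {κ : OpenPartialHomeomorph M E}
    (hκ : IsInteriorCoord I κ) {κ' : OpenPartialHomeomorph Y F} (hκ' : IsInteriorCoord J κ')
    {O : Set (M × Y)} (hO : IsOpen O) {p : M × Y} (hp : p ∈ O) (hpκ : p.1 ∈ κ.source)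
    (hpκ' : p.2 ∈ κ'.source) :
    ∃ V : Set (M × Y), IsOpen V ∧ p ∈ V ∧ V ⊆ O ∧ V ⊆ (κ.prod κ').source ∧ ∃ c > 0,
      ∀ (φ : EuclideanSpace ℝ (Fin d) → M × Y) (u : EuclideanSpace ℝ (Fin d)),
        MDifferentiableAt (𝓡 d) (I.prod J) φ u → φ u ∈ V → ∀ a,
        ‖fderiv ℝ (fun u => (κ.prod κ') (φ u)) u a‖ ^ 2 ≤
          c * pullbackForm (productMetric gM.inner gY.inner) φ u a a := by
  obtain ⟨c₁, hc₁, r₁, hr₁, -, h₁⟩ :=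
    exists_mul_norm_sq_le_pullbackForm gM hκ (κ.map_source hpκ)
  obtain ⟨c₂, hc₂, r₂, hr₂, -, h₂⟩ :=
    exists_mul_norm_sq_le_pullbackForm gY hκ' (κ'.map_source hpκ')
  let V₀ : Set (M × Y) := (κ.source ∩ κ ⁻¹' Metric.ball (κ p.1) r₁) ×ˢ
    (κ'.source ∩ κ' ⁻¹' Metric.ball (κ' p.2) r₂)
  have hV₀ : IsOpen V₀ := (κ.isOpen_inter_preimage Metric.isOpen_ball).prod
    (κ'.isOpen_inter_preimage Metric.isOpen_ball)
  refine ⟨O ∩ V₀, hO.inter hV₀, ⟨hp, ⟨hpκ, Metric.mem_ball_self hr₁⟩,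
    ⟨hpκ', Metric.mem_ball_self hr₂⟩⟩, inter_subset_left, fun q hq => ⟨hq.2.1.1, hq.2.2.1⟩,
    (min c₁ c₂)⁻¹, by positivity, fun φ u hφ hu a => ?_⟩
  have hd₁ : DifferentiableAt ℝ (fun u => κ (φ u).1) u := mdifferentiableAt_iff_differentiableAt.1
    ((hκ.smooth.mdifferentiableAt_of_isOpen κ.open_source hu.2.1.1).comp u hφ.fst)
  have hd₂ : DifferentiableAt ℝ (fun u => κ' (φ u).2) u := mdifferentiableAt_iff_differentiableAt.1
    ((hκ'.smooth.mdifferentiableAt_of_isOpen κ'.open_source hu.2.2.1).comp u hφ.snd)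
  have hder : fderiv ℝ (fun u => (κ.prod κ') (φ u)) u a =
      (fderiv ℝ (fun u => κ (φ u).1) u a, fderiv ℝ (fun u => κ' (φ u).2) u a) :=
    congrArg (fun T => T a) (hd₁.fderiv_prodMk hd₂)
  rw [hder, pullbackForm_productMetric _ _ hφ, pullbackForm_chart gM hκ hφ.fst hu.2.1.1,
    pullbackForm_chart gY hκ' hφ.snd hu.2.2.1]
  have e₁ := h₁ _ hu.2.1.2 (fderiv ℝ (fun u => κ (φ u).1) u a)
  have e₂ := h₂ _ hu.2.2.2 (fderiv ℝ (fun u => κ' (φ u).2) u a)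
  have hmin : 0 < min c₁ c₂ := lt_min hc₁ hc₂
  rw [inv_mul_eq_div, le_div_iff₀ hmin, Prod.norm_def]
  have s₁ := sq_nonneg ‖fderiv ℝ (fun u => κ (φ u).1) u a‖
  have s₂ := sq_nonneg ‖fderiv ℝ (fun u => κ' (φ u).2) u a‖
  have m₁ := mul_le_mul_of_nonneg_right (min_le_left c₁ c₂) s₁
  have m₂ := mul_le_mul_of_nonneg_right (min_le_right c₁ c₂) s₂
  have n₁ := mul_nonneg hmin.le s₁
  have n₂ := mul_nonneg hmin.le s₂
  rw [mul_comm]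
  -- The product carries the maximum norm, whose square is at most the sum of the two squares.
  rcases max_choice ‖fderiv ℝ (fun u => κ (φ u).1) u a‖ ‖fderiv ℝ (fun u => κ' (φ u).2) u a‖
    with h | h <;> rw [h] <;> linarith

end ProductLowerBound

/-! ### Minimality and uniqueness of `X × Y`. -/

section Main

variable {n m : ℕ}
  {M : Type*} [TopologicalSpace M] [T2Space M] [CompactSpace M]
  [ChartedSpace (EuclideanHalfSpace (n + 1)) M] [IsManifold (𝓡∂ (n + 1)) ∞ M]
  {Y : Type*} [TopologicalSpace Y] [T2Space Y] [CompactSpace Y]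
  [ChartedSpace (EuclideanSpace ℝ (Fin m)) Y] [IsManifold (𝓡 m) ∞ Y]
  (gM : ContMDiffRiemannianMetric (𝓡∂ (n + 1)) ∞ (EuclideanSpace ℝ (Fin (n + 1)))
    (fun x : M => TangentSpace (𝓡∂ (n + 1)) x))
  (gY : ContMDiffRiemannianMetric (𝓡 m) ∞ (EuclideanSpace ℝ (Fin m))
    (fun y : Y => TangentSpace (𝓡 m) y))
  {R : Set M} {X : Set M} {X' : Set (M × Y)}

omit [T2Space M] [T2Space Y] [IsManifold (𝓡 m) ∞ Y] in
theorem IsHomologous.ae_isTransverseAt (C : ChartPartition (𝓡 m) Y)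
    (h : IsHomologous ((𝓡∂ (n + 1)).prod (𝓡 m)) (R ×ˢ univ) X') (j : Fin C.num) :
    ∀ᵐ v, v ∈ (C.chart j).target → ∀ x, x ∉ (𝓡∂ (n + 1)).boundary M →
      (x, (C.chart j).symm v) ∈ X' →
        IsTransverseAt (𝓡∂ (n + 1)) (𝓡 m) X' (x, (C.chart j).symm v) := by
  have : SecondCountableTopology (EuclideanHalfSpace (n + 1)) :=
    inferInstanceAs (SecondCountableTopology {x : EuclideanSpace ℝ (Fin (n + 1)) // 0 ≤ x 0})
  have : SecondCountableTopology M :=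
    ChartedSpace.secondCountable_of_sigmaCompact (EuclideanHalfSpace (n + 1)) M
  have : SecondCountableTopology Y :=
    ChartedSpace.secondCountable_of_sigmaCompact (EuclideanSpace ℝ (Fin m)) Y
  exact h.isSurface.ae_isTransverseAt volume (C.isInteriorCoord j)

/-- Almost every slice is homologous to `R`. -/
theorem IsHomologous.ae_slice (C : ChartPartition (𝓡 m) Y)
    (h : IsHomologous ((𝓡∂ (n + 1)).prod (𝓡 m)) (R ×ˢ univ) X') (j : Fin C.num) :
    ∀ᵐ v, v ∈ C.piece j →
      IsHomologous (𝓡∂ (n + 1)) R {x | (x, (C.chart j).symm v) ∈ X'} := by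
  filter_upwards [h.ae_isTransverseAt C j] with v hv hvp
  exact h.slice fun x hx hxX => hv (C.piece_subset j hvp) x hx hxX

/-- Almost every slice is a competitor of `X`, so `area X` is below the coarea majorant `g` almost
everywhere; integrate over `Y`. -/
theorem IsMinimal.mul_totalVolume_le [Nonempty M] (C : ChartPartition (𝓡 m) Y)
    (hX : IsMinimal (𝓡∂ (n + 1)) gM.inner n R X)
    (h : IsHomologous ((𝓡∂ (n + 1)).prod (𝓡 m)) (R ×ˢ univ) X') :
    area (𝓡∂ (n + 1)) gM.inner n X * C.totalVolume gY ≤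
      area ((𝓡∂ (n + 1)).prod (𝓡 m)) (productMetric gM.inner gY.inner) (n + m) X' := by
  obtain ⟨g, -, hg2, hg3⟩ := exists_coarea_of_ae_isTransverseAt (n := n) gM gY C (by simp)
    (h.ae_isTransverseAt C)
  refine (C.mul_totalVolume_le gY fun j => ?_).trans hg2
  filter_upwards [hg3 j, h.ae_slice C j] with v hv hs hvp
  exact (hX.2 _ (hs hvp)).trans (hv hvp)

theorem IsMinimal.prod_univ (hX : IsMinimal (𝓡∂ (n + 1)) gM.inner n R X) :
    IsMinimal ((𝓡∂ (n + 1)).prod (𝓡 m)) (productMetric gM.inner gY.inner) (n + m)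
      (R ×ˢ univ) (X ×ˢ (univ : Set Y)) := by
  refine ⟨hX.1.prod_univ, fun X' hX' => ?_⟩
  -- Nonemptiness is used to pad coverings and to have nonzero volume; if the product is empty, all
  -- its subsets coincide.
  rcases isEmpty_or_nonempty (M × Y) with hMY | hMY
  · rw [Subsingleton.elim X' (X ×ˢ univ)]
  · obtain ⟨x, y⟩ := hMY.some
    have : Nonempty M := ⟨x⟩
    have : Nonempty Y := ⟨y⟩
    obtain ⟨C⟩ := nonempty_chartPartition (𝓡 m) Y
    exact (area_prod_univ_le gY gM C X).trans (hX.mul_totalVolume_le gM gY C hX')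

-- Finiteness comes from uniqueness rather than from compactness. If the minimal area were infinite,
-- every surface in the class would be minimal, but a nonempty `X` has a competitor different from
-- it by `IsHomologous.exists_ne`; an empty `X` has area zero.
omit [CompactSpace M] in
theorem IsUniqueMinimal.area_ne_top [Nonempty M]
    (hX : IsUniqueMinimal (𝓡∂ (n + 1)) gM.inner n R X) :
    area (𝓡∂ (n + 1)) gM.inner n X ≠ ⊤ := by
  intro htop
  have hne : X.Nonempty := by
    rw [nonempty_iff_ne_empty]
    rintro rfl
    have h := area_le_tsum (ι := Empty) (d := n) gM.inner (X := (∅ : Set M)) (fun i => i.elim)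
      (fun i => i.elim) (fun i => i.elim) (fun i => i.elim) (by simp)
    rw [htop, tsum_empty] at h
    exact absurd h (by simp)
  obtain ⟨X', hX', hXX'⟩ := hX.1.1.exists_ne (ModelWithCorners.isClosed_boundary (n := ∞) (by simp)) hne
  refine hXX' (hX.2 X' ⟨hX', fun X'' hX'' => ?_⟩)
  rw [top_le_iff.1 (htop.symm.le.trans (hX.1.2 X'' hX''))]
  exact le_top

/-- If `X` is the unique minimizer, then almost every slice of a minimizer in the product is `X`. -/
theorem IsUniqueMinimal.ae_slice_eq [Nonempty M] [Nonempty Y] (C : ChartPartition (𝓡 m) Y)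
    (hX : IsUniqueMinimal (𝓡∂ (n + 1)) gM.inner n R X)
    (h : IsHomologous ((𝓡∂ (n + 1)).prod (𝓡 m)) (R ×ˢ univ) X')
    (harea : area ((𝓡∂ (n + 1)).prod (𝓡 m)) (productMetric gM.inner gY.inner) (n + m) X' ≤
      area (𝓡∂ (n + 1)) gM.inner n X * C.totalVolume gY) (j : Fin C.num) :
    ∀ᵐ v, v ∈ C.piece j → {x | (x, (C.chart j).symm v) ∈ X'} = X := by
  obtain ⟨g, hg1, hg2, hg3⟩ := exists_coarea_of_ae_isTransverseAt (n := n) gM gY C (by simp)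
    (h.ae_isTransverseAt C)
  -- The integral of `g` is squeezed between `area X * vol Y` and itself, so `g = area X` almost
  -- everywhere; the slice then attains the minimal area and uniqueness in `M` identifies it.
  have hle : ∀ j, ∀ᵐ v, v ∈ C.piece j → area (𝓡∂ (n + 1)) gM.inner n X ≤ g j v := fun j => by
    filter_upwards [hg3 j, h.ae_slice C j] with v hv hs hvp
    exact (hX.1.2 _ (hs hvp)).trans (hv hvp)
  filter_upwards [hg3 j, h.ae_slice C j, C.ae_eq_of_le_mul_totalVolume gY (hX.area_ne_top gM) hg1
    hle (hg2.trans harea) j] with v hv hs heq hvp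
  refine hX.2 _ ⟨hs hvp, fun X'' hX'' => (hv hvp).trans ?_⟩
  rw [heq hvp]
  exact hX.1.2 _ hX''

omit [T2Space M] [CompactSpace M] [T2Space Y] [CompactSpace Y] in
/-- A surface in the product has a definite amount of area near each of its interior points. -/
theorem IsSurface.exists_area_lower_bound
    (h : IsSurface ((𝓡∂ (n + 1)).prod (𝓡 m)) X') {O : Set (M × Y)} (hO : IsOpen O) {p : M × Y}
    (hpO : p ∈ O) (hpX' : p ∈ X') (hpb : p ∉ ((𝓡∂ (n + 1)).prod (𝓡 m)).boundary (M × Y)) :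
    ∃ W : Set (M × Y), IsOpen W ∧ W ⊆ O ∧ ∃ δ : ℝ≥0∞, δ ≠ 0 ∧
      ∀ (φ : ℕ → LocalParam ((𝓡∂ (n + 1)).prod (𝓡 m)) (n + m)
          (X' \ ((𝓡∂ (n + 1)).prod (𝓡 m)).boundary (M × Y)))
        (A : ℕ → Set (EuclideanSpace ℝ (Fin (n + m)))), (∀ i, MeasurableSet (A i)) →
        (∀ i, A i ⊆ (φ i).source) →
        X' \ ((𝓡∂ (n + 1)).prod (𝓡 m)).boundary (M × Y) ⊆ ⋃ i, (φ i).toFun '' A i →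
        δ ≤ ∑' i, ∫⁻ u in A i ∩ (φ i).toFun ⁻¹' W,
          areaDensity (productMetric gM.inner gY.inner) (φ i).toFun u := by
  obtain ⟨U, f, hU, hpU, hf, hdf, hXU⟩ := h.interior_point p hpX' hpb
  have hbo : IsOpen (((𝓡∂ (n + 1)).prod (𝓡 m)).boundary (M × Y))ᶜ := by
    have h1 : ((𝓡∂ (n + 1)).prod (𝓡 m)).boundary (M × Y) =
        Prod.fst ⁻¹' ((𝓡∂ (n + 1)).boundary M) := by
      ext p
      exact mem_boundary_prod
    have h2 : IsClosed ((𝓡∂ (n + 1)).boundary M) :=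
      ModelWithCorners.isClosed_boundary (n := ∞) (by simp)
    rw [h1]
    exact (h2.preimage continuous_fst).isOpen_compl
  have hb2 : p.2 ∉ (𝓡 m).boundary Y := by
    rw [ModelWithCorners.Boundaryless.boundary_eq_empty]
    exact notMem_empty _
  have hκ := isInteriorCoord_interiorChart (I := 𝓡∂ (n + 1)) p.1
  have hκ' := isInteriorCoord_interiorChart (I := 𝓡 m) p.2
  obtain ⟨V, hV, hpV, hVO, hVs, c, hc, hbound⟩ := exists_norm_sq_le_productMetric (d := n + m)
    gM gY hκ hκ' (hU.inter (hO.inter hbo)) (p := p) ⟨hpU, hpO, hpb⟩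
    (mem_interiorChart_source fun hb => hpb (mem_boundary_prod.2 hb))
    (mem_interiorChart_source hb2)
  have hfp : p ∈ {q ∈ U | f q = 0} := hXU ▸ ⟨hpX', hpU⟩
  have hS : ∀ q ∈ V, f q = 0 → q ∈ X' \ ((𝓡∂ (n + 1)).prod (𝓡 m)).boundary (M × Y) := by
    intro q hq hfq
    have h3 : q ∈ X' ∩ U := hXU.symm ▸ ⟨(hVO hq).1, hfq⟩
    exact ⟨h3.1, (hVO hq).2.2⟩
  have hdim : Module.finrank ℝ (EuclideanSpace ℝ (Fin (n + 1)) × EuclideanSpace ℝ (Fin m)) =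
      n + m + 1 := by
    simp
    omega
  obtain ⟨W, hW, -, hWV, δ, hδ, hlow⟩ := MinimalSurface.exists_area_lower_bound hdim
    (productMetric gM.inner gY.inner)
    (fun p v w => congrArg₂ (· + ·) (gM.symm p.1 v.1 w.1) (gY.symm p.2 v.2 w.2))
    (hκ.prod hκ') hV hc hbound hVs (hf.mono fun q hq => (hVO hq).1) hS hpV hfp.2 hdf
  exact ⟨W, hW, fun q hq => (hVO (hWV hq)).2.1, δ, hδ, hlow⟩

omit [T2Space M] [T2Space Y] in
/-- If almost every slice of a surface is `X`, then parts of the surface away from `X × Y`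
contribute additional area. -/
theorem IsHomologous.add_le_area [Nonempty M] (C : ChartPartition (𝓡 m) Y)
    (h : IsHomologous ((𝓡∂ (n + 1)).prod (𝓡 m)) (R ×ˢ univ) X')
    (hslice : ∀ j, ∀ᵐ v, v ∈ C.piece j → {x | (x, (C.chart j).symm v) ∈ X'} = X)
    {W : Set (M × Y)} (hW : IsOpen W) (hWX : W ⊆ (X ×ˢ univ)ᶜ) {δ : ℝ≥0∞}
    (hlow : ∀ (φ : ℕ → LocalParam ((𝓡∂ (n + 1)).prod (𝓡 m)) (n + m)
          (X' \ ((𝓡∂ (n + 1)).prod (𝓡 m)).boundary (M × Y)))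
        (A : ℕ → Set (EuclideanSpace ℝ (Fin (n + m)))), (∀ i, MeasurableSet (A i)) →
        (∀ i, A i ⊆ (φ i).source) →
        X' \ ((𝓡∂ (n + 1)).prod (𝓡 m)).boundary (M × Y) ⊆ ⋃ i, (φ i).toFun '' A i →
        δ ≤ ∑' i, ∫⁻ u in A i ∩ (φ i).toFun ⁻¹' W,
          areaDensity (productMetric gM.inner gY.inner) (φ i).toFun u) :
    area (𝓡∂ (n + 1)) gM.inner n X * C.totalVolume gY + δ ≤
      area ((𝓡∂ (n + 1)).prod (𝓡 m)) (productMetric gM.inner gY.inner) (n + m) X' := by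
  refine le_iInf₂ fun φ A => le_iInf₂ fun hA hcov => ?_
  have hWm : ∀ i, MeasurableSet (A i ∩ (φ i).toFun ⁻¹' W) := fun i => by
    have hm := ((φ i).contMDiffOn.continuousOn.isOpen_inter_preimage (φ i).isOpen_source
      hW).measurableSet
    convert (hA i).1.inter hm using 1
    ext u
    exact ⟨fun h => ⟨h.1, (hA i).2 h.1, h.2⟩, fun h => ⟨h.1, h.2.2⟩⟩
  -- The part of each piece lying in `W` is removed. Almost every slice equals `X`, which misses
  -- `W`, so what remains still covers it and accounts for `area X * vol Y`; the removed parts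
  -- contribute at least `δ` on top.
  obtain ⟨g, hg1, hg2, hg3⟩ := exists_coarea_of_family (n := n) gM gY C (by simp) φ
    (fun i => A i \ (A i ∩ (φ i).toFun ⁻¹' W)) (fun i => (hA i).1.diff (hWm i))
    (fun i => sdiff_subset.trans (hA i).2)
  have hle : ∀ j, ∀ᵐ v, v ∈ C.piece j → area (𝓡∂ (n + 1)) gM.inner n X ≤ g j v := fun j => by
    filter_upwards [hslice j, h.ae_isTransverseAt C j] with v hv htr hvp
    have hle := hg3 j v hvp fun x hx hxX => by
      refine ⟨htr (C.piece_subset j hvp) x hx hxX, ?_⟩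
      obtain ⟨i, u, hu, hux⟩ := mem_iUnion.1 (hcov ⟨hxX, fun hb => hx (mem_boundary_prod.1 hb)⟩)
      refine mem_iUnion.2 ⟨i, u, ⟨hu, fun huW => hWX huW.2 ?_⟩, hux⟩
      have hxX2 : x ∈ {x | (x, (C.chart j).symm v) ∈ X'} := hxX
      rw [hv hvp] at hxX2
      rw [hux]
      exact ⟨hxX2, mem_univ _⟩
    rwa [hv hvp] at hle
  have hsum := add_le_add ((C.mul_totalVolume_le gY hle).trans hg2)
    (hlow φ A (fun i => (hA i).1) (fun i => (hA i).2) hcov)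
  refine hsum.trans_eq ?_
  rw [← ENNReal.tsum_add]
  refine tsum_congr fun i => ?_
  rw [add_comm]
  have hsplit := lintegral_inter_add_sdiff (μ := volume)
    (areaDensity (productMetric gM.inner gY.inner) (φ i).toFun) (A i) (hWm i)
  rw [inter_eq_self_of_subset_right inter_subset_left] at hsplit
  exact hsplit

/-- One inclusion is the absence of extra area: a point of `X'` off `X × Y` yields an interior one
by density, and `add_le_area` contradicts `harea`. The other holds because almost every slice is
`X`, these parameters are dense in `Y`, and `X'` is closed. -/
theorem IsUniqueMinimal.eq_prod_univ [Nonempty M] [Nonempty Y] (C : ChartPartition (𝓡 m) Y)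
    (hX : IsUniqueMinimal (𝓡∂ (n + 1)) gM.inner n R X)
    (h : IsHomologous ((𝓡∂ (n + 1)).prod (𝓡 m)) (R ×ˢ univ) X')
    (harea : area ((𝓡∂ (n + 1)).prod (𝓡 m)) (productMetric gM.inner gY.inner) (n + m) X' ≤
      area (𝓡∂ (n + 1)) gM.inner n X * C.totalVolume gY) : X' = X ×ˢ univ := by
  have hslice := hX.ae_slice_eq gM gY C h harea
  have hX'c : IsClosed X' := h.isSurface.isCompact.isClosed
  have hXc : IsClosed (X ×ˢ (univ : Set Y)) :=
    hX.1.1.isSurface.isCompact.isClosed.prod isClosed_univ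
  apply Subset.antisymm
  · by_contra hsub
    obtain ⟨q, hq, hqX⟩ := not_subset.1 hsub
    obtain ⟨p, hpX, hpX', hpb⟩ := mem_closure_iff.1 (h.isSurface.dense_interior hq) _
      hXc.isOpen_compl hqX
    obtain ⟨W, hW, hWX, δ, hδ, hlow⟩ :=
      h.isSurface.exists_area_lower_bound gM gY hXc.isOpen_compl hpX hpX' hpb
    have hfin : area (𝓡∂ (n + 1)) gM.inner n X * C.totalVolume gY ≠ ⊤ :=
      ENNReal.mul_ne_top (hX.area_ne_top gM) (C.totalVolume_ne_top gY)
    exact (ENNReal.lt_add_right hfin hδ).not_ge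
      ((h.add_le_area gM gY C hslice hW hWX hlow).trans harea)
  · rintro ⟨x, y⟩ ⟨hx, -⟩
    have hd := C.dense_of_ae (fun y => (x, y) ∈ X') fun j => by
      filter_upwards [hslice j] with v hv hvp
      have hxv : x ∈ {x | (x, (C.chart j).symm v) ∈ X'} := (hv hvp).symm ▸ hx
      exact hxv
    have hcl : IsClosed {y : Y | (x, y) ∈ X'} := hX'c.preimage (by fun_prop)
    exact hcl.closure_eq.subset (hd y)

theorem IsUniqueMinimal.prod_univ (hX : IsUniqueMinimal (𝓡∂ (n + 1)) gM.inner n R X) :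
    IsUniqueMinimal ((𝓡∂ (n + 1)).prod (𝓡 m)) (productMetric gM.inner gY.inner) (n + m)
      (R ×ˢ univ) (X ×ˢ (univ : Set Y)) := by
  refine ⟨hX.1.prod_univ gM gY, fun X' hX' => ?_⟩
  rcases isEmpty_or_nonempty (M × Y) with hMY | hMY
  · exact Subsingleton.elim _ _
  · obtain ⟨x, y⟩ := hMY.some
    have : Nonempty M := ⟨x⟩
    have : Nonempty Y := ⟨y⟩
    obtain ⟨C⟩ := nonempty_chartPartition (𝓡 m) Y
    exact hX.eq_prod_univ gM gY C hX'.1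
      ((hX'.2 _ hX.1.1.prod_univ).trans (area_prod_univ_le gY gM C X))

end Main

end

end MinimalSurface

theorem mainTheorem3 {n m : ℕ}
    {M : Type*} [TopologicalSpace M] [T2Space M] [CompactSpace M]
    [ChartedSpace (EuclideanHalfSpace (n + 1)) M] [IsManifold (𝓡∂ (n + 1)) ∞ M]
    {Y : Type*} [TopologicalSpace Y] [T2Space Y] [CompactSpace Y]
    [ChartedSpace (EuclideanSpace ℝ (Fin m)) Y] [IsManifold (𝓡 m) ∞ Y]
    (gM : ContMDiffRiemannianMetric (𝓡∂ (n + 1)) ∞ (EuclideanSpace ℝ (Fin (n + 1)))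
      (fun x : M => TangentSpace (𝓡∂ (n + 1)) x))
    (gY : ContMDiffRiemannianMetric (𝓡 m) ∞ (EuclideanSpace ℝ (Fin m))
      (fun y : Y => TangentSpace (𝓡 m) y))
    (R : Set M) (hR : MinimalSurface.IsBoundaryRegion (𝓡∂ (n + 1)) R) (X : Set M) :
    (MinimalSurface.IsMinimal (𝓡∂ (n + 1)) gM.inner n R X →
      MinimalSurface.IsMinimal ((𝓡∂ (n + 1)).prod (𝓡 m))
        (MinimalSurface.productMetric gM.inner gY.inner) (n + m) (R ×ˢ univ) (X ×ˢ univ)) ∧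
    (MinimalSurface.IsUniqueMinimal (𝓡∂ (n + 1)) gM.inner n R X →
      MinimalSurface.IsUniqueMinimal ((𝓡∂ (n + 1)).prod (𝓡 m))
        (MinimalSurface.productMetric gM.inner gY.inner) (n + m) (R ×ˢ univ) (X ×ˢ univ)) := by
  exact ⟨fun h => h.prod_univ gM gY, fun h => h.prod_univ gM gY⟩
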